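/- Let $\alpha\ge 0$ and let $f:\mathbb{R}\to\mathbb{R}$ be continuously differentiable with $f'(0)<0$, $\xi f(\xi)<0$ for all $\xi\neq 0$, $\lim_{\xi\to\infty}f(\xi)=-a$ and $\lim_{\xi\to-\infty}f(\xi)=b$ for some $a,b>0$, $\int_{\mathbb{R}}|f'(\xi)|\,d\xi<\infty$ and $\lim_{|\xi|\to\infty}\xi f'(\xi)=0$. For $\beta>0$, a slowly oscillating periodic solution (SOPS) of $$\dot x(t)=-\alpha x(t)+\beta f(x(t-1)),\qquad t>0,$$ is a solution $p$, continuous on $[-1,\infty)$ and continuously differentiable on $(0,\infty)$, for which there are $z_0\ge -1$, $z_1>z_0+1$, $z_2>z_1+1$ with $p>0$ on $(z_0,z_1)$, $p<0$ on $(z_1,z_2)$, and $p(t+\omega)=p(t)$ for all $t\ge -1$, where $\omega=z_2-z_0$. Given a real $n\times n$ matrix $G$ whose rows each sum to $1$, a synchronous SOPS of the coupled system $$\dot x^j(t)=-\alpha x^j(t)+\beta\sum_{k=1}^nG^{jk}f(x^k(t-1)),\qquad j=1,\dots,n,\ t>0,$$ is a solution $\mathbf p=(p,\dots,p)^T$ all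 of whose components equal an SOPS $p$ of the scalar equation. The monodromy operator $\mathbf M$ of $\mathbf p$ is the bounded operator on $C([-1,0],\mathbb{C}^n)$ given by $(\mathbf M\boldsymbol\psi)(\theta)=\mathbf y(\omega+\theta)$, where $\mathbf y$ is the solution of $\dot y^j(t)=-\alpha y^j(t)+\beta\sum_kG^{jk}f'(p(t-1))y^k(t-1)$, $t>0$, with $\mathbf y=\boldsymbol\psi$ on $[-1,0]$. For $\lambda\in\mathbb{C}$ the extended monodromy operator $M_\lambda$ of $p$ is the bounded operator on $C([-1,0],\mathbb{C})$ given by $(M_\lambda\psi)(\theta)=y(\omega+\theta)$, where $y$ is the solution of $\dot y(t)=-\alpha y(t)+\lambda\beta f'(p(t-1))y(t-1)$, $t>0$, with $y=\psi$ on $[-1,0]$. Let $\sigma$ denote the complex spectrum and $\rho$ the spectral radius; an eigenvalue is simple if its generalized eigenspace has dimension $1$. Let $\sigma_{-1}(G)=\sigma(G)\setminus\{1\}$ if $1$ is a simple eigenvalue of $G$, and $\sigma_{-1}(G)=\sigma(G)$ otherwise. The characteristic multipliers of $\mathbf p$ are the nonzero elements of $\sigma(\mathbf M)$; $\mathbf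 p$ is linearly stable if $1$ is a simple eigenvalue of $\mathbf M$ and $|\mu|<1$ for every characteristic multiplier $\mu\ne 1$, and linearly unstable if $|\mu|>1$ for some characteristic multiplier $\mu$. Theorem. There is a constant $\beta_0=\beta_0(\alpha,f)>0$ such that for every $\beta>\beta_0$, every $n\ge 2$, every real $n\times n$ matrix $G$ whose rows each sum to $1$, and every synchronous SOPS $\mathbf p=(p,\dots,p)^T$ of the coupled system, $$\sigma(\mathbf M)=\bigcup_{\lambda\in\sigma(G)}\sigma(M_\lambda),$$ and moreover: (i) if $\rho(M_\lambda)<1$ for all $\lambda\in\sigma_{-1}(G)$, then $\mathbf p$ is linearly stable; (ii) if $\rho(M_\lambda)>1$ for some $\lambda\in\sigma(G)$, then $\mathbf p$ is linearly unstable. -/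

import Mathlib

open Set Filter Topology MeasureTheory

noncomputable section

/-- Standing conditions on the nonlinearity: `f` is continuously differentiable, satisfies a bounded
negative feedback condition, and its derivative decays super-linearly. -/
structure BoundedNegativeFeedback (f : ℝ → ℝ) : Prop where
  contDiff : ContDiff ℝ 1 f
  deriv_zero_neg : deriv f 0 < 0
  feedback : ∀ ξ : ℝ, ξ ≠ 0 → f ξ * ξ < 0
  limits : ∃ a b : ℝ, 0 < a ∧ 0 < b ∧ Tendsto f atTop (𝓝 (-a)) ∧ Tendsto f atBot (𝓝 b)
  integrable_deriv : Integrable (deriv f)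
  decay_atTop : Tendsto (fun ξ => ξ * deriv f ξ) atTop (𝓝 0)
  decay_atBot : Tendsto (fun ξ => ξ * deriv f ξ) atBot (𝓝 0)

/-- The state space `C([-1,0], E)` with the uniform norm. -/
abbrev History (E : Type*) [TopologicalSpace E] := C(Icc (-1 : ℝ) 0, E)

/-- `x` (restricted to `[-1,∞)`) is a solution of `ẋ(t) = R(t, x(t), x(t-1))`, `t > 0`: it is
continuous on `[-1,∞)`, differentiable on `(0,∞)` and satisfies the equation there. For all the
right-hand sides below, the derivative is then automatically continuous on `(0,∞)`.
The values of `x` on `(-∞,-1)` play no role. -/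
def IsDDESolution {E : Type*} [NormedAddCommGroup E] [NormedSpace ℝ E]
    (R : ℝ → E → E → E) (x : ℝ → E) : Prop :=
  ContinuousOn x (Ici (-1)) ∧ ∀ t : ℝ, 0 < t → HasDerivAt x (R t (x t) (x (t - 1))) t

/-- `x_t = φ`, that is, `x(t + θ) = φ(θ)` for `θ ∈ [-1,0]`. -/
def HasHistory {E : Type*} [TopologicalSpace E] (x : ℝ → E) (t : ℝ) (φ : History E) : Prop :=
  ∀ θ : Icc (-1 : ℝ) 0, φ θ = x (t + θ)

/-- Right-hand side of the scalar equation `ẋ(t) = -αx(t) + βf(x(t-1))`. -/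
def scalarRHS (α β : ℝ) (f : ℝ → ℝ) : ℝ → ℝ → ℝ → ℝ :=
  fun _ u v => -α * u + β * f v

/-- Right-hand side of the coupled equation
`ẋ^j(t) = -αx^j(t) + β ∑_k G^{jk} f(x^k(t-1))`. -/
def coupledRHS {n : ℕ} (α β : ℝ) (f : ℝ → ℝ) (G : Matrix (Fin n) (Fin n) ℝ) :
    ℝ → EuclideanSpace ℝ (Fin n) → EuclideanSpace ℝ (Fin n) → EuclideanSpace ℝ (Fin n) :=
  fun _ u v => WithLp.toLp 2 fun j => -α * u j + β * ∑ k, G j k * f (v k)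

/-- `p` is a slowly oscillating periodic solution of the scalar equation, with period `ω`. -/
def IsSOPS (α β : ℝ) (f : ℝ → ℝ) (p : ℝ → ℝ) (ω : ℝ) : Prop :=
  IsDDESolution (scalarRHS α β f) p ∧
  ∃ z₀ z₁ z₂ : ℝ, -1 ≤ z₀ ∧ z₀ + 1 < z₁ ∧ z₁ + 1 < z₂ ∧
    (∀ t, z₀ < t → t < z₁ → 0 < p t) ∧ (∀ t, z₁ < t → t < z₂ → p t < 0) ∧
    ω = z₂ - z₀ ∧ ∀ t, -1 ≤ t → p (t + ω) = p t

/-- `P` is a synchronous SOPS of the coupled equation: a solution all of whose components are equal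
to the SOPS `p` (with period `ω`) of the scalar equation. -/
def IsSynchronousSOPS {n : ℕ} (α β : ℝ) (f : ℝ → ℝ) (G : Matrix (Fin n) (Fin n) ℝ)
    (P : ℝ → EuclideanSpace ℝ (Fin n)) (p : ℝ → ℝ) (ω : ℝ) : Prop :=
  IsDDESolution (coupledRHS α β f G) P ∧ IsSOPS α β f p ω ∧
    ∀ t, -1 ≤ t → ∀ j, P t j = p t

/-- Right-hand side of the variational equation (linearization) of the coupled equation along `P`:
`ẏ^j(t) = -αy^j(t) + β ∑_k G^{jk} f'(P^k(t-1)) y^k(t-1)`. -/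
def variationalRHS {n : ℕ} (α β : ℝ) (f : ℝ → ℝ) (G : Matrix (Fin n) (Fin n) ℝ)
    (P : ℝ → EuclideanSpace ℝ (Fin n)) :
    ℝ → EuclideanSpace ℂ (Fin n) → EuclideanSpace ℂ (Fin n) → EuclideanSpace ℂ (Fin n) :=
  fun t u v => WithLp.toLp 2 fun j =>
    -(α : ℂ) * u j + (β : ℂ) * ∑ k, (G j k : ℂ) * ((deriv f (P (t - 1) k) : ℝ) : ℂ) * v k

/-- Right-hand side of the extended variational equation along `p`:
`ẏ(t) = -αy(t) + lam β f'(p(t-1)) y(t-1)`. -/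
def extendedRHS (α β : ℝ) (f : ℝ → ℝ) (p : ℝ → ℝ) (lam : ℂ) : ℝ → ℂ → ℂ → ℂ :=
  fun t u v => -(α : ℂ) * u + lam * (β : ℂ) * ((deriv f (p (t - 1)) : ℝ) : ℂ) * v

section SolutionOperator

variable {E : Type*} [NormedAddCommGroup E] [NormedSpace ℝ E] [NormedSpace ℂ E]

/-- `M` is the bounded operator `ψ ↦ y_ω`, where `y` is the solution with `y_0 = ψ`. -/
def IsSolutionOperator (R : ℝ → E → E → E) (ω : ℝ) (M : History E →L[ℂ] History E) : Prop :=
  ∀ ψ : History E, ∃ y : ℝ → E, IsDDESolution R y ∧ HasHistory y 0 ψ ∧ HasHistory y ω (M ψ)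

/-- The operator `ψ ↦ y_ω`. It exists and is unique for the linear equations considered here:
see `monodromy_spec` and `extendedMonodromy_spec`. -/
def solutionOperator (R : ℝ → E → E → E) (ω : ℝ) : History E →L[ℂ] History E :=
  Classical.epsilon (IsSolutionOperator R ω)

end SolutionOperator

/-- The monodromy operator of a periodic solution `P`, with period `ω`, of the coupled equation. -/
def monodromy {n : ℕ} (α β : ℝ) (f : ℝ → ℝ) (G : Matrix (Fin n) (Fin n) ℝ)
    (P : ℝ → EuclideanSpace ℝ (Fin n)) (ω : ℝ) :
    History (EuclideanSpace ℂ (Fin n)) →L[ℂ] History (EuclideanSpace ℂ (Fin n)) :=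
  solutionOperator (variationalRHS α β f G P) ω

/-- The extended monodromy operator `M_lam` of an SOPS `p` with period `ω`. -/
def extendedMonodromy (α β : ℝ) (f : ℝ → ℝ) (p : ℝ → ℝ) (ω : ℝ) (lam : ℂ) :
    History ℂ →L[ℂ] History ℂ :=
  solutionOperator (extendedRHS α β f p lam) ω

/-- `μ` is a simple eigenvalue: its generalized eigenspace `⋃_j Null (A - μ)^j` has dimension 1. -/
def IsSimpleEigenvalue {V : Type*} [AddCommGroup V] [Module ℂ V] (A : Module.End ℂ V) (μ : ℂ) :
    Prop :=
  Module.finrank ℂ (A.maxGenEigenspace μ) = 1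

/-- The complex spectrum `σ(G)` of a real matrix. -/
def matrixSpectrum {n : ℕ} (G : Matrix (Fin n) (Fin n) ℝ) : Set ℂ :=
  spectrum ℂ (G.map (fun x : ℝ => (x : ℂ)))

/-- `σ_{-1}(G)`: it is `σ(G) \ {1}` if `1` is a simple eigenvalue of `G`, and `σ(G)` otherwise. -/
def matrixSpectrumMinusOne {n : ℕ} (G : Matrix (Fin n) (Fin n) ℝ) : Set ℂ :=
  {μ | μ ∈ matrixSpectrum G ∧
    (IsSimpleEigenvalue (Matrix.toLin' (G.map (fun x : ℝ => (x : ℂ)))) 1 → μ ≠ 1)}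

/-- The characteristic (Floquet) multipliers of a periodic solution `P` with period `ω`. -/
def characteristicMultipliers {n : ℕ} (α β : ℝ) (f : ℝ → ℝ) (G : Matrix (Fin n) (Fin n) ℝ)
    (P : ℝ → EuclideanSpace ℝ (Fin n)) (ω : ℝ) : Set ℂ :=
  {μ | μ ∈ spectrum ℂ (monodromy α β f G P ω) ∧ μ ≠ 0}

/-- Linear stability: the trivial multiplier `1` is simple, all others lie in the open unit disc. -/
def IsLinearlyStable {n : ℕ} (α β : ℝ) (f : ℝ → ℝ) (G : Matrix (Fin n) (Fin n) ℝ)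
    (P : ℝ → EuclideanSpace ℝ (Fin n)) (ω : ℝ) : Prop :=
  IsSimpleEigenvalue (monodromy α β f G P ω).toLinearMap 1 ∧
    ∀ μ ∈ characteristicMultipliers α β f G P ω, μ ≠ 1 → ‖μ‖ < 1

/-- Linear instability: some multiplier lies outside the closed unit disc. -/
def IsLinearlyUnstable {n : ℕ} (α β : ℝ) (f : ℝ → ℝ) (G : Matrix (Fin n) (Fin n) ℝ)
    (P : ℝ → EuclideanSpace ℝ (Fin n)) (ω : ℝ) : Prop :=
  ∃ μ ∈ characteristicMultipliers α β f G P ω, 1 < ‖μ‖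

/-! ### The solution operators are well defined -/

section WellDefined

set_option linter.unusedSectionVars false

variable {E : Type*} [NormedAddCommGroup E] [NormedSpace ℝ E] [NormedSpace ℂ E]
  [SMulCommClass ℝ ℂ E] [CompleteSpace E]

/-- Two solutions of `ẏ(t) = -αy(t) + B(t)y(t-1)` with the same initial history agree. -/
theorem dde_unique {α : ℝ} {R : ℝ → E → E → E} {B : ℝ → E →L[ℂ] E}
    (hR : ∀ t u v, R t u v = -(α • u) + B t v) {x y : ℝ → E}
    (hx : IsDDESolution R x) (hy : IsDDESolution R y)
    (h0 : ∀ θ ∈ Icc (-1 : ℝ) 0, x θ = y θ) : ∀ t, -1 ≤ t → x t = y t := by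
  have key : ∀ N : ℕ, ∀ t ∈ Icc (-1 : ℝ) N, x t = y t := by
    intro N
    induction N with
    | zero => intro t ht; exact h0 t (by simpa using ht)
    | succ N ih =>
      intro t ht
      by_cases htN : t ≤ N
      · exact ih t ⟨ht.1, htN⟩
      push Not at htN
      have hN0 : (0 : ℝ) ≤ N := Nat.cast_nonneg N
      have ht2 : t ≤ N + 1 := by have := ht.2; push_cast at this; exact this
      set d : ℝ → E := fun s => Real.exp (α * s) • (x s - y s) with hd
      have hcont : ContinuousOn d (Icc (N : ℝ) t) := by
        have hs : Icc (N : ℝ) t ⊆ Ici (-1) := fun s hs => by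
          simp only [mem_Ici]; linarith [hs.1]
        have h1 : ContinuousOn (fun s => x s - y s) (Icc (N : ℝ) t) :=
          (hx.1.mono hs).sub (hy.1.mono hs)
        exact ContinuousOn.smul (by fun_prop) h1
      have hder : ∀ s ∈ Ioo (N : ℝ) t, HasDerivAt d 0 s := by
        intro s hs
        have hs0 : 0 < s := lt_of_le_of_lt hN0 hs.1
        have hprev : x (s - 1) = y (s - 1) :=
          ih (s - 1) ⟨by linarith, by linarith [hs.2]⟩
        have h1 := (hx.2 s hs0).sub (hy.2 s hs0)
        rw [hR, hR, hprev] at h1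
        have h2 : HasDerivAt (fun s : ℝ => Real.exp (α * s)) (Real.exp (α * s) * α) s := by
          have := ((hasDerivAt_id s).const_mul α).exp
          simpa using this
        have h3 := h2.smul h1
        refine h3.congr_deriv ?_
        simp only [Pi.sub_apply]
        rw [mul_smul]
        module
      have hdt : d t = d N := by
        have h := intervalIntegral.integral_eq_sub_of_hasDerivAt_of_le htN.le hcont hder
          (by simp)
        simp only [intervalIntegral.integral_zero] at h
        exact (sub_eq_zero.1 h.symm)
      have hN : x N = y N := ih N ⟨by linarith, le_rfl⟩
      have h4 : d N = 0 := by simp [hd, hN]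
      rw [h4] at hdt
      exact sub_eq_zero.1 ((smul_eq_zero.1 hdt).resolve_left (Real.exp_pos _).ne')
  intro t ht
  obtain ⟨N, hN⟩ := exists_nat_ge t
  exact key N t ⟨ht, hN⟩

/-- Successive approximations, exact on `[-1, N]` after `N` steps. -/
def ddeApprox (α : ℝ) (B : ℝ → E →L[ℂ] E) (ψ : ℝ → E) : ℕ → ℝ → E
  | 0 => ψ
  | N + 1 => fun t => ψ t - ψ 0 + Real.exp (-α * max t 0) •
      (ψ 0 + ∫ s in (0 : ℝ)..max t 0, Real.exp (α * s) • B s (ddeApprox α B ψ N (s - 1)))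

theorem ddeApprox_continuous {α : ℝ} {B : ℝ → E →L[ℂ] E} {ψ : ℝ → E} (hB : Continuous B)
    (hψ : Continuous ψ) (N : ℕ) : Continuous (ddeApprox α B ψ N) := by
  induction N with
  | zero => exact hψ
  | succ N ih =>
    have h1 : Continuous fun s : ℝ => Real.exp (α * s) • B s (ddeApprox α B ψ N (s - 1)) :=
      Continuous.smul (by fun_prop) (hB.clm_apply (by fun_prop))
    have h2 : Continuous fun t : ℝ =>
        ∫ s in (0 : ℝ)..t, Real.exp (α * s) • B s (ddeApprox α B ψ N (s - 1)) :=
      intervalIntegral.continuous_primitive (fun a b => h1.intervalIntegrable a b) 0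
    have h3 := h2.comp (continuous_id.max (continuous_const (y := (0 : ℝ))))
    refine (hψ.sub continuous_const).add (Continuous.smul (by fun_prop) ?_)
    exact continuous_const.add h3

theorem ddeApprox_succ_eq (α : ℝ) (B : ℝ → E →L[ℂ] E) (ψ : ℝ → E) (N : ℕ) :
    ∀ t : ℝ, t ≤ N → ddeApprox α B ψ (N + 1) t = ddeApprox α B ψ N t := by
  induction N with
  | zero =>
    intro t ht
    have : max t 0 = 0 := max_eq_right (by simpa using ht)
    simp [ddeApprox, this]
  | succ N ih =>
    intro t ht
    have h : ∀ s ∈ uIcc (0 : ℝ) (max t 0),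
        Real.exp (α * s) • B s (ddeApprox α B ψ (N + 1) (s - 1)) =
          Real.exp (α * s) • B s (ddeApprox α B ψ N (s - 1)) := by
      intro s hs
      rw [uIcc_of_le (le_max_right _ _)] at hs
      have h1 : max t 0 ≤ N + 1 := max_le (by push_cast at ht; exact ht) (by positivity)
      rw [ih (s - 1) (by linarith [hs.2])]
    have h' := intervalIntegral.integral_congr (μ := volume) h
    change ψ t - ψ 0 + Real.exp (-α * max t 0) • (ψ 0 + ∫ s in (0 : ℝ)..max t 0,
      Real.exp (α * s) • B s (ddeApprox α B ψ (N + 1) (s - 1))) = _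
    rw [h']
    rfl

theorem ddeApprox_eq (α : ℝ) (B : ℝ → E →L[ℂ] E) (ψ : ℝ → E) {N m : ℕ} (hm : N ≤ m) :
    ∀ t : ℝ, t ≤ N → ddeApprox α B ψ m t = ddeApprox α B ψ N t := by
  induction m, hm using Nat.le_induction with
  | base => intro t _; rfl
  | succ m hm ih =>
    intro t ht
    rw [ddeApprox_succ_eq α B ψ m t (ht.trans (by exact_mod_cast hm)), ih t ht]

theorem ddeApprox_bound {α : ℝ} (hα : 0 ≤ α) {B : ℝ → E →L[ℂ] E} (hB : Continuous B) (T : ℝ)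
    (N : ℕ) : ∃ K : ℝ, 0 ≤ K ∧ ∀ (ψ : ℝ → E) (C : ℝ), (∀ t, ‖ψ t‖ ≤ C) →
      ∀ t ≤ T, ‖ddeApprox α B ψ N t‖ ≤ K * C := by
  induction N with
  | zero => exact ⟨1, zero_le_one, fun ψ C h t _ => by simpa [ddeApprox] using h t⟩
  | succ N ih =>
    obtain ⟨K, hK0, hK⟩ := ih
    obtain ⟨b, hb⟩ := (isCompact_Icc (a := (0 : ℝ)) (b := max T 0)).exists_bound_of_continuousOn
      hB.continuousOn
    have hT0 : (0 : ℝ) ≤ max T 0 := le_max_right _ _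
    have hb0 : 0 ≤ b := (norm_nonneg _).trans (hb 0 ⟨le_rfl, hT0⟩)
    set e := Real.exp (α * max T 0) with he
    refine ⟨3 + e * b * K * max T 0, by positivity, fun ψ C h t ht => ?_⟩
    have hC : 0 ≤ C := (norm_nonneg _).trans (h 0)
    have htm : max t 0 ≤ max T 0 := max_le_max ht le_rfl
    have ht0 : (0 : ℝ) ≤ max t 0 := le_max_right _ _
    have hint : ‖∫ s in (0 : ℝ)..max t 0,
        Real.exp (α * s) • B s (ddeApprox α B ψ N (s - 1))‖ ≤ (e * b * (K * C)) * max T 0 := by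
      have h1 : ∀ s ∈ uIoc (0 : ℝ) (max t 0),
          ‖Real.exp (α * s) • B s (ddeApprox α B ψ N (s - 1))‖ ≤ e * b * (K * C) := by
        intro s hs
        rw [uIoc_of_le ht0] at hs
        have hsT : s ≤ max T 0 := hs.2.trans htm
        have hsT' : s - 1 ≤ T := by
          rcases le_total T 0 with hT | hT
          · rw [max_eq_right hT] at hsT; linarith [hs.1, max_le (ht.trans hT) le_rfl, hs.2]
          · rw [max_eq_left hT] at hsT; linarith
        rw [norm_smul, Real.norm_eq_abs, abs_of_pos (Real.exp_pos _), mul_assoc]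
        refine mul_le_mul (Real.exp_le_exp.2 (mul_le_mul_of_nonneg_left hsT hα)) ?_
          (norm_nonneg _) (Real.exp_pos _).le
        exact ((B s).le_opNorm _).trans
          (mul_le_mul (hb s ⟨hs.1.le, hsT⟩) (hK ψ C h _ hsT') (norm_nonneg _) hb0)
      refine (intervalIntegral.norm_integral_le_of_norm_le_const h1).trans ?_
      rw [sub_zero, abs_of_nonneg ht0]
      exact mul_le_mul_of_nonneg_left htm (by positivity)
    have hexp : Real.exp (-α * max t 0) ≤ 1 := by
      rw [Real.exp_le_one_iff]; nlinarith
    have h5 : ‖Real.exp (-α * max t 0) • (ψ 0 + ∫ s in (0 : ℝ)..max t 0,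
        Real.exp (α * s) • B s (ddeApprox α B ψ N (s - 1)))‖ ≤
          C + (e * b * (K * C)) * max T 0 := by
      rw [norm_smul, Real.norm_eq_abs, abs_of_pos (Real.exp_pos _)]
      refine (mul_le_of_le_one_left (norm_nonneg _) hexp).trans ?_
      exact (norm_add_le _ _).trans (add_le_add (h 0) hint)
    rw [ddeApprox]
    refine (norm_add_le _ _).trans ?_
    have h6 := (norm_sub_le (ψ t) (ψ 0)).trans (add_le_add (h t) (h 0))
    calc _ ≤ (C + C) + (C + (e * b * (K * C)) * max T 0) := add_le_add h6 h5
      _ = _ := by ring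

/-- The linear equation `ẏ(t) = -αy(t) + B(t)y(t-1)` has a solution with any initial history, and
on `[-1, T]` it is bounded by a multiple of the norm of the history. -/
theorem dde_exists {α : ℝ} (hα : 0 ≤ α) {R : ℝ → E → E → E} {B : ℝ → E →L[ℂ] E}
    (hR : ∀ t u v, R t u v = -(α • u) + B t v) (hB : ContinuousOn B (Ici 0)) (T : ℝ) :
    ∃ K : ℝ, 0 ≤ K ∧ ∀ ψ : History E, ∃ y : ℝ → E,
      IsDDESolution R y ∧ HasHistory y 0 ψ ∧ ∀ t ≤ T, ‖y t‖ ≤ K * ‖ψ‖ := by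
  set B' : ℝ → E →L[ℂ] E := fun t => B (max t 0) with hB'def
  have hB' : Continuous B' :=
    hB.comp_continuous (by fun_prop) (fun t => mem_Ici.2 (le_max_right _ _))
  obtain ⟨K, hK0, hK⟩ := ddeApprox_bound hα hB' T ⌈T⌉₊
  refine ⟨K, hK0, fun ψ => ?_⟩
  set ψe : ℝ → E := IccExtend (by norm_num : (-1 : ℝ) ≤ 0) ψ with hψe
  have hψc : Continuous ψe := ψ.continuous.Icc_extend'
  set a : ℕ → ℝ → E := ddeApprox α B' ψe with ha
  set y : ℝ → E := fun t => a ⌈t⌉₊ t with hy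
  have hya : ∀ (N : ℕ) (t : ℝ), t ≤ N → y t = a N t := by
    intro N t ht
    exact (ddeApprox_eq α B' ψe (Nat.ceil_le.2 ht) t (Nat.le_ceil t)).symm
  have hac : ∀ N, Continuous (a N) := fun N => ddeApprox_continuous hB' hψc N
  have hyev : ∀ (N : ℕ) (t : ℝ), t < N → y =ᶠ[𝓝 t] a N := by
    intro N t ht
    filter_upwards [Iio_mem_nhds ht] with s hs using hya N s (le_of_lt hs)
  refine ⟨y, ⟨?_, ?_⟩, ?_, ?_⟩
  · intro t _
    obtain ⟨N, hN⟩ := exists_nat_gt t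
    exact ((hac N).continuousAt.congr (hyev N t hN).symm).continuousWithinAt
  · intro t ht
    obtain ⟨N, hN⟩ := exists_nat_gt t
    have hN1 : t < ((N + 1 : ℕ) : ℝ) := by push_cast; linarith
    set g : ℝ → E := fun s => Real.exp (α * s) • B' s (a N (s - 1)) with hg
    have hgc : Continuous g := by
      have := hac N
      exact Continuous.smul (by fun_prop) (hB'.clm_apply (by fun_prop))
    set F : ℝ → E := fun s => Real.exp (-α * s) • (ψe 0 + ∫ r in (0 : ℝ)..s, g r) with hF
    have haF : ∀ s, 0 < s → a (N + 1) s = F s := by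
      intro s hs
      have h1 : max s 0 = s := max_eq_left hs.le
      have h2 : ψe s = ψe 0 := by
        rw [hψe, IccExtend_of_right_le _ _ hs.le, IccExtend_of_right_le _ _ le_rfl]
      simp only [ha, ddeApprox, h1, h2, hF, hg]
      simp
    have hyF : y =ᶠ[𝓝 t] F := by
      filter_upwards [hyev (N + 1) t hN1, Ioi_mem_nhds ht] with s h1 h2
      rw [h1, haF s h2]
    have h2 : HasDerivAt (fun s : ℝ => Real.exp (-α * s)) (Real.exp (-α * t) * (-α)) t := by
      have := ((hasDerivAt_id t).const_mul (-α)).exp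
      simpa using this
    have h3 : HasDerivAt (fun s => ψe 0 + ∫ r in (0 : ℝ)..s, g r) (g t) t :=
      (intervalIntegral.integral_hasDerivAt_right (hgc.intervalIntegrable _ _)
        (hgc.stronglyMeasurableAtFilter _ _) hgc.continuousAt).const_add _
    have h4 : HasDerivAt F _ t := h2.smul h3
    refine (h4.congr_of_eventuallyEq hyF).congr_deriv ?_
    have hyt : y t = F t := hyF.eq_of_nhds
    have hyt1 : y (t - 1) = a N (t - 1) := hya N _ (by linarith)
    rw [hR, hyt, hyt1, hF, hg]
    have hBt : B' t = B t := by simp only [hB'def, max_eq_left ht.le]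
    have he : Real.exp (-α * t) * Real.exp (α * t) = 1 := by
      rw [← Real.exp_add]; simp
    simp only [hBt]
    rw [smul_smul (Real.exp (-α * t)), he, one_smul, mul_comm (Real.exp (-α * t)) (-α), mul_smul,
      neg_smul]
    abel
  · intro θ
    have h0 : (0 : ℝ) + θ ≤ (0 : ℕ) := by simpa using θ.2.2
    rw [hya 0 _ h0]
    simp only [ha, ddeApprox, hψe, zero_add]
    exact (IccExtend_val _ _ _).symm
  · intro t ht
    rw [hya ⌈T⌉₊ t (ht.trans (Nat.le_ceil T))]
    exact hK ψe ‖ψ‖ (fun s => ψ.norm_coe_le_norm _) t ht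

/-- The solution operator of a linear equation exists and is unique. -/
theorem existsUnique_isSolutionOperator {α : ℝ} (hα : 0 ≤ α) {R : ℝ → E → E → E}
    {B : ℝ → E →L[ℂ] E} (hR : ∀ t u v, R t u v = -(α • u) + B t v)
    (hB : ContinuousOn B (Ici 0)) {ω : ℝ} (hω : 0 ≤ ω) :
    ∃! M : History E →L[ℂ] History E, IsSolutionOperator R ω M := by
  have hmem : ∀ θ : Icc (-1 : ℝ) 0, -1 ≤ ω + θ := fun θ => by linarith [θ.2.1]
  have huniq : ∀ {x y : ℝ → E} {ψ : History E}, IsDDESolution R x → IsDDESolution R y →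
      HasHistory x 0 ψ → HasHistory y 0 ψ → ∀ t, -1 ≤ t → x t = y t := by
    intro x y ψ hx hy hx0 hy0
    refine dde_unique hR hx hy fun θ hθ => ?_
    have h1 := hx0 ⟨θ, hθ⟩
    have h2 := hy0 ⟨θ, hθ⟩
    simp only [zero_add] at h1 h2
    rw [← h1, h2]
  obtain ⟨K, hK0, hK⟩ := dde_exists hα hR hB ω
  choose y hy hy0 hyK using hK
  let m : History E → History E := fun ψ =>
    ⟨fun θ => y ψ (ω + θ), (hy ψ).1.comp_continuous (by fun_prop) hmem⟩
  let L : History E →ₗ[ℂ] History E :=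
    { toFun := m
      map_add' := by
        intro ψ φ
        ext θ
        have hsum : IsDDESolution R (fun t => y ψ t + y φ t) := by
          refine ⟨(hy ψ).1.add (hy φ).1, fun t ht => ?_⟩
          refine (((hy ψ).2 t ht).add ((hy φ).2 t ht)).congr_deriv ?_
          simp only [hR, map_add, smul_add]
          abel
        exact huniq (hy (ψ + φ)) hsum (hy0 _)
          (fun θ => by simp [hy0 ψ θ, hy0 φ θ]) _ (hmem θ)
      map_smul' := by
        intro c ψ
        ext θ
        have hsm : IsDDESolution R (fun t => c • y ψ t) := by
          refine ⟨(hy ψ).1.const_smul c, fun t ht => ?_⟩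
          refine (((hy ψ).2 t ht).const_smul c).congr_deriv ?_
          simp only [hR, map_smul, smul_add, smul_neg]
          rw [smul_comm]
        exact huniq (hy (c • ψ)) hsm (hy0 _) (fun θ => by simp [hy0 ψ θ]) _ (hmem θ) }
  refine ⟨L.mkContinuous K fun ψ => ?_, fun ψ => ⟨y ψ, hy ψ, hy0 ψ, fun θ => rfl⟩, ?_⟩
  · refine (ContinuousMap.norm_le _ (by positivity)).2 fun θ => ?_
    exact hyK ψ _ (by linarith [θ.2.2])
  · intro M hM
    ext ψ θ
    obtain ⟨x, hx, hx0, hxω⟩ := hM ψ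
    rw [hxω θ]
    exact huniq hx (hy ψ) hx0 (hy0 ψ) _ (hmem θ)

end WellDefined

theorem continuousOn_deriv_comp_delay {f g : ℝ → ℝ} (hf : ContDiff ℝ 1 f)
    (hg : ContinuousOn g (Ici (-1))) :
    ContinuousOn (fun t => ((deriv f (g (t - 1)) : ℝ) : ℂ)) (Ici 0) := by
  have h1 : ContinuousOn (fun t : ℝ => g (t - 1)) (Ici 0) :=
    hg.comp (by fun_prop) (fun t ht => by simp only [mem_Ici] at ht ⊢; linarith)
  exact Complex.continuous_ofReal.comp_continuousOn
    ((hf.continuous_deriv le_rfl).comp_continuousOn h1)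

theorem extended_existsUnique {α β : ℝ} {f p : ℝ → ℝ} {ω : ℝ} (hα : 0 ≤ α)
    (hf : ContDiff ℝ 1 f) (hp : ContinuousOn p (Ici (-1))) (hω : 0 ≤ ω) (lam : ℂ) :
    ∃! M : History ℂ →L[ℂ] History ℂ, IsSolutionOperator (extendedRHS α β f p lam) ω M := by
  refine existsUnique_isSolutionOperator hα
    (B := fun t => (lam * (β : ℂ) * ((deriv f (p (t - 1)) : ℝ) : ℂ)) • ContinuousLinearMap.id ℂ ℂ)
    (fun t u v => by simp [extendedRHS]) ?_ hω
  exact (continuousOn_const.mul (continuousOn_deriv_comp_delay hf hp)).smul continuousOn_const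

theorem variational_existsUnique {n : ℕ} {α β : ℝ} {f : ℝ → ℝ} {G : Matrix (Fin n) (Fin n) ℝ}
    {P : ℝ → EuclideanSpace ℝ (Fin n)} {ω : ℝ} (hα : 0 ≤ α) (hf : ContDiff ℝ 1 f)
    (hP : ContinuousOn P (Ici (-1))) (hω : 0 ≤ ω) :
    ∃! M : History (EuclideanSpace ℂ (Fin n)) →L[ℂ] History (EuclideanSpace ℂ (Fin n)),
      IsSolutionOperator (variationalRHS α β f G P) ω M := by
  let D : Fin n → EuclideanSpace ℂ (Fin n) →L[ℂ] EuclideanSpace ℂ (Fin n) := fun k =>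
    (EuclideanSpace.proj k : EuclideanSpace ℂ (Fin n) →L[ℂ] ℂ).smulRight
      (WithLp.toLp 2 fun j => (β : ℂ) * (G j k : ℂ))
  refine existsUnique_isSolutionOperator hα
    (B := fun t => ∑ k, ((deriv f (P (t - 1) k) : ℝ) : ℂ) • D k) (fun t u v => ?_) ?_ hω
  · ext j
    simp only [variationalRHS, D, PiLp.add_apply, PiLp.neg_apply, PiLp.smul_apply, sum_apply,
      smul_apply, ContinuousLinearMap.smulRight_apply, PiLp.proj_apply, WithLp.ofLp_sum,
      Finset.sum_apply, Complex.real_smul, neg_mul, smul_eq_mul, Finset.mul_sum]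
    congr 1
    refine Finset.sum_congr rfl fun k _ => ?_
    ring
  · refine continuousOn_finsetSum _ fun k _ => ?_
    have hk : ContinuousOn (fun t => P t k) (Ici (-1)) :=
      (EuclideanSpace.proj k : EuclideanSpace ℝ (Fin n) →L[ℝ] ℝ).continuous.comp_continuousOn hP
    have h1 := continuousOn_deriv_comp_delay hf hk
    exact ContinuousOn.fun_smul h1 continuousOn_const

/-- The monodromy operator is the solution operator over one period of the variational equation. -/
theorem monodromy_spec {n : ℕ} {α β : ℝ} {f : ℝ → ℝ} {G : Matrix (Fin n) (Fin n) ℝ}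
    {P : ℝ → EuclideanSpace ℝ (Fin n)} {ω : ℝ} (hα : 0 ≤ α) (hf : ContDiff ℝ 1 f)
    (hP : ContinuousOn P (Ici (-1))) (hω : 0 ≤ ω) :
    IsSolutionOperator (variationalRHS α β f G P) ω (monodromy α β f G P ω) :=
  Classical.epsilon_spec (variational_existsUnique hα hf hP hω).exists

/-- The extended monodromy operator is the solution operator over one period of the extended
variational equation. -/
theorem extendedMonodromy_spec {α β : ℝ} {f p : ℝ → ℝ} {ω : ℝ} (hα : 0 ≤ α)
    (hf : ContDiff ℝ 1 f) (hp : ContinuousOn p (Ici (-1))) (hω : 0 ≤ ω) (lam : ℂ) :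
    IsSolutionOperator (extendedRHS α β f p lam) ω (extendedMonodromy α β f p ω lam) :=
  Classical.epsilon_spec (extended_existsUnique hα hf hp hω lam).exists

end

/-!
For large `β` a slowly oscillating periodic solution `p` has humps of height of order `β` and
crosses zero steeply, so the coefficient `β f'(p(t-1))` of the linearized equation is concentrated
near the times where `p(t-1)` vanishes, with a total mass there that stays bounded as `β` grows. Hence a solution of
the linearized equation is, up to a small error, governed by its value at a single time between
two zeros of `p(t-1)`, and over one period every solution comes close to a multiple of the
particular solution `p'`. So the period map contracts transversally to `p'`: the multiplier `1` of
the scalar equation is simple, and all its other multipliers lie in the open unit disc.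

Making this uniform in `p` requires a priori bounds. With `u = p / β` the equation becomes
`u' = -α u + F(u(t-1))`, where `|F v|` is comparable to `min (β |v|) 1` (`FeedbackBounds`, `IsProfile`).
Comparing each hump with the next one shows that one of the two extrema of `u` is bounded below
(`exists_peak_or_trough_lower`). A hump of definite height keeps the feedback bounded below near
the time one unit before its end (`exists_feedback_lower`), so `u` crosses zero with a definite
slope, the other extremum is bounded below too, and the lengths of the humps are controlled
(`exists_humpBounds`). Near its zeros `p` is therefore steep, and the integral of `β |f'(p)|`
there is bounded by a multiple of the integral of `|f'|`; elsewhere `|p|` is of the order of `β`,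
so `β f'(p)` is small because `ξ f'(ξ) → 0`. Two applications of `IsDDESolution.half_period` then
give `exists_contraction`, and the abstract `eigen_of_contraction` turns it into
`exists_scalar_stable`.

The coupled system is handled by linear algebra. The solution operators are compact over a period
longer than the delay, so nonzero spectral values are eigenvalues, and `0` is always in the
spectrum. The monodromy operator `M` of the coupled system commutes with the pointwise action of
`G`, so each of its eigenspaces contains an eigenfunction with values in an eigenspace of `G` for
some `λ`; its components evolve by `M_λ` (`spectrum_coupled`). If `1` is a simple eigenvalue of
`G` and no `M_λ` with `λ ≠ 1` has the eigenvalue `1`, then the generalized eigenfunctions of `M`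
for `1` take values in the span of `(1, …, 1)`, where `M` acts as `M_1`
(`isSimpleEigenvalue_coupled`).
-/

/-! ### Integrals of nonnegative continuous functions -/

theorem integral_mono_subinterval {g : ℝ → ℝ} (hg : Continuous g) (h0 : ∀ s, 0 ≤ g s)
    {a b a' b' : ℝ} (h1 : a ≤ a') (h2 : a' ≤ b') (h3 : b' ≤ b) :
    ∫ s in a'..b', g s ≤ ∫ s in a..b, g s :=
  intervalIntegral.integral_mono_interval h1 h2 h3 (Eventually.of_forall h0)
    (hg.intervalIntegrable _ _)

theorem mul_le_integral {g : ℝ → ℝ} (hg : Continuous g) {a b m : ℝ} (hab : a ≤ b)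
    (hm : ∀ s ∈ Icc a b, m ≤ g s) : (b - a) * m ≤ ∫ s in a..b, g s := by
  have := intervalIntegral.integral_mono_on (μ := volume) hab
    (continuous_const.intervalIntegrable _ _) (hg.intervalIntegrable a b) hm
  simpa using this

theorem integral_le_mul {g : ℝ → ℝ} (hg : Continuous g) {a b m : ℝ} (hab : a ≤ b)
    (hm : ∀ s ∈ Icc a b, g s ≤ m) : ∫ s in a..b, g s ≤ (b - a) * m := by
  have := intervalIntegral.integral_mono_on (μ := volume) hab
    (hg.intervalIntegrable a b) (continuous_const.intervalIntegrable _ _) hm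
  simpa using this

/-! ### Saturated feedback and slowly oscillating profiles -/

/-- The saturation `min (β|v|) 1`, to which the size of the rescaled nonlinearity `f (β v)` is
comparable. -/
noncomputable def satur (β v : ℝ) : ℝ := min (β * |v|) 1

/-- `F` is a negative feedback whose size is comparable to `satur β`, with constants `c` and `C`.
Only `β` varies in the limit of large `β`. -/
structure FeedbackBounds (c C β : ℝ) (F : ℝ → ℝ) : Prop where
  c_pos : 0 < c
  β_pos : 0 < β
  cont : Continuous F
  sign : ∀ v, v * F v ≤ 0
  lower : ∀ v, c * satur β v ≤ |F v|
  upper : ∀ v, |F v| ≤ C * satur β v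

/-- `u` is a slowly oscillating solution of `u'(t) = -α u(t) + F (u (t - 1))` on the whole line, of
period `z + y`, normalized so that it is positive on `(0, z)` and negative on `(z, z + y)`. -/
structure IsProfile (α : ℝ) (F u : ℝ → ℝ) (z y : ℝ) : Prop where
  one_lt_left : 1 < z
  one_lt_right : 1 < y
  deriv : ∀ t, HasDerivAt u (-α * u t + F (u (t - 1))) t
  pos : ∀ t, 0 < t → t < z → 0 < u t
  neg : ∀ t, z < t → t < z + y → u t < 0
  periodic : ∀ t, u (t + (z + y)) = u t

theorem satur_nonneg {β : ℝ} (hβ : 0 < β) (v : ℝ) : 0 ≤ satur β v :=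
  le_min (by positivity) zero_le_one

theorem satur_le_one (β v : ℝ) : satur β v ≤ 1 := min_le_right _ _

theorem satur_le_mul {β : ℝ} (hβ : 0 < β) {k v w : ℝ} (hk : 1 ≤ k) (h : |v| ≤ k * |w|) :
    satur β v ≤ k * satur β w := by
  unfold satur
  rcases le_total (β * |w|) 1 with h1 | h1
  · rw [min_eq_left h1]
    exact (min_le_left _ _).trans (by nlinarith)
  · rw [min_eq_right h1]
    exact (min_le_right _ _).trans (by linarith)

theorem satur_eq_one {β v : ℝ} (h : 1 ≤ β * |v|) : satur β v = 1 := min_eq_right h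

theorem satur_neg (β v : ℝ) : satur β (-v) = satur β v := by simp [satur]

namespace FeedbackBounds

variable {c C β : ℝ} {F : ℝ → ℝ}

theorem c_le (hF : FeedbackBounds c C β F) : c ≤ C := by
  have h1 := hF.lower (1 / β)
  have h2 := hF.upper (1 / β)
  have hβ := hF.β_pos
  have h3 : satur β (1 / β) = 1 := satur_eq_one (by
    rw [abs_of_pos (by positivity)]; field_simp; exact le_rfl)
  rw [h3] at h1 h2
  linarith

theorem C_pos (hF : FeedbackBounds c C β F) : 0 < C := hF.c_pos.trans_le hF.c_le

theorem one_le_ratio (hF : FeedbackBounds c C β F) : 1 ≤ C / c :=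
  (one_le_div hF.c_pos).2 hF.c_le

theorem abs_le (hF : FeedbackBounds c C β F) (v : ℝ) : |F v| ≤ C := by
  refine (hF.upper v).trans ?_
  have := satur_le_one β v
  nlinarith [hF.C_pos]

theorem zero (hF : FeedbackBounds c C β F) : F 0 = 0 := by
  have h := hF.upper 0
  simp only [satur, abs_zero, mul_zero] at h
  have h1 : min (0 : ℝ) 1 = 0 := by norm_num
  rw [h1, mul_zero] at h
  exact abs_eq_zero.1 (le_antisymm h (abs_nonneg _))

theorem of_nonneg (hF : FeedbackBounds c C β F) {v : ℝ} (hv : 0 ≤ v) : F v = -|F v| := by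
  rcases hv.eq_or_lt with h | h
  · rw [← h, hF.zero]; simp
  · have := hF.sign v
    have h2 : F v ≤ 0 := by
      by_contra! h3
      nlinarith [mul_pos h h3]
    rw [abs_of_nonpos h2]; ring

theorem flip (hF : FeedbackBounds c C β F) : FeedbackBounds c C β fun v => -F (-v) where
  c_pos := hF.c_pos
  β_pos := hF.β_pos
  cont := (hF.cont.comp continuous_neg).neg
  sign v := by have := hF.sign (-v); linarith
  lower v := by have := hF.lower (-v); rwa [satur_neg, ← abs_neg] at this
  upper v := by have := hF.upper (-v); rwa [satur_neg, ← abs_neg] at this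

/-- The sizes of the feedback at two comparable arguments are comparable. -/
theorem compare (hF : FeedbackBounds c C β F) {k v w : ℝ} (hk : 1 ≤ k) (h : |v| ≤ k * |w|) :
    |F v| ≤ C / c * k * |F w| := by
  have h1 := hF.upper v
  have h2 := hF.lower w
  have h3 := satur_le_mul hF.β_pos hk h
  have hc := hF.c_pos
  have hC := hF.C_pos
  calc |F v| ≤ C * (k * satur β w) := h1.trans (mul_le_mul_of_nonneg_left h3 hC.le)
    _ = C / c * k * (c * satur β w) := by field_simp
    _ ≤ _ := mul_le_mul_of_nonneg_left h2 (by positivity)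

theorem le_of_one_le (hF : FeedbackBounds c C β F) {v : ℝ} (h : 1 ≤ β * |v|) : c ≤ |F v| := by
  have := hF.lower v
  rwa [satur_eq_one h, mul_one] at this

end FeedbackBounds

namespace IsProfile

variable {α c C β : ℝ} {F u : ℝ → ℝ} {z y : ℝ}

theorem continuous (h : IsProfile α F u z y) : Continuous u :=
  continuous_iff_continuousAt.2 fun t => (h.deriv t).continuousAt

theorem nonneg (h : IsProfile α F u z y) {t : ℝ} (h1 : 0 ≤ t) (h2 : t ≤ z) : 0 ≤ u t := by
  have hz := h.one_lt_left
  have hsub : closure (Ioo 0 z) ⊆ {t | 0 ≤ u t} :=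
    closure_minimal (fun t ht => (h.pos t ht.1 ht.2).le) (isClosed_le continuous_const h.continuous)
  rw [closure_Ioo (by linarith)] at hsub
  exact hsub ⟨h1, h2⟩

/-- Exchanging the roles of the two signs. -/
theorem flip (h : IsProfile α F u z y) :
    IsProfile α (fun v => -F (-v)) (fun t => -u (t + z)) y z where
  one_lt_left := h.one_lt_right
  one_lt_right := h.one_lt_left
  deriv t := by
    have h1 := ((h.deriv (t + z)).comp_add_const t z).neg
    refine h1.congr_deriv ?_
    rw [show t - 1 + z = t + z - 1 by ring]
    simp only [neg_neg]; ring
  pos t h1 h2 := by have := h.neg (t + z) (by linarith) (by linarith); linarith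
  neg t h1 h2 := by
    have := h.pos (t - y) (by linarith) (by linarith)
    rw [← h.periodic, show t - y + (z + y) = t + z by ring] at this
    linarith
  periodic t := by
    rw [← h.periodic (t + z)]; ring_nf

theorem nonpos (h : IsProfile α F u z y) {t : ℝ} (h1 : z ≤ t) (h2 : t ≤ z + y) : u t ≤ 0 := by
  have := h.flip.nonneg (t := t - z) (by linarith) (by linarith)
  rw [show t - z + z = t by ring] at this
  linarith

theorem zero_mid (h : IsProfile α F u z y) : u z = 0 := by
  have h1 := h.one_lt_left
  have h2 := h.one_lt_right
  exact le_antisymm (h.nonpos le_rfl (by linarith)) (h.nonneg (by linarith) le_rfl)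

theorem continuous_feedback (h : IsProfile α F u z y) (hF : FeedbackBounds c C β F) :
    Continuous fun s => |F (u s)| := (hF.cont.comp h.continuous).abs

/-- Variation of constants. -/
theorem exp_mul_sub (h : IsProfile α F u z y) (hF : FeedbackBounds c C β F) (a b : ℝ) :
    Real.exp (α * b) * u b - Real.exp (α * a) * u a =
      ∫ s in (a - 1)..(b - 1), Real.exp (α * (s + 1)) * F (u s) := by
  have hd : ∀ s ∈ uIcc (a - 1) (b - 1), HasDerivAt (fun s => Real.exp (α * (s + 1)) * u (s + 1))
      (Real.exp (α * (s + 1)) * F (u s)) s := by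
    intro s _
    have h1 : HasDerivAt (fun s : ℝ => Real.exp (α * (s + 1))) (Real.exp (α * (s + 1)) * α) s := by
      have := (((hasDerivAt_id s).add_const 1).const_mul α).exp
      simpa using this
    have h2 := (h.deriv (s + 1)).comp_add_const s 1
    refine (h1.mul h2).congr_deriv ?_
    rw [show s + 1 - 1 = s by ring]; ring
  have hc : Continuous fun s => Real.exp (α * (s + 1)) * F (u s) :=
    Continuous.mul (by fun_prop) (hF.cont.comp h.continuous)
  have := intervalIntegral.integral_eq_sub_of_hasDerivAt hd (hc.intervalIntegrable _ _)
  rw [this]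
  simp

theorem exp_integral_bounds (h : IsProfile α F u z y) (hF : FeedbackBounds c C β F) (hα : 0 ≤ α)
    {a b : ℝ} (hab : a ≤ b) :
    Real.exp (α * a) * ∫ s in (a - 1)..(b - 1), |F (u s)| ≤
        ∫ s in (a - 1)..(b - 1), Real.exp (α * (s + 1)) * |F (u s)| ∧
      ∫ s in (a - 1)..(b - 1), Real.exp (α * (s + 1)) * |F (u s)| ≤
        Real.exp (α * b) * ∫ s in (a - 1)..(b - 1), |F (u s)| := by
  have hg := h.continuous_feedback hF
  have hc : Continuous fun s => Real.exp (α * (s + 1)) * |F (u s)| :=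
    Continuous.mul (by fun_prop) hg
  rw [← intervalIntegral.integral_const_mul, ← intervalIntegral.integral_const_mul]
  constructor
  · refine intervalIntegral.integral_mono_on (by linarith)
      ((continuous_const.mul hg).intervalIntegrable _ _) (hc.intervalIntegrable _ _) fun s hs => ?_
    refine mul_le_mul_of_nonneg_right (Real.exp_le_exp.2 ?_) (abs_nonneg _)
    exact mul_le_mul_of_nonneg_left (by linarith [hs.1]) hα
  · refine intervalIntegral.integral_mono_on (by linarith)
      (hc.intervalIntegrable _ _) ((continuous_const.mul hg).intervalIntegrable _ _) fun s hs => ?_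
    refine mul_le_mul_of_nonneg_right (Real.exp_le_exp.2 ?_) (abs_nonneg _)
    exact mul_le_mul_of_nonneg_left (by linarith [hs.2]) hα

/-- While the delayed argument is nonnegative, `u` decreases by an amount comparable to the integral
of the feedback. -/
theorem fall (h : IsProfile α F u z y) (hF : FeedbackBounds c C β F) (hα : 0 ≤ α)
    {a b : ℝ} (ha : 1 ≤ a) (hab : a ≤ b) (hb : b ≤ z + 1) :
    Real.exp (α * (b - a)) * u b + ∫ s in (a - 1)..(b - 1), |F (u s)| ≤ u a ∧
      u a ≤ Real.exp (α * (b - a)) * (u b + ∫ s in (a - 1)..(b - 1), |F (u s)|) := by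
  have h1 := h.exp_mul_sub hF a b
  obtain ⟨h2, h3⟩ := h.exp_integral_bounds hF hα hab
  have h4 : ∫ s in (a - 1)..(b - 1), Real.exp (α * (s + 1)) * F (u s) =
      -∫ s in (a - 1)..(b - 1), Real.exp (α * (s + 1)) * |F (u s)| := by
    rw [← intervalIntegral.integral_neg]
    refine intervalIntegral.integral_congr fun s hs => ?_
    rw [uIcc_of_le (by linarith)] at hs
    have := hF.of_nonneg (h.nonneg (t := s) (by linarith [hs.1]) (by linarith [hs.2]))
    rw [this]; simp
  rw [h4] at h1
  have h5 : Real.exp (α * b) = Real.exp (α * a) * Real.exp (α * (b - a)) := by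
    rw [← Real.exp_add]; ring_nf
  have h6 := Real.exp_pos (α * a)
  rw [h5] at h1 h3
  constructor
  · refine le_of_mul_le_mul_left ?_ h6
    linarith
  · refine le_of_mul_le_mul_left ?_ h6
    linarith

/-- While the delayed argument is nonpositive, `u` does not decrease by more than the factor
`exp (-α)`. -/
theorem rise (h : IsProfile α F u z y) (hF : FeedbackBounds c C β F) (hα : 0 ≤ α)
    {a b : ℝ} (ha : 0 ≤ a) (hab : a ≤ b) (hb : b ≤ 1) : u a ≤ Real.exp α * u b := by
  have hy := h.one_lt_right
  have hz := h.one_lt_left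
  have h1 := (h.flip.fall hF.flip hα (a := a + y) (b := b + y) (by linarith) (by linarith)
    (by linarith)).1
  have h2 : 0 ≤ ∫ s in (a + y - 1)..(b + y - 1), |(fun v => -F (-v)) (-u (s + z))| :=
    intervalIntegral.integral_nonneg (by linarith) fun _ _ => abs_nonneg _
  have e1 : u (b + y + z) = u b := by rw [← h.periodic b]; ring_nf
  have e2 : u (a + y + z) = u a := by rw [← h.periodic a]; ring_nf
  rw [e1, e2] at h1
  have h3 : Real.exp (α * (b + y - (a + y))) ≤ Real.exp α := Real.exp_le_exp.2 (by nlinarith)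
  have h4 := h.nonneg (t := b) (by linarith) (by linarith)
  nlinarith

theorem antitone (h : IsProfile α F u z y) (hF : FeedbackBounds c C β F) (hα : 0 ≤ α)
    {a b : ℝ} (ha : 1 ≤ a) (hab : a ≤ b) (hb : b ≤ z) : u b ≤ u a := by
  have h1 := (h.fall hF hα ha hab (by linarith)).1
  have h2 : 0 ≤ ∫ s in (a - 1)..(b - 1), |F (u s)| :=
    intervalIntegral.integral_nonneg (by linarith) fun _ _ => abs_nonneg _
  have h3 : 1 ≤ Real.exp (α * (b - a)) := Real.one_le_exp (by nlinarith)
  have h4 := h.nonneg (t := b) (by linarith) (by linarith)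
  nlinarith

theorem integral_le_peak (h : IsProfile α F u z y) (hF : FeedbackBounds c C β F) (hα : 0 ≤ α) :
    ∫ s in (0 : ℝ)..(z - 1), |F (u s)| ≤ u 1 := by
  have h1 := (h.fall hF hα (a := 1) (b := z) le_rfl h.one_lt_left.le (by linarith)).1
  rw [h.zero_mid] at h1
  simpa using h1

theorem integral_le_trough (h : IsProfile α F u z y) (hF : FeedbackBounds c C β F) (hα : 0 ≤ α)
    {t : ℝ} (ht0 : 0 ≤ t) (ht1 : t ≤ 1) :
    ∫ s in (z - 1)..(z - 1 + t), |F (u s)| ≤ Real.exp α * -u (z + t) := by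
  have hz := h.one_lt_left
  have hy := h.one_lt_right
  have h1 := (h.fall hF hα (a := z) (b := z + t) hz.le (by linarith) (by linarith)).1
  rw [h.zero_mid, show z + t - 1 = z - 1 + t by ring, show z + t - z = t by ring] at h1
  have h2 := h.nonpos (t := z + t) (by linarith) (by linarith)
  have h3 : Real.exp (α * t) ≤ Real.exp α := Real.exp_le_exp.2 (by nlinarith)
  nlinarith

theorem trough_le_integral (h : IsProfile α F u z y) (hF : FeedbackBounds c C β F) (hα : 0 ≤ α)
    {t : ℝ} (ht0 : 0 ≤ t) (ht1 : t ≤ 1) :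
    -u (z + t) ≤ ∫ s in (z - 1)..(z - 1 + t), |F (u s)| := by
  have hz := h.one_lt_left
  have h1 := (h.fall hF hα (a := z) (b := z + t) hz.le (by linarith) (by linarith)).2
  rw [h.zero_mid, show z + t - 1 = z - 1 + t by ring] at h1
  have h2 := Real.exp_pos (α * (z + t - z))
  have := nonneg_of_mul_nonneg_right h1 h2
  linarith

end IsProfile

/-! ### Comparison of the humps of a profile -/

namespace IsProfile

variable {α c C β : ℝ} {F u : ℝ → ℝ} {z y : ℝ}

theorem le_exp_mul_peak (h : IsProfile α F u z y) (hF : FeedbackBounds c C β F) (hα : 0 ≤ α)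
    {t : ℝ} (h0 : 0 ≤ t) (hz : t ≤ z) : u t ≤ Real.exp α * u 1 := by
  rcases le_total t 1 with h1 | h1
  · exact h.rise hF hα h0 h1 le_rfl
  · have h2 := h.antitone hF hα le_rfl h1 hz
    have h3 := h.nonneg (t := 1) (by linarith) h.one_lt_left.le
    nlinarith [Real.one_le_exp hα]

theorem le_trough (h : IsProfile α F u z y) (hF : FeedbackBounds c C β F) (hα : 0 ≤ α)
    {t : ℝ} (h0 : 0 ≤ t) (h1 : t ≤ 1) : -u (z + t) ≤ C := by
  have h2 := h.trough_le_integral hF hα h0 h1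
  have h3 := integral_le_mul (h.continuous_feedback hF) (a := z - 1) (b := z - 1 + t) (m := C)
    (by linarith) fun s _ => hF.abs_le _
  nlinarith [hF.C_pos]

theorem le_of_mem (h : IsProfile α F u z y) (hF : FeedbackBounds c C β F) (hα : 0 ≤ α)
    {t : ℝ} (h0 : 0 ≤ t) (hz : t ≤ z) : u t ≤ C := by
  have key : ∀ s, 0 ≤ s → s ≤ 1 → u s ≤ C := fun s h2 h3 => by
    have := h.flip.le_trough hF.flip hα h2 h3
    rwa [neg_neg, show y + s + z = s + (z + y) by ring, h.periodic] at this
  rcases le_total t 1 with h1 | h1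
  · exact key t h0 h1
  · exact (h.antitone hF hα le_rfl h1 hz).trans (key 1 zero_le_one le_rfl)

theorem abs_le (h : IsProfile α F u z y) (hF : FeedbackBounds c C β F) (hα : 0 ≤ α) (t : ℝ) :
    |u t| ≤ C := by
  have hz := h.one_lt_left
  have hy := h.one_lt_right
  have hper : Function.Periodic u (z + y) := h.periodic
  obtain ⟨s, hs, hts⟩ := hper.exists_mem_Ico₀ (by linarith) t
  rw [hts]
  rcases le_total s z with h1 | h1
  · rw [abs_of_nonneg (h.nonneg hs.1 h1)]
    exact h.le_of_mem hF hα hs.1 h1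
  · rw [abs_of_nonpos (h.nonpos h1 hs.2.le)]
    have := h.flip.le_of_mem hF.flip hα (t := s - z) (by linarith) (by linarith [hs.2])
    rwa [sub_add_cancel] at this

theorem abs_deriv_le (h : IsProfile α F u z y) (hF : FeedbackBounds c C β F) (hα : 0 ≤ α) (t : ℝ) :
    |-α * u t + F (u (t - 1))| ≤ C * (1 + α) := by
  have h1 := h.abs_le hF hα t
  have h2 := hF.abs_le (u (t - 1))
  calc _ ≤ |-α * u t| + |F (u (t - 1))| := abs_add_le _ _
    _ = α * |u t| + |F (u (t - 1))| := by rw [abs_mul, abs_neg, abs_of_nonneg hα]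
    _ ≤ _ := by nlinarith

theorem lipschitz (h : IsProfile α F u z y) (hF : FeedbackBounds c C β F) (hα : 0 ≤ α) (s t : ℝ) :
    |u t - u s| ≤ C * (1 + α) * |t - s| := by
  have := convex_univ.norm_image_sub_le_of_norm_hasDerivWithin_le (f := u) (s := univ)
    (C := C * (1 + α)) (x := s) (y := t) (fun x _ => (h.deriv x).hasDerivWithinAt)
    (fun x _ => h.abs_deriv_le hF hα x) (mem_univ _) (mem_univ _)
  simpa using this

/-- If the decreasing part of the positive hump is not too short, then the following trough is
comparable to its extremal value well before the latter is attained. -/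
theorem trough_comparable (h : IsProfile α F u z y) (hF : FeedbackBounds c C β F) (hα : 0 ≤ α)
    {η t : ℝ} (hη0 : 0 ≤ η) (hη1 : η ≤ 1) (hηz : η ≤ z - 1) (ht0 : 1 - η / 2 ≤ t) (ht1 : t ≤ 1) :
    -u (z + 1) ≤ Real.exp α * (1 + C / c) * -u (z + t) := by
  have hz := h.one_lt_left
  have hg := h.continuous_feedback hF
  have h1 := h.trough_le_integral hF hα zero_le_one le_rfl
  have h2 := h.integral_le_trough hF hα (t := t) (by linarith) ht1
  have h3 := integral_mono_subinterval hg (fun _ => abs_nonneg _) (a := z - 1) (b := z - 1 + t)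
    (a' := z - 1) (b' := z - η / 2) le_rfl (by linarith) (by linarith)
  have h4 := integral_mono_subinterval hg (fun _ => abs_nonneg _) (a := z - 1) (b := z - η / 2)
    (a' := z - η) (b' := z - η / 2) (by linarith) (by linarith) le_rfl
  have h5 : ∫ s in (z - η / 2)..z, |F (u s)| ≤ C / c * ∫ s in (z - η)..(z - η / 2), |F (u s)| := by
    have e1 : ∫ s in (z - η)..(z - η / 2), |F (u (s + η / 2))| =
        ∫ s in (z - η / 2)..z, |F (u s)| := by
      rw [intervalIntegral.integral_comp_add_right (fun s => |F (u s)|)]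
      congr 1 <;> ring
    rw [← e1, ← intervalIntegral.integral_const_mul]
    refine intervalIntegral.integral_mono_on (by linarith)
      ((hg.comp (continuous_add_const (η / 2))).intervalIntegrable _ _)
      ((continuous_const.mul hg).intervalIntegrable _ _) fun s hs => ?_
    have h6 := h.antitone hF hα (a := s) (b := s + η / 2) (by linarith [hs.1]) (by linarith)
      (by linarith [hs.2])
    have h7 := h.nonneg (t := s + η / 2) (by linarith [hs.1]) (by linarith [hs.2])
    have := hF.compare (k := 1) (v := u (s + η / 2)) (w := u s) le_rfl (by
      rw [one_mul, abs_of_nonneg h7, abs_of_nonneg (h7.trans h6)]; exact h6)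
    rwa [mul_one] at this
  have h8 := intervalIntegral.integral_add_adjacent_intervals (μ := volume)
    (hg.intervalIntegrable (z - 1) (z - η / 2)) (hg.intervalIntegrable (z - η / 2) z)
  rw [show z - 1 + 1 = z by ring, ← h8] at h1
  have h9 : 0 ≤ C / c := by linarith [hF.one_le_ratio]
  calc -u (z + 1) ≤ (1 + C / c) * ∫ s in (z - 1)..(z - η / 2), |F (u s)| := by nlinarith
    _ ≤ (1 + C / c) * (Real.exp α * -u (z + t)) :=
      mul_le_mul_of_nonneg_left (h3.trans h2) (by linarith)
    _ = _ := by ring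

/-- The same comparison for the positive hump. -/
theorem peak_comparable (h : IsProfile α F u z y) (hF : FeedbackBounds c C β F) (hα : 0 ≤ α)
    {η t : ℝ} (hη0 : 0 ≤ η) (hη1 : η ≤ 1) (hηz : η ≤ y - 1) (ht0 : 1 - η / 2 ≤ t) (ht1 : t ≤ 1) :
    u 1 ≤ Real.exp α * (1 + C / c) * u t := by
  have := h.flip.trough_comparable hF.flip hα hη0 hη1 hηz ht0 ht1
  rwa [neg_neg, neg_neg, show y + 1 + z = 1 + (z + y) by ring, h.periodic,
    show y + t + z = t + (z + y) by ring, h.periodic] at this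

/-- On the rising part `[0, 1]` of the hump the feedback is almost nondecreasing in time. -/
theorem compare_rise (h : IsProfile α F u z y) (hF : FeedbackBounds c C β F) (hα : 0 ≤ α)
    {s t : ℝ} (hs : 0 ≤ s) (hst : s ≤ t) (ht : t ≤ 1) :
    |F (u s)| ≤ C / c * Real.exp α * |F (u t)| := by
  have hz := h.one_lt_left
  refine hF.compare (Real.one_le_exp hα) ?_
  rw [abs_of_nonneg (h.nonneg hs (by linarith)), abs_of_nonneg (h.nonneg (by linarith)
    (by linarith))]
  exact h.rise hF hα hs hst ht

theorem peak_le_integral (h : IsProfile α F u z y) (hF : FeedbackBounds c C β F) (hα : 0 ≤ α)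
    (hz2 : z ≤ 2) : u 1 ≤ Real.exp α * ∫ s in (0 : ℝ)..(z - 1), |F (u s)| := by
  have hz := h.one_lt_left
  have h1 := (h.fall hF hα (a := 1) (b := z) le_rfl hz.le (by linarith)).2
  rw [h.zero_mid, zero_add, sub_self] at h1
  have h2 : 0 ≤ ∫ s in (0 : ℝ)..(z - 1), |F (u s)| :=
    intervalIntegral.integral_nonneg (by linarith) fun _ _ => abs_nonneg _
  exact h1.trans (mul_le_mul_of_nonneg_right (Real.exp_le_exp.2 (by nlinarith)) h2)

/-- A positive hump with a short decreasing part is followed by a much deeper trough. -/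
theorem peak_le_trough (h : IsProfile α F u z y) (hF : FeedbackBounds c C β F) (hα : 0 ≤ α)
    (hz2 : z ≤ 2) :
    (1 - (z - 1)) * u 1 ≤ C / c * Real.exp α ^ 3 * (z - 1) * -u (z + 1) := by
  have hz := h.one_lt_left
  have hg := h.continuous_feedback hF
  have hR := hF.one_le_ratio
  have hD := Real.one_le_exp hα
  set D := Real.exp α
  have h1 := h.peak_le_integral hF hα hz2
  have h2 : (1 - (z - 1)) * ∫ s in (0 : ℝ)..(z - 1), |F (u s)| ≤
      ∫ t in (z - 1)..1, (z - 1) * (C / c * D * |F (u t)|) := by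
    refine mul_le_integral (continuous_const.mul (continuous_const.mul hg)) (by linarith) ?_
    intro t ht
    have := integral_le_mul hg (a := 0) (b := z - 1) (m := C / c * D * |F (u t)|) (by linarith)
      fun s hs => h.compare_rise hF hα hs.1 (hs.2.trans ht.1) ht.2
    simpa using this
  rw [intervalIntegral.integral_const_mul, intervalIntegral.integral_const_mul] at h2
  have h3 := integral_mono_subinterval hg (fun _ => abs_nonneg _) (a := z - 1) (b := z - 1 + 1)
    (a' := z - 1) (b' := 1) le_rfl (by linarith) (by linarith)
  have h4 := h.integral_le_trough hF hα zero_le_one le_rfl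
  change _ ≤ D * _ at h4
  have hR0 : 0 < C / c := by linarith
  have hD0 : 0 < D := by linarith
  have hz0 : 0 < z - 1 := by linarith
  calc (1 - (z - 1)) * u 1
      ≤ (1 - (z - 1)) * (D * ∫ s in (0 : ℝ)..(z - 1), |F (u s)|) :=
        mul_le_mul_of_nonneg_left h1 (by linarith)
    _ = D * ((1 - (z - 1)) * ∫ s in (0 : ℝ)..(z - 1), |F (u s)|) := by ring
    _ ≤ D * ((z - 1) * (C / c * D * (D * -u (z + 1)))) := by
        refine mul_le_mul_of_nonneg_left (h2.trans ?_) hD0.le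
        refine mul_le_mul_of_nonneg_left ?_ hz0.le
        exact mul_le_mul_of_nonneg_left (h3.trans h4) (by positivity)
    _ = _ := by ring

theorem trough_le_peak (h : IsProfile α F u z y) (hF : FeedbackBounds c C β F) (hα : 0 ≤ α)
    (hy2 : y ≤ 2) :
    (1 - (y - 1)) * -u (z + 1) ≤ C / c * Real.exp α ^ 3 * (y - 1) * u 1 := by
  have := h.flip.peak_le_trough hF.flip hα hy2
  rwa [neg_neg, show y + 1 + z = 1 + (z + y) by ring, h.periodic, add_comm 1 z] at this

theorem peak_pos (h : IsProfile α F u z y) : 0 < u 1 := h.pos 1 one_pos h.one_lt_left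

theorem trough_pos (h : IsProfile α F u z y) : 0 < -u (z + 1) := by
  have := h.one_lt_right
  have := h.neg (z + 1) (by linarith) (by linarith)
  linarith

/-- If the hump keeps the order of its peak before time `1`, then the saturated peak is controlled
by the extrema: the integral of the feedback over the hump is bounded by both. -/
theorem satur_peak_le (h : IsProfile α F u z y) (hF : FeedbackBounds c C β F) (hα : 0 ≤ α)
    {η k : ℝ} (hη0 : 0 ≤ η) (hη1 : η ≤ 1) (hk : 0 ≤ k)
    (hu : ∀ t, 1 - η / 2 ≤ t → t ≤ 1 → k * u 1 ≤ u t) :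
    η / 2 * (c * satur β (k * u 1)) ≤ u 1 + Real.exp α * -u (z + 1) := by
  have hz := h.one_lt_left
  have hg := h.continuous_feedback hF
  have h1 := h.integral_le_peak hF hα
  have h2 := h.integral_le_trough hF hα zero_le_one le_rfl
  rw [sub_add_cancel] at h2
  have h3 := intervalIntegral.integral_add_adjacent_intervals (μ := volume)
    (hg.intervalIntegrable 0 (z - 1)) (hg.intervalIntegrable (z - 1) z)
  have h4 := integral_mono_subinterval hg (fun _ => abs_nonneg _) (a := 0) (b := z)
    (a' := 1 - η / 2) (b' := 1) (by linarith) (by linarith) hz.le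
  have h5 := mul_le_integral hg (a := 1 - η / 2) (b := 1) (m := c * satur β (k * u 1))
    (by linarith) fun t ht => by
      refine le_trans ?_ (hF.lower (u t))
      refine mul_le_mul_of_nonneg_left ?_ hF.c_pos.le
      have h6 := hu t ht.1 ht.2
      have h7 : 0 ≤ k * u 1 := mul_nonneg hk h.peak_pos.le
      have := satur_le_mul hF.β_pos (k := 1) (v := k * u 1) (w := u t) le_rfl (by
        rw [one_mul, abs_of_nonneg h7, abs_of_nonneg (h7.trans h6)]; exact h6)
      linarith
  linarith

end IsProfile

/-! ### Lower bounds for profiles with large feedback gain -/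

/-- For large `β` a linear bound on a saturation forces saturation: the alternative, that
`β v / k ≤ 1`, would bound `β`. -/
theorem le_mul_of_mul_satur_le {β m N k v : ℝ} (hm : 0 < m) (hk : 0 < k) (hv : 0 < v)
    (hβ : N * k / m < β) (h : m * satur β (v / k) ≤ N * v) : m ≤ N * v := by
  rw [satur, abs_of_pos (div_pos hv hk)] at h
  rcases le_total (β * (v / k)) 1 with h1 | h1
  · rw [min_eq_left h1] at h
    rw [div_lt_iff₀ hm] at hβ
    have h2 : m * (β * (v / k)) * k = m * β * v := by field_simp
    have h3 : m * β * v ≤ N * v * k := by rw [← h2]; exact mul_le_mul_of_nonneg_right h hk.le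
    nlinarith
  · rwa [min_eq_right h1, mul_one] at h

namespace IsProfile

variable {α c C β : ℝ} {F u : ℝ → ℝ} {z y : ℝ}

theorem div_le_peak (h : IsProfile α F u z y) (hF : FeedbackBounds c C β F) (hα : 0 ≤ α)
    {η t : ℝ} (hη0 : 0 ≤ η) (hη1 : η ≤ 1) (hηz : η ≤ y - 1) (ht0 : 1 - η / 2 ≤ t) (ht1 : t ≤ 1) :
    (Real.exp α * (1 + C / c))⁻¹ * u 1 ≤ u t := by
  have hK : 0 < Real.exp α * (1 + C / c) := by
    have := hF.one_le_ratio
    have := Real.exp_pos α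
    positivity
  rw [inv_mul_le_iff₀ hK]
  exact h.peak_comparable hF hα hη0 hη1 hηz ht0 ht1

/-- A peak at least as large as the following trough is bounded below, if the decreasing part of the
other hump is not too short. -/
theorem peak_lower_of_ge (h : IsProfile α F u z y) (hF : FeedbackBounds c C β F) (hα : 0 ≤ α)
    {η : ℝ} (hη0 : 0 < η) (hη1 : η ≤ 1) (hηy : η ≤ y - 1) (hle : -u (z + 1) ≤ u 1)
    (hβ : 2 * Real.exp α * (Real.exp α * (1 + C / c)) / (η / 2 * c) < β) :
    η / 2 * c ≤ 2 * Real.exp α * u 1 := by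
  have hD := Real.one_le_exp hα
  have hR := hF.one_le_ratio
  have hK : 0 < Real.exp α * (1 + C / c) := by positivity
  have h1 := h.satur_peak_le hF hα hη0.le hη1 (inv_pos.2 hK).le
    fun t h1 h2 => h.div_le_peak hF hα hη0.le hη1 hηy h1 h2
  have hc := hF.c_pos
  refine le_mul_of_mul_satur_le (by positivity) hK h.peak_pos hβ ?_
  rw [div_eq_inv_mul (u 1)]
  have := h.peak_pos
  nlinarith

/-- The trough after a hump with a very short decreasing part is bounded below. -/
theorem trough_lower_of_short (h : IsProfile α F u z y) (hF : FeedbackBounds c C β F)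
    (hα : 0 ≤ α) (hz4 : z - 1 ≤ 1 / 4) (hy4 : 3 / 4 ≤ y - 1)
    (hβ : 1 * (16 * (C * Real.exp α ^ 2 * (Real.exp α * (1 + C / c)) / c)) / (1 / 16 * c) < β) :
    1 / 16 * c ≤ -u (z + 1) := by
  have hz := h.one_lt_left
  have hg := h.continuous_feedback hF
  have hD := Real.one_le_exp hα
  have hR := hF.one_le_ratio
  have hc := hF.c_pos
  have hC := hF.C_pos
  set D := Real.exp α with hDdef
  set K := D * (1 + C / c) with hK
  have hK1 : 1 ≤ K := by rw [hK]; nlinarith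
  have hA := h.peak_pos
  have hB := h.trough_pos
  set S := satur β (K⁻¹ * u 1) with hS
  have hS0 : 0 ≤ S := satur_nonneg hF.β_pos _
  -- on `[5/8, 1]` the hump has the size of its peak
  have h1 : ∀ t, 5 / 8 ≤ t → t ≤ 1 → c * S ≤ |F (u t)| := fun t ht0 ht1 => by
    have h2 := h.div_le_peak hF hα (η := 3 / 4) (t := t) (by norm_num) (by norm_num) hy4
      (by linarith) ht1
    have h3 : 0 ≤ K⁻¹ * u 1 := by positivity
    refine le_trans (mul_le_mul_of_nonneg_left ?_ hc.le) (hF.lower (u t))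
    have := satur_le_mul hF.β_pos (k := 1) (v := K⁻¹ * u 1) (w := u t) le_rfl (by
      rw [one_mul, abs_of_nonneg h3, abs_of_nonneg (h3.trans h2)]; exact h2)
    linarith
  have h2 : -u (z + 1) ≤ C * (D * K * S) := by
    have h3 := h.trough_le_integral hF hα zero_le_one le_rfl
    have h4 := integral_le_mul hg (a := z - 1) (b := z - 1 + 1) (m := C * (D * K * S))
      (by linarith) fun s hs => by
        have hs0 : 0 ≤ s := by linarith [hs.1]
        have hs1 : s ≤ z := by linarith [hs.2]
        refine (hF.upper _).trans (mul_le_mul_of_nonneg_left ?_ hC.le)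
        refine satur_le_mul hF.β_pos (by nlinarith) ?_
        rw [abs_of_nonneg (h.nonneg hs0 hs1), abs_of_nonneg (by positivity)]
        have := h.le_exp_mul_peak hF hα hs0 hs1
        calc u s ≤ D * u 1 := this
          _ = D * K * (K⁻¹ * u 1) := by field_simp
    linarith
  have h3 : ∀ t, 11 / 16 ≤ t → t ≤ 3 / 4 →
      -u (z + 1) ≤ 16 * (C * D ^ 2 * K / c) * -u (z + t) := fun t ht0 ht1 => by
    have h4 := h.integral_le_trough hF hα (t := t) (by linarith) (by linarith)
    have h5 := integral_mono_subinterval hg (fun _ => abs_nonneg _) (a := z - 1) (b := z - 1 + t)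
      (a' := 5 / 8) (b' := 11 / 16) (by linarith) (by norm_num) (by linarith)
    have h6 := mul_le_integral hg (a := 5 / 8) (b := 11 / 16) (m := c * S) (by norm_num)
      fun s hs => h1 s hs.1 (by linarith [hs.2])
    have h7 : S ≤ 16 * D / c * -u (z + t) := by
      rw [div_mul_eq_mul_div, le_div_iff₀ hc]
      change _ ≤ D * _ at h4
      nlinarith
    calc -u (z + 1) ≤ C * (D * K * S) := h2
      _ ≤ C * (D * K * (16 * D / c * -u (z + t))) := by gcongr
      _ = _ := by ring
  set K2 := 16 * (C * D ^ 2 * K / c) with hK2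
  have hK2pos : 0 < K2 := by positivity
  have h4 := h.flip.integral_le_peak hF.flip hα
  have hg' := h.flip.continuous_feedback hF.flip
  have h5 := integral_mono_subinterval hg' (fun _ => abs_nonneg _) (a := 0) (b := y - 1)
      (a' := 11 / 16) (b' := 3 / 4) (by norm_num) (by norm_num) hy4
  have h6 := mul_le_integral hg' (a := 11 / 16) (b := 3 / 4)
    (m := c * satur β (-u (z + 1) / K2)) (by norm_num) fun s hs => by
      have h7 := h3 s hs.1 hs.2
      refine le_trans (mul_le_mul_of_nonneg_left ?_ hc.le) (hF.flip.lower _)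
      have h8 : 0 ≤ -u (z + 1) / K2 := by positivity
      have h9 : -u (z + 1) / K2 ≤ -u (s + z) := by
        rw [div_le_iff₀ hK2pos, add_comm s z]; linarith
      have := satur_le_mul hF.β_pos (k := 1) (v := -u (z + 1) / K2) (w := -u (s + z)) le_rfl (by
        rw [one_mul, abs_of_nonneg h8, abs_of_nonneg (h8.trans h9)]; exact h9)
      linarith
  rw [add_comm 1 z] at h4
  have := le_mul_of_mul_satur_le (β := β) (m := 1 / 16 * c) (N := 1) (k := K2) (v := -u (z + 1))
    (by positivity) hK2pos hB hβ (by linarith)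
  linarith

end IsProfile

/-- For large `β`, at least one of the two extrema of a profile is bounded away from zero. -/
theorem exists_peak_or_trough_lower {α c C : ℝ} (hα : 0 ≤ α) (hc : 0 < c) (hcC : c ≤ C) :
    ∃ δ : ℝ, 0 < δ ∧ ∃ β₁ : ℝ, ∀ (β : ℝ) (F u : ℝ → ℝ) (z y : ℝ), β₁ < β →
      FeedbackBounds c C β F → IsProfile α F u z y → δ ≤ u 1 ∨ δ ≤ -u (z + 1) := by
  have hD := Real.one_le_exp hα
  have hR : 1 ≤ C / c := (one_le_div hc).2 hcC
  set Λ := C / c * Real.exp α ^ 3 with hΛ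
  have hΛ1 : 1 ≤ Λ := by
    rw [hΛ]; exact one_le_mul_of_one_le_of_one_le hR (one_le_pow₀ hD)
  set η := 1 / (4 * Λ ^ 2 + 1) with hη
  have hη0 : 0 < η := by positivity
  have hη4 : η ≤ 1 / 4 := by
    rw [hη, div_le_div_iff₀ (by positivity) (by norm_num)]; nlinarith
  set b₁ := 2 * Real.exp α * (Real.exp α * (1 + C / c)) / (η / 2 * c) with hb₁
  set b₂ := 1 * (16 * (C * Real.exp α ^ 2 * (Real.exp α * (1 + C / c)) / c)) / (1 / 16 * c)
    with hb₂
  refine ⟨min (η / 2 * c / (2 * Real.exp α)) (1 / 16 * c), by positivity, max b₁ b₂,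
    fun β F u z y hβ hF h => ?_⟩
  have hβ1 : b₁ < β := (le_max_left _ _).trans_lt hβ
  have hβ2 : b₂ < β := (le_max_right _ _).trans_lt hβ
  -- a short decreasing part of one hump forces a long one of the other
  have key : ∀ {F u : ℝ → ℝ} {z y : ℝ}, FeedbackBounds c C β F → IsProfile α F u z y →
      z - 1 < η → 3 / 4 ≤ y - 1 := by
    intro F u z y hF h hz
    by_contra! hy
    have hz1 := h.one_lt_left
    have hy1 := h.one_lt_right
    have h1 := h.peak_le_trough hF hα (by linarith)
    have h2 := h.trough_le_peak hF hα (by linarith)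
    have hA := h.peak_pos
    have hB := h.trough_pos
    rw [← hΛ] at h1 h2
    have h3 : -u (z + 1) ≤ 3 * Λ * u 1 := by nlinarith [mul_pos (by linarith : 0 < Λ) hA]
    have h4 : u 1 * (3 / 4) ≤ 3 * Λ ^ 2 * (z - 1) * u 1 := by
      calc u 1 * (3 / 4) ≤ (1 - (z - 1)) * u 1 := by nlinarith
        _ ≤ Λ * (z - 1) * (3 * Λ * u 1) := h1.trans
          (mul_le_mul_of_nonneg_left h3 (mul_nonneg (by linarith) (by linarith)))
        _ = _ := by ring
    have h5 : 3 / 4 ≤ 3 * Λ ^ 2 * (z - 1) := by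
      by_contra! h6
      nlinarith
    have h6 : (z - 1) * (4 * Λ ^ 2 + 1) < 1 := by
      rwa [hη, lt_div_iff₀ (by positivity)] at hz
    nlinarith
  by_cases hz : z - 1 < η
  · right
    exact (min_le_right _ _).trans
      (h.trough_lower_of_short hF hα (by linarith) (key hF h hz) hβ2)
  by_cases hy : y - 1 < η
  · left
    have := h.flip.trough_lower_of_short hF.flip hα (by linarith) (key hF.flip h.flip hy) hβ2
    rw [neg_neg, show y + 1 + z = 1 + (z + y) by ring, h.periodic] at this
    exact (min_le_right _ _).trans this
  push Not at hz hy
  rcases le_total (-u (z + 1)) (u 1) with hle | hle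
  · left
    refine (min_le_left _ _).trans ?_
    rw [div_le_iff₀' (by positivity)]
    exact h.peak_lower_of_ge hF hα hη0 (by linarith) hy hle hβ1
  · right
    refine (min_le_left _ _).trans ?_
    rw [div_le_iff₀' (by positivity)]
    have := h.flip.peak_lower_of_ge hF.flip hα hη0 (by linarith) hz (by
      rw [neg_neg, show y + 1 + z = 1 + (z + y) by ring, h.periodic, add_comm 1 z]; exact hle) hβ1
    rwa [add_comm 1 z] at this

/-- A hump whose peak is bounded below has, for large `β`, a feedback bounded below around the
time one unit before its end; in particular the following trough is bounded below as well. -/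
theorem exists_feedback_lower {α c C : ℝ} (hα : 0 ≤ α) (hc : 0 < c) (hcC : c ≤ C) {δ : ℝ}
    (hδ : 0 < δ) :
    ∃ τ κ : ℝ, 0 < τ ∧ τ ≤ 1 / 4 ∧ 0 < κ ∧ ∃ β₁ : ℝ, ∀ (β : ℝ) (F u : ℝ → ℝ) (z y : ℝ), β₁ < β →
      FeedbackBounds c C β F → IsProfile α F u z y → δ ≤ u 1 →
        2 * τ ≤ z - 1 ∧ (∀ t, z - 1 - τ ≤ t → t ≤ z - 1 + τ → κ ≤ |F (u t)|) ∧
          κ ≤ -u (z + 1) := by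
  have hD := Real.one_le_exp hα
  have hC : 0 < C := hc.trans_le hcC
  have hR : 1 ≤ C / c := (one_le_div hc).2 hcC
  set D := Real.exp α with hDdef
  set L := C * (1 + α) with hL
  have hL0 : 0 < L := by positivity
  set τ := min (1 / 4) (min (δ / (2 * D * C)) (δ / (2 * L))) with hτ
  have hτ0 : 0 < τ := by positivity
  have hτ4 : τ ≤ 1 / 4 := min_le_left _ _
  have hτC : 2 * D * C * τ ≤ δ := by
    rw [← le_div_iff₀' (by positivity)]
    exact (min_le_right _ _).trans (min_le_left _ _)
  have hτL : 2 * L * τ ≤ δ := by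
    rw [← le_div_iff₀' (by positivity)]
    exact (min_le_right _ _).trans (min_le_right _ _)
  set Λ := C / c * D with hΛ
  have hΛ1 : 1 ≤ Λ := one_le_mul_of_one_le_of_one_le hR hD
  set k₁ := δ / (2 * D * Λ) with hk₁
  set κ := min (k₁ / Λ) c with hκ
  have hκ0 : 0 < κ := by positivity
  have hκc : κ ≤ c := min_le_right _ _
  have hκk : κ ≤ k₁ / Λ := min_le_left _ _
  refine ⟨τ, τ * κ / D, hτ0, hτ4, by positivity, max (1 / (τ * κ)) (2 / δ),
    fun β F u z y hβ hF h hpeak => ?_⟩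
  have hβ0 := hF.β_pos
  have hβ1 : 1 < β * (τ * κ) := by
    rw [← div_lt_iff₀ (by positivity)]; exact (le_max_left _ _).trans_lt hβ
  have hβ2 : 2 < β * δ := by
    rw [← div_lt_iff₀ hδ]; exact (le_max_right _ _).trans_lt hβ
  have hz := h.one_lt_left
  have hg := h.continuous_feedback hF
  have hlip := h.lipschitz hF hα
  have h2τ : 2 * τ ≤ z - 1 := by
    have h1 := hlip z 1
    rw [h.zero_mid, sub_zero, abs_of_pos h.peak_pos, abs_of_neg (by linarith), ← hL] at h1
    have : 2 * L * τ ≤ L * (z - 1) := by linarith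
    nlinarith
  -- near the peak
  have hnear : ∀ t, 1 - τ ≤ t → t ≤ 1 + τ → δ / 2 ≤ u t := fun t h1 h2 => by
    have h3 := (abs_le.1 (hlip 1 t)).1
    have h4 : |t - 1| ≤ τ := abs_le.2 ⟨by linarith, by linarith⟩
    have : L * |t - 1| ≤ L * τ := mul_le_mul_of_nonneg_left h4 hL0.le
    linarith
  have hone : ∀ t, 1 / β ≤ u t → κ ≤ |F (u t)| := fun t h1 => by
    refine hκc.trans (hF.le_of_one_le ?_)
    rw [div_le_iff₀' hβ0] at h1
    exact h1.trans (mul_le_mul_of_nonneg_left (le_abs_self _) hβ0.le)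
  have hinv : 1 / β < τ * κ := by rw [div_lt_iff₀' hβ0]; exact hβ1
  have hinv2 : 1 / β < δ / 2 := by rw [div_lt_iff₀' hβ0]; linarith
  -- it suffices to treat the times before `z - 1`
  suffices hleft : (∀ t, z - 1 - τ ≤ t → t ≤ z - 1 → κ ≤ |F (u t)|) ∧
      ∀ t, z - 1 ≤ t → t ≤ 1 → κ ≤ |F (u t)| by
    obtain ⟨hl1, hl2⟩ := hleft
    have hend : τ * κ ≤ u (z - τ) := by
      have h1 := (h.fall hF hα (a := z - τ) (b := z) (by linarith) (by linarith) (by linarith)).1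
      rw [h.zero_mid, mul_zero, zero_add] at h1
      have h2 := mul_le_integral hg (a := z - τ - 1) (b := z - 1) (m := κ) (by linarith)
        fun s hs => hl1 s (by linarith [hs.1]) hs.2
      linarith
    have hall : ∀ t, z - 1 - τ ≤ t → t ≤ z - 1 + τ → κ ≤ |F (u t)| := fun t h1 h2 => by
      rcases le_total t (z - 1) with h3 | h3
      · exact hl1 t h1 h3
      rcases le_total t 1 with h4 | h4
      · exact hl2 t h3 h4
      · refine hone t (hinv.le.trans (hend.trans ?_))
        exact h.antitone hF hα h4 (by linarith) (by linarith)
    refine ⟨h2τ, fun t h1 h2 => le_trans ?_ (hall t h1 h2), ?_⟩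
    · rw [div_le_iff₀ (by linarith)]
      nlinarith
    · have h1 := h.integral_le_trough hF hα zero_le_one le_rfl
      have h2 := integral_mono_subinterval hg (fun _ => abs_nonneg _) (a := z - 1)
        (b := z - 1 + 1) (a' := z - 1) (b' := z - 1 + τ) le_rfl (by linarith) (by linarith)
      have h3 := mul_le_integral hg (a := z - 1) (b := z - 1 + τ) (m := κ) (by linarith)
        fun s hs => hall s (by linarith [hs.1]) hs.2
      rw [div_le_iff₀' (by linarith)]
      linarith
  rcases le_total z 2 with hz2 | hz2
  · -- short hump: `u` rises on `[0, z - 1]`, and the integral there is bounded below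
    have h1 := h.peak_le_integral hF hα hz2
    have h2 := intervalIntegral.integral_add_adjacent_intervals (μ := volume)
      (hg.intervalIntegrable 0 (z - 1 - τ)) (hg.intervalIntegrable (z - 1 - τ) (z - 1))
    have h3 := integral_le_mul hg (a := z - 1 - τ) (b := z - 1) (m := C) (by linarith)
      fun s _ => hF.abs_le _
    have h4 := integral_le_mul hg (a := 0) (b := z - 1 - τ) (m := Λ * |F (u (z - 1 - τ))|)
      (by linarith) fun s hs => h.compare_rise hF hα hs.1 hs.2 (by linarith)
    have h5 : k₁ ≤ |F (u (z - 1 - τ))| := by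
      rw [hk₁, div_le_iff₀' (by positivity)]
      change _ ≤ D * _ at h1
      have h6 : 0 ≤ Λ * |F (u (z - 1 - τ))| := by positivity
      nlinarith
    have h6 : ∀ t, z - 1 - τ ≤ t → t ≤ 1 → κ ≤ |F (u t)| := fun t h6 h7 => by
      have h8 := h.compare_rise hF hα (s := z - 1 - τ) (t := t) (by linarith) h6 h7
      refine hκk.trans ?_
      rw [div_le_iff₀' (by positivity)]
      exact h5.trans h8
    exact ⟨fun t h7 h8 => h6 t h7 (by linarith), fun t h7 h8 => h6 t (by linarith) h8⟩
  · -- long hump: `u ≥ 1 / β` until `z - 1`, since a smaller value would lead to a zero within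
    -- one unit of time
    have h1 : 1 / β ≤ u (z - 1) := by
      by_contra! h2
      obtain ⟨s, hs, hus⟩ := intermediate_value_Icc' (by linarith : 1 ≤ z - 1)
        h.continuous.continuousOn ⟨h2.le, hinv2.le.trans (hnear 1 (by linarith) (by linarith))⟩
      have hs1 : 1 + τ ≤ s := by
        by_contra! h3
        have := hnear s (by linarith [hs.1]) h3.le
        linarith
      have h3 := (h.fall hF hα (a := s) (b := s + 1) hs.1 (by linarith) (by linarith [hs.2])).1
      have h4 : 0 ≤ Real.exp (α * (s + 1 - s)) * u (s + 1) :=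
        mul_nonneg (Real.exp_pos _).le (h.nonneg (by linarith) (by linarith [hs.2]))
      have h5 := integral_mono_subinterval hg (fun _ => abs_nonneg _) (a := s - 1)
        (b := s + 1 - 1) (a' := s - τ) (b' := s) (by linarith) (by linarith) (by linarith)
      have h6 := mul_le_integral hg (a := s - τ) (b := s) (m := κ) (by linarith) fun r hr =>
        hone r (by
          rw [← hus]
          exact h.antitone hF hα (by linarith [hr.1]) hr.2 (by linarith [hs.2]))
      linarith
    refine ⟨fun t h2 h3 => hone t ?_, fun t h2 h3 => hone t ?_⟩
    · rcases le_total t 1 with h4 | h4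
      · exact hinv2.le.trans (hnear t (by linarith) (by linarith))
      · exact h1.trans (h.antitone hF hα h4 h3 (by linarith))
    · exact hinv2.le.trans (hnear t (by linarith) (by linarith))

/-- Uniform bounds on the positive hump of a profile: it lasts between `1 + 2τ` and `Z`, is at least
`κτ` at distance `τ` from its ends, crosses zero at its end with slope at most `-κ`, and has slope
at most `-κ` at time `1 + τ`. -/
structure HumpBounds (α κ τ Z : ℝ) (F u : ℝ → ℝ) (z : ℝ) : Prop where
  two_mul_le : 2 * τ ≤ z - 1
  le : z ≤ Z
  lower : ∀ t, τ ≤ t → t ≤ z - τ → κ * τ ≤ u t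
  slope_end : ∀ t, z - τ ≤ t → t ≤ z + τ → -α * u t + F (u (t - 1)) ≤ -κ
  slope_mid : -α * u (1 + τ) + F (u τ) ≤ -κ

theorem exists_peak_and_trough_lower {α c C : ℝ} (hα : 0 ≤ α) (hc : 0 < c) (hcC : c ≤ C) :
    ∃ δ : ℝ, 0 < δ ∧ ∃ β₁ : ℝ, ∀ (β : ℝ) (F u : ℝ → ℝ) (z y : ℝ), β₁ < β →
      FeedbackBounds c C β F → IsProfile α F u z y → δ ≤ u 1 ∧ δ ≤ -u (z + 1) := by
  obtain ⟨δ, hδ, b₁, h1⟩ := exists_peak_or_trough_lower hα hc hcC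
  obtain ⟨τ, κ, hτ, -, hκ, b₂, h2⟩ := exists_feedback_lower hα hc hcC hδ
  refine ⟨min δ κ, lt_min hδ hκ, max b₁ b₂, fun β F u z y hβ hF h => ?_⟩
  have hβ1 : b₁ < β := (le_max_left _ _).trans_lt hβ
  have hβ2 : b₂ < β := (le_max_right _ _).trans_lt hβ
  rcases h1 β F u z y hβ1 hF h with h3 | h3
  · exact ⟨(min_le_left _ _).trans h3, (min_le_right _ _).trans (h2 β F u z y hβ2 hF h h3).2.2⟩
  · refine ⟨(min_le_right _ _).trans ?_, (min_le_left _ _).trans h3⟩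
    have := (h2 β _ _ y z hβ2 hF.flip h.flip (by rwa [add_comm 1 z])).2.2
    rwa [neg_neg, show y + 1 + z = 1 + (z + y) by ring, h.periodic] at this

/-- For large `β` the bounds hold with constants independent of `β` and of the profile; applied to
`IsProfile.flip`, they bound the negative hump as well. -/
theorem exists_humpBounds {α c C : ℝ} (hα : 0 ≤ α) (hc : 0 < c) (hcC : c ≤ C) :
    ∃ τ κ Z : ℝ, 0 < τ ∧ τ ≤ 1 / 4 ∧ 0 < κ ∧ 0 < Z ∧ ∃ β₁ : ℝ,
      ∀ (β : ℝ) (F u : ℝ → ℝ) (z y : ℝ), β₁ < β → FeedbackBounds c C β F →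
        IsProfile α F u z y → HumpBounds α κ τ Z F u z := by
  obtain ⟨δ, hδ, b₁, h1⟩ := exists_peak_and_trough_lower hα hc hcC
  obtain ⟨τ₀, k, hτ₀, hτ4, hk, b₂, h2⟩ := exists_feedback_lower hα hc hcC hδ
  have hD := Real.one_le_exp hα
  have hC : 0 < C := hc.trans_le hcC
  set D := Real.exp α with hDdef
  set L := C * (1 + α) with hL
  have hL0 : 0 < L := by positivity
  set τ := min τ₀ (k / (2 * (α * L + 1))) with hτ
  have hτ0 : 0 < τ := by positivity
  have hττ : τ ≤ τ₀ := min_le_left _ _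
  have hτk : α * L * τ ≤ k / 2 := by
    have h3 : τ ≤ k / (2 * (α * L + 1)) := min_le_right _ _
    rw [le_div_iff₀ (by positivity)] at h3
    nlinarith
  set κ := min (min (k / 2) (k / D ^ 2)) c with hκ
  have hκ0 : 0 < κ := by positivity
  have hκ1 : κ ≤ k / 2 := (min_le_left _ _).trans (min_le_left _ _)
  have hκ2 : κ ≤ k / D ^ 2 := (min_le_left _ _).trans (min_le_right _ _)
  have hκc : κ ≤ c := min_le_right _ _
  refine ⟨τ, κ, 2 + C / c, hτ0, hττ.trans hτ4, hκ0, by positivity,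
    max (max b₁ b₂) (1 / (κ * τ)), fun β F u z y hβ hF h => ?_⟩
  have hβ1 : b₁ < β := ((le_max_left _ _).trans (le_max_left _ _)).trans_lt hβ
  have hβ2 : b₂ < β := ((le_max_right _ _).trans (le_max_left _ _)).trans_lt hβ
  have hβ3 : 1 < β * (κ * τ) := by
    rw [← div_lt_iff₀ (by positivity)]; exact (le_max_right _ _).trans_lt hβ
  have hβ0 := hF.β_pos
  obtain ⟨hpeak, htrough⟩ := h1 β F u z y hβ1 hF h
  obtain ⟨hz2, hG, -⟩ := h2 β F u z y hβ2 hF h hpeak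
  obtain ⟨hy2, hG', -⟩ := h2 β _ _ y z hβ2 hF.flip h.flip (by rwa [add_comm 1 z])
  have hz := h.one_lt_left
  have hg := h.continuous_feedback hF
  have hg' := h.flip.continuous_feedback hF.flip
  have hstart : k * τ ≤ D * u τ := by
    have h3 := h.flip.integral_le_trough hF.flip hα (t := τ) hτ0.le (by linarith)
    have h4 := mul_le_integral hg' (a := y - 1) (b := y - 1 + τ) (m := k) (by linarith)
      fun s hs => hG' s (by linarith [hs.1]) (by linarith [hs.2])
    rw [neg_neg, show y + τ + z = τ + (z + y) by ring, h.periodic] at h3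
    linarith
  have hend : k * τ ≤ u (z - τ) := by
    have h3 := (h.fall hF hα (a := z - τ) (b := z) (by linarith) (by linarith) (by linarith)).1
    rw [h.zero_mid, mul_zero, zero_add] at h3
    have h4 := mul_le_integral hg (a := z - τ - 1) (b := z - 1) (m := k) (by linarith)
      fun s hs => hG s (by linarith [hs.1]) (by linarith [hs.2])
    linarith
  have hκD : D ^ 2 * κ ≤ k := by
    rwa [le_div_iff₀' (by positivity)] at hκ2
  have hlower : ∀ t, τ ≤ t → t ≤ z - τ → κ * τ ≤ u t := fun t h3 h4 => by
    rcases le_total t 1 with h5 | h5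
    · have h6 := h.rise hF hα hτ0.le h3 h5
      have h7 : D ^ 2 * (κ * τ) ≤ D ^ 2 * u t := by
        calc D ^ 2 * (κ * τ) = D ^ 2 * κ * τ := by ring
          _ ≤ k * τ := mul_le_mul_of_nonneg_right hκD hτ0.le
          _ ≤ D * u τ := hstart
          _ ≤ D * (D * u t) := mul_le_mul_of_nonneg_left h6 (by linarith)
          _ = _ := by ring
      exact le_of_mul_le_mul_left h7 (by positivity)
    · have h6 := h.antitone hF hα h5 h4 (by linarith)
      have h7 : κ * τ ≤ k * τ := mul_le_mul_of_nonneg_right (by linarith) hτ0.le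
      linarith
  have hGc : ∀ t, τ ≤ t → t ≤ z - τ → c ≤ |F (u t)| := fun t h3 h4 => by
    refine hF.le_of_one_le (hβ3.le.trans ?_)
    exact mul_le_mul_of_nonneg_left ((hlower t h3 h4).trans (le_abs_self _)) hβ0.le
  refine ⟨by linarith, ?_, hlower, fun t h3 h4 => ?_, ?_⟩
  · have h3 := (h.fall hF hα (a := 1 + τ) (b := z) (by linarith) (by linarith) (by linarith)).1
    rw [h.zero_mid, mul_zero, zero_add, add_sub_cancel_left] at h3
    have h4 := mul_le_integral hg (a := τ) (b := z - 1) (m := c) (by linarith)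
      fun s hs => hGc s hs.1 (by linarith [hs.2])
    have h5 := (abs_le.1 (h.abs_le hF hα (1 + τ))).2
    have h6 : z - 1 - τ ≤ C / c := by
      rw [le_div_iff₀ hc]; linarith
    linarith
  · have h5 := hG (t - 1) (by linarith) (by linarith)
    have h6 := hF.of_nonneg (h.nonneg (t := t - 1) (by linarith) (by linarith))
    have h7 := h.lipschitz hF hα z t
    rw [h.zero_mid, sub_zero, ← hL] at h7
    have h8 : |t - z| ≤ τ := abs_le.2 ⟨by linarith, by linarith⟩
    have h9 : L * |t - z| ≤ L * τ := mul_le_mul_of_nonneg_left h8 hL0.le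
    have h10 : -α * u t ≤ α * (L * τ) := by
      have := mul_le_mul_of_nonneg_left ((neg_le_abs (u t)).trans (h7.trans h9)) hα
      linarith
    linarith
  · have h5 := hGc τ le_rfl (by linarith)
    have h6 := hF.of_nonneg (h.nonneg (t := τ) (by linarith) (by linarith))
    have h7 := mul_nonneg hα (h.nonneg (t := 1 + τ) (by linarith) (by linarith))
    linarith

/-! ### The linear equation over one period -/

/-- Right-hand side of the complex scalar linear equation `y'(t) = -α y(t) + K(t-1) y(t-1)`. -/
noncomputable def linearRHS (α : ℝ) (K : ℝ → ℝ) : ℝ → ℂ → ℂ → ℂ :=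
  fun t u v => -(α : ℂ) * u + (K (t - 1) : ℂ) * v

namespace IsDDESolution

variable {α : ℝ} {K : ℝ → ℝ} {y : ℝ → ℂ}

theorem shift_linear (hy : IsDDESolution (linearRHS α K) y) {T : ℝ} (hT : 0 ≤ T) :
    IsDDESolution (linearRHS α fun s => K (s + T)) fun t => y (t + T) := by
  refine ⟨hy.1.comp (by fun_prop) fun t ht => ?_, fun t ht => ?_⟩
  · simp only [mem_Ici] at ht ⊢; linarith
  · have h1 := (hy.2 (t + T) (by linarith)).comp_add_const t T
    refine h1.congr_deriv ?_
    simp only [linearRHS]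
    rw [show t - 1 + T = t + T - 1 by ring]

theorem sub_const_mul (hy : IsDDESolution (linearRHS α K) y) {q : ℝ → ℂ}
    (hq : IsDDESolution (linearRHS α K) q) (a : ℂ) :
    IsDDESolution (linearRHS α K) fun t => y t - a * q t := by
  refine ⟨hy.1.sub (continuousOn_const.mul hq.1), fun t ht => ?_⟩
  refine ((hy.2 t ht).sub ((hq.2 t ht).const_mul a)).congr_deriv ?_
  simp only [linearRHS]; ring

/-- Since `α ≥ 0`, a solution grows at most by the integral of the delayed term. -/
theorem norm_le_add_mul_integral (hy : IsDDESolution (linearRHS α K) y) (hα : 0 ≤ α)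
    (hK : Continuous K) {a b m : ℝ} (ha : 0 < a) (hab : a ≤ b)
    (hm : ∀ s ∈ Icc (a - 1) (b - 1), ‖y s‖ ≤ m) :
    ‖y b‖ ≤ ‖y a‖ + m * ∫ s in (a - 1)..(b - 1), |K s| := by
  have hm0 : 0 ≤ m := (norm_nonneg _).trans (hm (a - 1) ⟨le_rfl, by linarith⟩)
  set w : ℝ → ℂ := fun s => (Real.exp (α * (s + 1)) : ℂ) * y (s + 1) with hw
  have hexp : ∀ s : ℝ, HasDerivAt (fun s : ℝ => ((Real.exp (α * (s + 1)) : ℝ) : ℂ))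
      ((Real.exp (α * (s + 1)) * α : ℝ) : ℂ) s := fun s => by
    have : HasDerivAt (fun s : ℝ => Real.exp (α * (s + 1))) (Real.exp (α * (s + 1)) * α) s := by
      have := (((hasDerivAt_id s).add_const 1).const_mul α).exp
      simpa using this
    exact this.ofReal_comp
  have hd : ∀ s ∈ uIcc (a - 1) (b - 1), HasDerivAt w
      ((Real.exp (α * (s + 1)) : ℂ) * ((K s : ℂ) * y s)) s := fun s hs => by
    rw [uIcc_of_le (by linarith)] at hs
    have h2 := (hy.2 (s + 1) (by linarith [hs.1])).comp_add_const s 1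
    refine ((hexp s).mul h2).congr_deriv ?_
    simp only [linearRHS]
    rw [show s + 1 - 1 = s by ring]
    push_cast; ring
  have hyc : ContinuousOn y (Icc (a - 1) (b - 1)) := hy.1.mono fun s hs => by
    simp only [mem_Ici]; linarith [hs.1]
  have hc : ContinuousOn (fun s : ℝ => (Real.exp (α * (s + 1)) : ℂ) * ((K s : ℂ) * y s))
      (uIcc (a - 1) (b - 1)) := by
    rw [uIcc_of_le (by linarith)]
    exact ContinuousOn.mul (by fun_prop) (ContinuousOn.mul (by fun_prop) hyc)
  have h1 := intervalIntegral.integral_eq_sub_of_hasDerivAt hd hc.intervalIntegrable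
  have h2 : ‖∫ s in (a - 1)..(b - 1), (Real.exp (α * (s + 1)) : ℂ) * ((K s : ℂ) * y s)‖ ≤
      ∫ s in (a - 1)..(b - 1), Real.exp (α * b) * m * |K s| := by
    refine intervalIntegral.norm_integral_le_of_norm_le (by linarith) (ae_of_all _ fun s hs => ?_)
      ((continuous_const.mul hK.abs).intervalIntegrable _ _)
    rw [norm_mul, norm_mul, Complex.norm_real, Complex.norm_real, Real.norm_eq_abs,
      Real.norm_eq_abs, abs_of_pos (Real.exp_pos _)]
    have h3 : Real.exp (α * (s + 1)) ≤ Real.exp (α * b) :=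
      Real.exp_le_exp.2 (mul_le_mul_of_nonneg_left (by linarith [hs.2]) hα)
    have h4 := hm s ⟨hs.1.le, hs.2⟩
    calc Real.exp (α * (s + 1)) * (|K s| * ‖y s‖) ≤ Real.exp (α * b) * (|K s| * m) := by gcongr
      _ = _ := by ring
  rw [intervalIntegral.integral_const_mul, h1] at h2
  simp only [hw, sub_add_cancel] at h2
  have h5 := norm_sub_norm_le ((Real.exp (α * b) : ℂ) * y b) ((Real.exp (α * a) : ℂ) * y a)
  rw [norm_mul, norm_mul, Complex.norm_real, Complex.norm_real, Real.norm_eq_abs,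
    Real.norm_eq_abs, abs_of_pos (Real.exp_pos _), abs_of_pos (Real.exp_pos _)] at h5
  have h6 : Real.exp (α * a) * ‖y a‖ ≤ Real.exp (α * b) * ‖y a‖ :=
    mul_le_mul_of_nonneg_right
      (Real.exp_le_exp.2 (mul_le_mul_of_nonneg_left hab hα)) (norm_nonneg _)
  refine le_of_mul_le_mul_left ?_ (Real.exp_pos (α * b))
  linarith

/-- A solution over the hump `[0, z]`, when the coefficient is concentrated near the ends of the
hump: it stays bounded and, from time `1 + τ` on, it is controlled by its value at that time, up to
an error of the size `ε` of the coefficient inside the hump. -/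
theorem half_period (hy : IsDDESolution (linearRHS α K) y) (hα : 0 ≤ α) (hK : Continuous K)
    {τ z Z ε C₀ N : ℝ} (hτ : 0 < τ) (hτ4 : τ ≤ 1 / 4) (hz : 2 * τ ≤ z - 1) (hzZ : z ≤ Z)
    (hεZ : ε * Z ≤ 1 / 2) (hKε : ∀ s, τ ≤ s → s ≤ z - τ → |K s| ≤ ε)
    (hK0 : ∫ s in (-τ)..τ, |K s| ≤ C₀) (hN : ∀ t ∈ Icc (-τ) (1 - τ), ‖y t‖ ≤ N) :
    (∀ t ∈ Icc (-τ) (z + 1 - τ), ‖y t‖ ≤ 2 * (1 + C₀) * N) ∧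
      ∀ t ∈ Icc (1 + τ) (z + 1 - τ), ‖y t‖ ≤ ‖y (1 + τ)‖ + ε * Z * (2 * (1 + C₀) * N) := by
  have hN0 : 0 ≤ N := (norm_nonneg _).trans (hN 0 ⟨by linarith, by linarith⟩)
  have hC0 : 0 ≤ C₀ :=
    (intervalIntegral.integral_nonneg (by linarith) fun _ _ => abs_nonneg _).trans hK0
  have hε0 : 0 ≤ ε := (abs_nonneg _).trans (hKε τ le_rfl (by linarith))
  have hyc : ContinuousOn (fun t => ‖y t‖) (Icc (-τ) (z + 1 - τ)) := (hy.1.mono fun s hs => by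
    simp only [mem_Ici]; linarith [hs.1]).norm
  obtain ⟨t₀, ht₀, hmax⟩ := isCompact_Icc.exists_isMaxOn ⟨0, by constructor <;> linarith⟩ hyc
  set M := ‖y t₀‖ with hM
  have hM0 : 0 ≤ M := norm_nonneg _
  have hmax' : ∀ t ∈ Icc (-τ) (z + 1 - τ), ‖y t‖ ≤ M := fun t ht => hmax ht
  have h1 : ∀ t, 1 - τ ≤ t → t ≤ 1 + τ → ‖y t‖ ≤ (1 + C₀) * N := fun t h1 h2 => by
    have h3 := hy.norm_le_add_mul_integral hα hK (a := 1 - τ) (b := t) (m := N) (by linarith) h1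
      fun s hs => hN s ⟨by linarith [hs.1], by linarith [hs.2]⟩
    have h4 := integral_mono_subinterval hK.abs (fun _ => abs_nonneg _) (a := -τ) (b := τ)
      (a' := 1 - τ - 1) (b' := t - 1) (by linarith) (by linarith) (by linarith)
    have h5 := hN (1 - τ) ⟨by linarith, le_rfl⟩
    have h6 := mul_le_mul_of_nonneg_left (h4.trans hK0) hN0
    linarith
  have h2 : ∀ t, 1 + τ ≤ t → t ≤ z + 1 - τ → ‖y t‖ ≤ ‖y (1 + τ)‖ + ε * Z * M :=
    fun t h2 h3 => by
      have h4 := hy.norm_le_add_mul_integral hα hK (a := 1 + τ) (b := t) (m := M) (by linarith) h2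
        fun s hs => hmax' s ⟨by linarith [hs.1], by linarith [hs.2]⟩
      have h5 := integral_le_mul hK.abs (a := 1 + τ - 1) (b := t - 1) (m := ε) (by linarith)
        fun s hs => hKε s (by linarith [hs.1]) (by linarith [hs.2])
      have h6 : (t - 1 - (1 + τ - 1)) * ε ≤ Z * ε :=
        mul_le_mul_of_nonneg_right (by linarith) hε0
      have h7 := mul_le_mul_of_nonneg_left (h5.trans h6) hM0
      linarith
  have hM2 : M ≤ 2 * (1 + C₀) * N := by
    have h3 : M ≤ (1 + C₀) * N + ε * Z * M := by
      have h7 : 0 ≤ ε * Z * M := mul_nonneg (mul_nonneg hε0 (by linarith)) hM0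
      rcases le_total t₀ (1 - τ) with h4 | h4
      · have := hN t₀ ⟨ht₀.1, h4⟩
        have := mul_nonneg hC0 hN0
        linarith
      rcases le_total t₀ (1 + τ) with h5 | h5
      · have := h1 t₀ h4 h5
        linarith
      · have h6 := h2 t₀ h5 ht₀.2
        have := h1 (1 + τ) (by linarith) le_rfl
        linarith
    nlinarith
  refine ⟨fun t ht => (hmax' t ht).trans hM2, fun t ht => (h2 t ht.1 ht.2).trans ?_⟩
  have := mul_le_mul_of_nonneg_left hM2 (mul_nonneg hε0 (by linarith : 0 ≤ Z))
  linarith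

/-- Over a full period, all solutions become close to multiples of one given solution `q` that does
not vanish at time `1 + τ`. -/
theorem exists_near_multiple (hy : IsDDESolution (linearRHS α K) y) {q : ℝ → ℂ}
    (hq : IsDDESolution (linearRHS α K) q) (hα : 0 ≤ α) (hK : Continuous K)
    {τ z z' Z ε C₀ N Q κ : ℝ} (hτ : 0 < τ) (hτ4 : τ ≤ 1 / 4)
    (hz : 2 * τ ≤ z - 1) (hzZ : z ≤ Z) (hz' : 2 * τ ≤ z' - 1) (hzZ' : z' ≤ Z)
    (hεZ : ε * Z ≤ 1 / 2) (hKε : ∀ s, τ ≤ s → s ≤ z - τ → |K s| ≤ ε)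
    (hKε' : ∀ s, τ ≤ s → s ≤ z' - τ → |K (s + z)| ≤ ε)
    (hK0 : ∫ s in (-τ)..τ, |K s| ≤ C₀) (hK0' : ∫ s in (-τ)..τ, |K (s + z)| ≤ C₀)
    (hκ : 0 < κ) (hqκ : κ ≤ ‖q (1 + τ)‖) (hqQ : ∀ t, -1 ≤ t → ‖q t‖ ≤ Q)
    (hN : ∀ t ∈ Icc (-τ) (1 - τ), ‖y t‖ ≤ N) :
    ∃ a : ℂ, ∀ t ∈ Icc (z + z' - τ) (z + z' + 1 - τ), ‖y t - a * q t‖ ≤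
      ε * (Z * (2 * (1 + C₀)) ^ 2 * (1 + 2 * (1 + C₀) * Q / κ)) * N := by
  set A := 2 * (1 + C₀) with hA
  have hC0 : 0 ≤ C₀ :=
    (intervalIntegral.integral_nonneg (by linarith) fun _ _ => abs_nonneg _).trans hK0
  have hN0 : 0 ≤ N := (norm_nonneg _).trans (hN 0 ⟨by linarith, by linarith⟩)
  have hQ0 : 0 ≤ Q := (norm_nonneg _).trans (hqQ 0 (by norm_num))
  have hA0 : 0 < A := by positivity
  set a := y (1 + τ) / q (1 + τ) with ha
  have hq0 : q (1 + τ) ≠ 0 := fun h => by rw [h, norm_zero] at hqκ; linarith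
  have hy1 := (hy.half_period hα hK hτ hτ4 hz hzZ hεZ hKε hK0 hN).1 (1 + τ)
    ⟨by linarith, by linarith⟩
  have ha1 : ‖a‖ ≤ A * N / κ := by
    rw [ha, norm_div]
    exact div_le_div₀ (by positivity) hy1 hκ hqκ
  have hd := hy.sub_const_mul hq a
  have hN1 : ∀ t ∈ Icc (-τ) (1 - τ), ‖y t - a * q t‖ ≤ (1 + A * Q / κ) * N := fun t ht => by
    refine (norm_sub_le _ _).trans ?_
    rw [norm_mul]
    have h1 := mul_le_mul ha1 (hqQ t (by linarith [ht.1])) (norm_nonneg _) (by positivity)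
    calc ‖y t‖ + ‖a‖ * ‖q t‖ ≤ N + A * N / κ * Q := add_le_add (hN t ht) h1
      _ = _ := by ring
  have h1 := (hd.half_period hα hK hτ hτ4 hz hzZ hεZ hKε hK0 hN1).2
  have h2 : y (1 + τ) - a * q (1 + τ) = 0 := by rw [ha, div_mul_cancel₀ _ hq0, sub_self]
  rw [h2, norm_zero, zero_add] at h1
  have h3 := (hd.shift_linear (T := z) (by linarith)).half_period hα
    (hK.comp (continuous_add_const z)) (z := z') hτ hτ4 hz' hzZ' hεZ hKε' hK0'
    (N := ε * Z * (A * ((1 + A * Q / κ) * N))) fun t ht =>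
      h1 (t + z) ⟨by linarith [ht.1], by linarith [ht.2]⟩
  refine ⟨a, fun t ht => ?_⟩
  have h4 := h3.1 (t - z) ⟨by linarith [ht.1], by linarith [ht.2]⟩
  rw [sub_add_cancel] at h4
  refine h4.trans (le_of_eq ?_)
  ring

end IsDDESolution

/-! ### The nonlinearity -/

namespace BoundedNegativeFeedback

variable {f : ℝ → ℝ}

theorem apply_zero (hf : BoundedNegativeFeedback f) : f 0 = 0 := by
  have hc : ContinuousAt f 0 := hf.contDiff.continuous.continuousAt
  apply le_antisymm
  · refine le_of_tendsto (hc.tendsto.mono_left nhdsWithin_le_nhds : Tendsto f (𝓝[>] 0) _) ?_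
    filter_upwards [self_mem_nhdsWithin] with x hx
    have hx' : (0 : ℝ) < x := hx
    have := hf.feedback x hx'.ne'
    by_contra! h
    nlinarith [mul_pos h hx']
  · refine ge_of_tendsto (hc.tendsto.mono_left nhdsWithin_le_nhds : Tendsto f (𝓝[<] 0) _) ?_
    filter_upwards [self_mem_nhdsWithin] with x hx
    have hx' : x < (0 : ℝ) := hx
    have := hf.feedback x hx'.ne
    by_contra! h
    nlinarith [mul_pos_of_neg_of_neg h hx']

/-- `f` is comparable to the identity near `0` and to a constant away from `0`. -/
theorem exists_bounds (hf : BoundedNegativeFeedback f) :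
    ∃ c C : ℝ, 0 < c ∧ c ≤ C ∧ ∀ ξ, c * min |ξ| 1 ≤ |f ξ| ∧ |f ξ| ≤ C * min |ξ| 1 := by
  obtain ⟨a, b, ha, hb, hfa, hfb⟩ := hf.limits
  have hdiff : Differentiable ℝ f := hf.contDiff.differentiable one_ne_zero
  have hfac : ∀ ξ, f ξ = ξ * dslope f 0 ξ := fun ξ => by
    have := sub_smul_dslope f 0 ξ
    rw [hf.apply_zero] at this
    simpa using this.symm
  have hds : Continuous (dslope f 0) := by
    rw [← continuousOn_univ, continuousOn_dslope univ_mem]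
    exact ⟨hdiff.continuous.continuousOn, hdiff 0⟩
  have hne : ∀ ξ, 0 < |dslope f 0 ξ| := fun ξ => by
    rw [abs_pos]
    rcases eq_or_ne ξ 0 with rfl | h
    · rw [dslope_same]; exact hf.deriv_zero_neg.ne
    · intro h0
      have := hf.feedback ξ h
      rw [hfac ξ, h0] at this
      simp at this
  obtain ⟨R₁, hR₁⟩ := eventually_atTop.1 (hfa.abs.eventually
    (Icc_mem_nhds (a := a / 2) (b := 2 * a) (by rw [abs_neg, abs_of_pos ha]; linarith)
      (by rw [abs_neg, abs_of_pos ha]; linarith)))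
  obtain ⟨R₂, hR₂⟩ := eventually_atBot.1 (hfb.abs.eventually
    (Icc_mem_nhds (a := b / 2) (b := 2 * b) (by rw [abs_of_pos hb]; linarith)
      (by rw [abs_of_pos hb]; linarith)))
  set R := max 1 (max R₁ (-R₂)) with hR
  have hR1 : 1 ≤ R := le_max_left _ _
  have hRR₁ : R₁ ≤ R := (le_max_left _ _).trans (le_max_right _ _)
  have hRR₂ : -R₂ ≤ R := (le_max_right _ _).trans (le_max_right _ _)
  have hne' : (Icc (-R) R).Nonempty := ⟨0, by constructor <;> linarith⟩
  obtain ⟨x₁, -, h1⟩ := isCompact_Icc.exists_isMinOn hne' hds.abs.continuousOn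
  obtain ⟨x₂, -, h2⟩ := isCompact_Icc.exists_isMaxOn hne' hds.abs.continuousOn
  set m := |dslope f 0 x₁|
  set M := |dslope f 0 x₂|
  have hm : 0 < m := hne _
  have hM : 0 < M := hne _
  set c := min m (min (a / 2) (b / 2)) with hc
  set C := max (M * R) (max (2 * a) (2 * b)) with hC
  have hc0 : 0 < c := by positivity
  have key : ∀ ξ, c * min |ξ| 1 ≤ |f ξ| ∧ |f ξ| ≤ C * min |ξ| 1 := fun ξ => by
    rcases le_or_gt |ξ| R with h | h
    · have hmem : ξ ∈ Icc (-R) R := abs_le.1 h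
      have h3 : m ≤ |dslope f 0 ξ| := h1 hmem
      have h4 : |dslope f 0 ξ| ≤ M := h2 hmem
      rw [hfac ξ, abs_mul]
      constructor
      · calc c * min |ξ| 1 ≤ m * |ξ| := mul_le_mul (min_le_left _ _) (min_le_left _ _)
              (by positivity) hm.le
          _ ≤ |ξ| * |dslope f 0 ξ| := by rw [mul_comm]; gcongr
      · have h5 : |ξ| ≤ R * min |ξ| 1 := by
          rcases le_total |ξ| 1 with h6 | h6
          · rw [min_eq_left h6]; nlinarith [abs_nonneg ξ]
          · rw [min_eq_right h6]; linarith
        calc |ξ| * |dslope f 0 ξ| ≤ (R * min |ξ| 1) * M := by gcongr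
          _ = M * R * min |ξ| 1 := by ring
          _ ≤ C * min |ξ| 1 := mul_le_mul_of_nonneg_right (le_max_left _ _) (by positivity)
    · rw [min_eq_right (hR1.trans h.le), mul_one, mul_one]
      rcases le_total 0 ξ with h0 | h0
      · rw [abs_of_nonneg h0] at h
        have h3 := hR₁ ξ (hRR₁.trans h.le)
        exact ⟨((min_le_right _ _).trans (min_le_left _ _)).trans h3.1,
          h3.2.trans ((le_max_left _ _).trans (le_max_right _ _))⟩
      · rw [abs_of_nonpos h0] at h
        have h3 := hR₂ ξ (by linarith)
        exact ⟨((min_le_right _ _).trans (min_le_right _ _)).trans h3.1,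
          h3.2.trans ((le_max_right _ _).trans (le_max_right _ _))⟩
  refine ⟨c, C, hc0, ?_, key⟩
  have := key 1
  simp only [abs_one, min_self, mul_one] at this
  exact this.1.trans this.2

theorem feedbackBounds (hf : BoundedNegativeFeedback f) {c C : ℝ} (hc : 0 < c)
    (h : ∀ ξ, c * min |ξ| 1 ≤ |f ξ| ∧ |f ξ| ≤ C * min |ξ| 1) {β : ℝ} (hβ : 0 < β) :
    FeedbackBounds c C β fun v => f (β * v) where
  c_pos := hc
  β_pos := hβ
  cont := hf.contDiff.continuous.comp (by fun_prop)
  sign v := by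
    rcases eq_or_ne v 0 with rfl | hv
    · simp
    · have := hf.feedback (β * v) (mul_ne_zero hβ.ne' hv)
      by_contra! h1
      nlinarith [mul_pos hβ h1]
  lower v := by
    have := (h (β * v)).1
    rwa [abs_mul, abs_of_pos hβ] at this
  upper v := by
    have := (h (β * v)).2
    rwa [abs_mul β v, abs_of_pos hβ] at this

theorem exists_decay (hf : BoundedNegativeFeedback f) {ε : ℝ} (hε : 0 < ε) :
    ∃ R : ℝ, ∀ ξ, R ≤ |ξ| → |ξ * deriv f ξ| ≤ ε := by
  obtain ⟨R₁, hR₁⟩ := eventually_atTop.1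
    (hf.decay_atTop.eventually (Metric.closedBall_mem_nhds 0 hε))
  obtain ⟨R₂, hR₂⟩ := eventually_atBot.1
    (hf.decay_atBot.eventually (Metric.closedBall_mem_nhds 0 hε))
  refine ⟨max R₁ (-R₂), fun ξ hξ => ?_⟩
  have h1 := (le_max_left _ _).trans hξ
  have h2 := (le_max_right _ _).trans hξ
  rcases le_total 0 ξ with h | h
  · rw [abs_of_nonneg h] at h1
    simpa using hR₁ ξ h1
  · rw [abs_of_nonpos h] at h2
    simpa using hR₂ ξ (by linarith)

end BoundedNegativeFeedback

/-- Change of variables along a steeply decreasing function. -/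
theorem mul_integral_comp_le {g v v' : ℝ → ℝ} (hg : Continuous g) (hgi : Integrable g)
    (hv : ∀ s, HasDerivAt v (v' s) s) (hv' : Continuous v') {a b m : ℝ} (hab : a ≤ b)
    (hm : ∀ s ∈ Icc a b, v' s ≤ -m) :
    m * ∫ s in a..b, |g (v s)| ≤ ∫ ξ, |g ξ| := by
  have hvc : Continuous v := continuous_iff_continuousAt.2 fun s => (hv s).continuousAt
  have hgv : Continuous fun s => |g (v s)| := (hg.comp hvc).abs
  have h1 := intervalIntegral.integral_comp_mul_deriv (a := a) (b := b) (f := v) (f' := v')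
    (g := fun ξ => |g ξ|) (fun s _ => hv s) hv'.continuousOn hg.abs
  have h2 : ∫ s in a..b, m * |g (v s)| ≤ ∫ s in a..b, -(((fun ξ => |g ξ|) ∘ v) s * v' s) := by
    refine intervalIntegral.integral_mono_on hab ((continuous_const.mul hgv).intervalIntegrable _ _)
      ((hgv.mul hv').neg.intervalIntegrable _ _) fun s hs => ?_
    have := hm s hs
    simp only [Function.comp]
    nlinarith [abs_nonneg (g (v s))]
  rw [intervalIntegral.integral_const_mul, intervalIntegral.integral_neg, h1] at h2
  refine h2.trans ?_
  rw [← intervalIntegral.integral_symm]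
  refine (le_abs_self _).trans ?_
  rw [← Real.norm_eq_abs]
  refine (intervalIntegral.norm_integral_le_integral_norm_uIoc).trans ?_
  simp only [Real.norm_eq_abs, abs_abs]
  exact setIntegral_le_integral hgi.abs (ae_of_all _ fun _ => abs_nonneg _)

/-- The derivative of a profile, as a complex function; it solves the linearized equation. -/
noncomputable def IsProfile.velocity (α : ℝ) (F u : ℝ → ℝ) : ℝ → ℂ :=
  fun t => ((-α * u t + F (u (t - 1)) : ℝ) : ℂ)

/-- For large `β` the linearized equation contracts, over one period, transversally to the
derivative of the profile. -/
theorem exists_contraction {α : ℝ} (hα : 0 ≤ α) {f : ℝ → ℝ} (hf : BoundedNegativeFeedback f) :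
    ∃ β₀ τ : ℝ, 0 < β₀ ∧ 0 < τ ∧ τ ≤ 1 / 4 ∧ ∀ (β : ℝ) (u : ℝ → ℝ) (z y : ℝ), β₀ < β →
      IsProfile α (fun v => f (β * v)) u z y →
        IsDDESolution (linearRHS α fun s => β * deriv f (β * u s))
          (IsProfile.velocity α (fun v => f (β * v)) u) ∧
        IsProfile.velocity α (fun v => f (β * v)) u 0 ≠ 0 ∧
        ∀ (x : ℝ → ℂ) (N : ℝ), IsDDESolution (linearRHS α fun s => β * deriv f (β * u s)) x →
          (∀ t ∈ Icc (-τ) (1 - τ), ‖x t‖ ≤ N) →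
          ∀ t ∈ Icc (z + y - τ) (z + y + 1 - τ),
            ‖x t - x (z + y) / IsProfile.velocity α (fun v => f (β * v)) u (z + y) *
              IsProfile.velocity α (fun v => f (β * v)) u t‖ ≤ 1 / 2 * N := by
  obtain ⟨c, C, hc, hcC, hb⟩ := hf.exists_bounds
  have hC : 0 < C := hc.trans_le hcC
  obtain ⟨τ, κ, Z, hτ, hτ4, hκ, hZ, b₁, hH⟩ := exists_humpBounds hα hc hcC
  have hf' : Continuous (deriv f) := hf.contDiff.continuous_deriv le_rfl
  set I := ∫ ξ, |deriv f ξ| with hI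
  have hI0 : 0 ≤ I := integral_nonneg fun _ => abs_nonneg _
  set C₀ := I / κ with hC₀
  have hC₀0 : 0 ≤ C₀ := by positivity
  set Q := C * (1 + α) with hQ
  have hQ0 : 0 < Q := by positivity
  set B := Z * (2 * (1 + C₀)) ^ 2 * (1 + 2 * (1 + C₀) * Q / κ) with hB
  have hB0 : 0 < B := by positivity
  set ε := 1 / (2 * (Z + B * (1 + Q / κ))) with hε
  have hε0 : 0 < ε := by positivity
  have hεs : ε * (Z + B * (1 + Q / κ)) = 1 / 2 := by
    rw [hε]; field_simp
  have hεZ : ε * Z ≤ 1 / 2 := by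
    rw [← hεs]
    exact mul_le_mul_of_nonneg_left (by linarith [show 0 ≤ B * (1 + Q / κ) by positivity]) hε0.le
  have hεB : ε * B * (1 + Q / κ) ≤ 1 / 2 := by
    rw [← hεs, mul_assoc]
    exact mul_le_mul_of_nonneg_left (by linarith) hε0.le
  obtain ⟨R, hR⟩ := hf.exists_decay (ε := ε * (κ * τ)) (by positivity)
  refine ⟨max 1 (max b₁ (R / (κ * τ))), τ, by positivity, hτ, hτ4, fun β u z y hβ h => ?_⟩
  have hβ0 : 0 < β := one_pos.trans ((le_max_left _ _).trans_lt hβ)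
  have hβ1 : b₁ < β := ((le_max_left _ _).trans (le_max_right _ _)).trans_lt hβ
  have hβ2 : R ≤ β * (κ * τ) := by
    rw [← div_le_iff₀ (by positivity)]
    exact (((le_max_right _ _).trans (le_max_right _ _)).trans_lt hβ).le
  have hF := hf.feedbackBounds hc hb hβ0
  set F : ℝ → ℝ := fun v => f (β * v) with hFdef
  have hu := h.continuous
  have H := hH β F u z y hβ1 hF h
  have H' := hH β _ _ y z hβ1 hF.flip h.flip
  set K : ℝ → ℝ := fun s => β * deriv f (β * u s) with hK
  have hKc : Continuous K := continuous_const.mul (hf'.comp (continuous_const.mul hu))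
  have hKsmall : ∀ s, κ * τ ≤ |u s| → |K s| ≤ ε := fun s hs => by
    have h0 : 0 < |u s| := (by positivity : 0 < κ * τ).trans_le hs
    have h1 := hR (β * u s) (by
      rw [abs_mul, abs_of_pos hβ0]
      exact hβ2.trans (mul_le_mul_of_nonneg_left hs hβ0.le))
    have h2 : |β * u s * deriv f (β * u s)| = |u s| * |K s| := by
      simp only [hK, abs_mul]; ring
    rw [h2] at h1
    have h3 : κ * τ * |K s| ≤ κ * τ * ε :=
      (mul_le_mul_of_nonneg_right hs (abs_nonneg _)).trans (h1.trans (le_of_eq (by ring)))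
    exact le_of_mul_le_mul_left h3 (by positivity)
  set v' : ℝ → ℝ := fun s => -α * u s + F (u (s - 1)) with hv'
  have hv'c : Continuous v' :=
    (continuous_const.mul hu).add (hF.cont.comp (hu.comp (continuous_sub_right 1)))
  have hud : ∀ s, HasDerivAt u (v' s) s := h.deriv
  -- the coefficient near the zeros
  have hKz : ∫ s in (-τ)..τ, |K (s + z)| ≤ C₀ := by
    have h1 := mul_integral_comp_le (v := fun s => β * u (s + z)) (v' := fun s => β * v' (s + z))
      (m := β * κ) hf' hf.integrable_deriv
      (fun s => ((hud (s + z)).comp_add_const s z).const_mul β)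
      (continuous_const.mul (hv'c.comp (continuous_add_const z))) (by linarith : -τ ≤ τ)
      fun s hs => by
        have := H.slope_end (s + z) (by linarith [hs.1]) (by linarith [hs.2])
        change v' (s + z) ≤ -κ at this
        nlinarith
    rw [hC₀, le_div_iff₀' hκ]
    refine le_trans (le_of_eq ?_) h1
    simp only [hK, abs_mul, abs_of_pos hβ0, intervalIntegral.integral_const_mul]
    ring
  have hslope0 : ∀ s, -τ ≤ s → s ≤ τ → κ ≤ v' s := fun s h1 h2 => by
    have := H'.slope_end (s + y) (by linarith) (by linarith)
    simp only [neg_neg] at this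
    rw [show s + y + z = s + (z + y) by ring, show s + y - 1 + z = s - 1 + (z + y) by ring,
      h.periodic, h.periodic] at this
    simp only [hv']
    linarith
  have hK0 : ∫ s in (-τ)..τ, |K s| ≤ C₀ := by
    have h1 := mul_integral_comp_le (g := fun ξ => deriv f (-ξ)) (v := fun s => -(β * u s))
      (v' := fun s => -(β * v' s)) (m := β * κ) (hf'.comp continuous_neg)
      hf.integrable_deriv.comp_neg (fun s => ((hud s).const_mul β).neg)
      (continuous_const.mul hv'c).neg (by linarith : -τ ≤ τ) fun s hs => by
        have := hslope0 s hs.1 hs.2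
        nlinarith
    rw [integral_neg_eq_self (fun ξ => |deriv f ξ|)] at h1
    rw [hC₀, le_div_iff₀' hκ]
    refine le_trans (le_of_eq ?_) h1
    simp only [hK, abs_mul, abs_of_pos hβ0, intervalIntegral.integral_const_mul, neg_neg]
    ring
  set q := IsProfile.velocity α F u with hq
  have hqn : ∀ t, ‖q t‖ = |v' t| := fun t => by
    simp only [hq, IsProfile.velocity, Complex.norm_real, Real.norm_eq_abs, hv']
  have hqsol : IsDDESolution (linearRHS α K) q := by
    have hqd : ∀ t, HasDerivAt q (linearRHS α K t (q t) (q (t - 1))) t := fun t => by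
      have hfd : HasDerivAt f (deriv f (β * u (t - 1))) (β * u (t - 1)) :=
        (hf.contDiff.differentiable one_ne_zero _).hasDerivAt
      have h1 : HasDerivAt (fun s => F (u (s - 1)))
          (deriv f (β * u (t - 1)) * (β * v' (t - 1))) t :=
        hfd.comp t (((hud (t - 1)).comp_sub_const t 1).const_mul β)
      refine (((hud t).const_mul (-α)).add h1).ofReal_comp.congr_deriv ?_
      simp only [linearRHS, hq, IsProfile.velocity, hK, hv']
      push_cast; ring
    exact ⟨fun t _ => (hqd t).continuousAt.continuousWithinAt, fun t _ => hqd t⟩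
  have hqper : q (z + y) = q 0 := by
    have h1 : u (z + y - 1) = u (0 - 1) := by rw [← h.periodic (0 - 1)]; ring_nf
    have h2 : u (z + y) = u 0 := by rw [← h.periodic 0, zero_add]
    simp only [hq, IsProfile.velocity, h1, h2]
  have hq0 : κ ≤ ‖q 0‖ := by
    rw [hqn]
    exact (hslope0 0 (by linarith) hτ.le).trans (le_abs_self _)
  have hq0' : q 0 ≠ 0 := fun h0 => by rw [h0, norm_zero] at hq0; linarith
  have hqQ : ∀ t, ‖q t‖ ≤ Q := fun t => by
    rw [hqn]; exact h.abs_deriv_le hF hα t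
  refine ⟨hqsol, hq0', fun x N hx hN t ht => ?_⟩
  have hN0 : 0 ≤ N := (norm_nonneg _).trans (hN 0 ⟨by linarith, by linarith⟩)
  obtain ⟨a, ha⟩ := hx.exists_near_multiple hqsol hα hKc hτ hτ4 H.two_mul_le H.le
    H'.two_mul_le H'.le hεZ
    (fun s h1 h2 => hKsmall s ((H.lower s h1 h2).trans (le_abs_self _)))
    (fun s h1 h2 => hKsmall (s + z) ((H'.lower s h1 h2).trans (neg_le_abs _))) hK0 hKz hκ
    (by
      have := H.slope_mid
      rw [hqn]
      refine le_trans ?_ (neg_le_abs _)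
      simp only [hv', add_sub_cancel_left]
      linarith)
    (fun t _ => hqQ t) hN
  have h1 := ha t ht
  have h2 := ha (z + y) ⟨by linarith, by linarith⟩
  rw [← hB] at h1 h2
  have hqω : q (z + y) ≠ 0 := by rwa [hqper]
  -- the coefficient `a` may be read off at time `z + y`
  have h3 : ‖x (z + y) / q (z + y) - a‖ ≤ ε * B * N / κ := by
    have h4 : x (z + y) / q (z + y) - a = (x (z + y) - a * q (z + y)) / q (z + y) := by
      field_simp
    rw [h4, norm_div]
    exact div_le_div₀ (by positivity) h2 hκ (by rwa [hqper])
  calc ‖x t - x (z + y) / q (z + y) * q t‖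
      = ‖(x t - a * q t) - (x (z + y) / q (z + y) - a) * q t‖ := by ring_nf
    _ ≤ ε * B * N + ε * B * N / κ * Q := by
        refine (norm_sub_le _ _).trans (add_le_add h1 ?_)
        rw [norm_mul]
        exact mul_le_mul h3 (hqQ t) (norm_nonneg _) (by positivity)
    _ = ε * B * (1 + Q / κ) * N := by ring
    _ ≤ 1 / 2 * N := mul_le_mul_of_nonneg_right hεB hN0

/-! ### Solution operators of linear delay equations -/

theorem IsDDESolution.congr {E : Type*} [NormedAddCommGroup E] [NormedSpace ℝ E]
    {R R' : ℝ → E → E → E} {y : ℝ → E} (hy : IsDDESolution R y)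
    (h : ∀ t, 0 < t → ∀ u v, R t u v = R' t u v) : IsDDESolution R' y :=
  ⟨hy.1, fun t ht => by rw [← h t ht]; exact hy.2 t ht⟩

theorem IsSolutionOperator.congr {E : Type*} [NormedAddCommGroup E] [NormedSpace ℝ E]
    [NormedSpace ℂ E] {ω : ℝ} {R R' : ℝ → E → E → E} {M : History E →L[ℂ] History E}
    (hM : IsSolutionOperator R ω M) (h : ∀ t, 0 < t → ∀ u v, R t u v = R' t u v) :
    IsSolutionOperator R' ω M := fun ψ => by
  obtain ⟨y, hy, h0, h1⟩ := hM ψ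
  exact ⟨y, hy.congr h, h0, h1⟩

/-- Composition of histories with a continuous linear map. -/
def historyMap {E E' : Type*} [NormedAddCommGroup E] [NormedSpace ℂ E] [NormedAddCommGroup E']
    [NormedSpace ℂ E'] (T : E →L[ℂ] E') : History E →L[ℂ] History E' :=
  T.compLeftContinuous ℂ (Icc (-1 : ℝ) 0)

theorem historyMap_apply {E E' : Type*} [NormedAddCommGroup E] [NormedSpace ℂ E]
    [NormedAddCommGroup E'] [NormedSpace ℂ E'] (T : E →L[ℂ] E') (ψ : History E)
    (θ : Icc (-1 : ℝ) 0) :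
    historyMap T ψ θ = T (ψ θ) := rfl

section DelayOperator

set_option linter.unusedSectionVars false

variable {E E' : Type*} [NormedAddCommGroup E] [NormedSpace ℝ E] [NormedSpace ℂ E]
  [IsScalarTower ℝ ℂ E] [NormedAddCommGroup E'] [NormedSpace ℝ E'] [NormedSpace ℂ E']
  [IsScalarTower ℝ ℂ E'] {α ω : ℝ} {k : ℝ → ℝ} {G : E →L[ℂ] E} {G' : E' →L[ℂ] E'}

/-- Right-hand side of `y'(t) = -α y(t) + k(t) G y(t-1)`. Both the variational equation (with `G`
the coupling matrix) and the extended variational equations (with `G` a scalar) have this form. -/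
def delayRHS (α : ℝ) (k : ℝ → ℝ) (G : E →L[ℂ] E) : ℝ → E → E → E :=
  fun t u v => -(α • u) + k t • G v

theorem delayRHS_eq (α : ℝ) (k : ℝ → ℝ) (G : E →L[ℂ] E) (t : ℝ) (u v : E) :
    delayRHS α k G t u v = -(α • u) + ((k t : ℂ) • G) v := by
  rw [delayRHS, smul_apply, ← algebraMap_smul ℂ (k t) (G v)]
  rfl

theorem IsDDESolution.map_of_commute {y : ℝ → E} (hy : IsDDESolution (delayRHS α k G) y)
    (T : E →L[ℂ] E') (hT : ∀ t, -1 ≤ t → T (G (y t)) = G' (T (y t))) :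
    IsDDESolution (delayRHS α k G') fun t => T (y t) := by
  refine ⟨T.continuous.comp_continuousOn hy.1, fun t ht => ?_⟩
  have h1 : HasDerivAt (fun t => T (y t)) (T (delayRHS α k G t (y t) (y (t - 1)))) t := by
    have := (T.restrictScalars ℝ).hasFDerivAt.comp_hasDerivAt t (hy.2 t ht)
    exact this
  refine h1.congr_deriv ?_
  simp only [delayRHS, map_add, map_neg]
  rw [← hT (t - 1) (by linarith)]
  congr 1
  · congr 1
    exact (T.restrictScalars ℝ).map_smul α (y t)
  · exact (T.restrictScalars ℝ).map_smul (k t) (G (y (t - 1)))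

theorem IsDDESolution.shift_period {E : Type*} [NormedAddCommGroup E] [NormedSpace ℝ E]
    [NormedSpace ℂ E] {G : E →L[ℂ] E} {y : ℝ → E} (hy : IsDDESolution (delayRHS α k G) y)
    (hω : 0 ≤ ω) (hk : ∀ t, 0 < t → k (t + ω) = k t) :
    IsDDESolution (delayRHS α k G) fun t => y (t + ω) := by
  refine ⟨hy.1.comp (by fun_prop) fun t ht => ?_, fun t ht => ?_⟩
  · simp only [mem_Ici] at ht ⊢; linarith
  · refine ((hy.2 (t + ω) (by linarith)).comp_add_const t ω).congr_deriv ?_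
    simp only [delayRHS]
    rw [hk t ht, show t + ω - 1 = t - 1 + ω by ring]

variable [CompleteSpace E] [CompleteSpace E']

theorem delay_unique {x y : ℝ → E} (hx : IsDDESolution (delayRHS α k G) x)
    (hy : IsDDESolution (delayRHS α k G) y) (h0 : ∀ θ ∈ Icc (-1 : ℝ) 0, x θ = y θ) :
    ∀ t, -1 ≤ t → x t = y t :=
  dde_unique (delayRHS_eq α k G) hx hy h0

/-- The value of a solution operator may be computed with any solution. -/
theorem IsSolutionOperator.hasHistory {M : History E →L[ℂ] History E}
    (hM : IsSolutionOperator (delayRHS α k G) ω M) (hω : 0 ≤ ω) {y : ℝ → E} {ψ : History E}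
    (hy : IsDDESolution (delayRHS α k G) y) (h0 : HasHistory y 0 ψ) : HasHistory y ω (M ψ) := by
  obtain ⟨x, hx, hx0, hxω⟩ := hM ψ
  intro θ
  rw [hxω θ]
  refine delay_unique hx hy (fun s hs => ?_) _ (by linarith [θ.2.1])
  have h1 := hx0 ⟨s, hs⟩
  have h2 := h0 ⟨s, hs⟩
  simp only [zero_add] at h1 h2
  rw [← h1, h2]

theorem IsSolutionOperator.map_of_commute {M : History E →L[ℂ] History E}
    {M' : History E' →L[ℂ] History E'} (hM : IsSolutionOperator (delayRHS α k G) ω M)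
    (hM' : IsSolutionOperator (delayRHS α k G') ω M') (hω : 0 ≤ ω) (T : E →L[ℂ] E')
    (hT : ∀ v, T (G v) = G' (T v)) (ψ : History E) :
    M' (historyMap T ψ) = historyMap T (M ψ) := by
  obtain ⟨y, hy, h0, h1⟩ := hM ψ
  have h2 := hM'.hasHistory hω (hy.map_of_commute (G' := G') T fun t _ => hT (y t))
    (ψ := historyMap T ψ) fun θ => congrArg T (h0 θ)
  ext θ
  rw [h2 θ]
  exact (congrArg T (h1 θ)).symm

/-- On histories with values in the eigenspace of `G` for `lam`, the components evolve
independently, by the scalar equation with parameter `lam`. -/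
theorem IsSolutionOperator.map_of_eigen {M : History E →L[ℂ] History E}
    {M' : History ℂ →L[ℂ] History ℂ} {lam : ℂ} (hM : IsSolutionOperator (delayRHS α k G) ω M)
    (hM' : IsSolutionOperator (delayRHS α k (lam • ContinuousLinearMap.id ℂ ℂ)) ω M')
    (hω : 0 ≤ ω) (T : E →L[ℂ] ℂ) {ψ : History E} (hψ : ∀ θ, G (ψ θ) = lam • ψ θ) :
    M' (historyMap T ψ) = historyMap T (M ψ) := by
  obtain ⟨y, hy, h0, h1⟩ := hM ψ
  have hGy : ∀ t, -1 ≤ t → G (y t) = lam • y t := by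
    have e1 := hy.map_of_commute (G' := G) G fun t _ => rfl
    have e2 := hy.map_of_commute (G' := G) (lam • ContinuousLinearMap.id ℂ E) fun t _ => by simp
    refine delay_unique e1 e2 fun s hs => ?_
    have h2 := h0 ⟨s, hs⟩
    simp only [zero_add] at h2
    have h3 := hψ ⟨s, hs⟩
    rw [h2] at h3
    simpa using h3
  have h2 := hM'.hasHistory hω (hy.map_of_commute (G' := lam • ContinuousLinearMap.id ℂ ℂ) T
    fun t ht => by rw [hGy t ht]; simp) (ψ := historyMap T ψ) fun θ => congrArg T (h0 θ)
  ext θ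
  rw [h2 θ]
  exact (congrArg T (h1 θ)).symm

/-- The powers of the solution operator over one period give the solution over several periods. -/
theorem IsSolutionOperator.pow_apply {M : History E →L[ℂ] History E}
    (hM : IsSolutionOperator (delayRHS α k G) ω M) (hω : 0 ≤ ω)
    (hk : ∀ t, 0 < t → k (t + ω) = k t) {y : ℝ → E} {ψ : History E}
    (hy : IsDDESolution (delayRHS α k G) y) (h0 : HasHistory y 0 ψ) (m : ℕ) :
    HasHistory y (m * ω) ((M ^ m) ψ) := by
  induction m generalizing y ψ with
  | zero => simpa using h0
  | succ m ih =>
    have h1 := hM.hasHistory hω hy h0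
    have h2 := ih (hy.shift_period hω hk) (ψ := M ψ) fun θ => by
      rw [h1 θ]; congr 1; ring
    intro θ
    rw [pow_succ]
    refine (h2 θ).trans ?_
    simp only
    congr 1; push_cast; ring

/-- Over more than one unit of time the solutions have bounded derivatives on the final window, so
the solution operator is compact by the Arzelà–Ascoli theorem. -/
theorem isCompactOperator_of_isSolutionOperator [FiniteDimensional ℂ E]
    {M : History E →L[ℂ] History E} (hM : IsSolutionOperator (delayRHS α k G) ω M) (hα : 0 ≤ α)
    (hω : 1 < ω) (hk : ContinuousOn k (Ici 0)) : IsCompactOperator M := by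
  have hB : ContinuousOn (fun t => (k t : ℂ) • G) (Ici 0) :=
    (Complex.continuous_ofReal.comp_continuousOn hk).smul continuousOn_const
  obtain ⟨K, hK0, hK⟩ := dde_exists hα (delayRHS_eq α k G) hB ω
  obtain ⟨κ, hκ⟩ := (isCompact_Icc (a := (0 : ℝ)) (b := ω)).exists_bound_of_continuousOn
    (hk.mono fun s hs => hs.1)
  have hκ0 : 0 ≤ κ := (norm_nonneg _).trans (hκ 0 ⟨le_rfl, by linarith⟩)
  set L := α * K + κ * (‖G‖ * K) with hL
  have hbound : ∀ ψ : History E, ‖ψ‖ ≤ 1 → (∀ θ, ‖M ψ θ‖ ≤ K) ∧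
      ∀ θ θ', ‖M ψ θ - M ψ θ'‖ ≤ L * |(θ : ℝ) - θ'| := fun ψ hψ => by
    obtain ⟨y, hy, h0, hyK⟩ := hK ψ
    have h1 := hM.hasHistory (by linarith) hy h0
    have hyK' : ∀ t ≤ ω, ‖y t‖ ≤ K := fun t ht =>
      (hyK t ht).trans (mul_le_of_le_one_right hK0 hψ)
    refine ⟨fun θ => by rw [h1 θ]; exact hyK' _ (by linarith [θ.2.2]), fun θ θ' => ?_⟩
    rw [h1 θ, h1 θ']
    have h2 := (convex_Icc (ω - 1) ω).norm_image_sub_le_of_norm_hasDerivWithin_le (C := L)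
      (x := ω + θ') (y := ω + θ)
      (fun t ht => (hy.2 t (by linarith [ht.1])).hasDerivWithinAt) (fun t ht => ?_)
      ⟨by linarith [θ'.2.1], by linarith [θ'.2.2]⟩ ⟨by linarith [θ.2.1], by linarith [θ.2.2]⟩
    · simpa using h2
    · refine (norm_add_le _ _).trans ?_
      rw [norm_neg, norm_smul, norm_smul, Real.norm_eq_abs, abs_of_nonneg hα]
      refine add_le_add (mul_le_mul_of_nonneg_left (hyK' t ht.2) hα) ?_
      refine mul_le_mul (hκ t ⟨by linarith [ht.1], ht.2⟩) ?_ (norm_nonneg _) hκ0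
      exact (G.le_opNorm _).trans
        (mul_le_mul_of_nonneg_left (hyK' _ (by linarith [ht.2])) (norm_nonneg _))
  have hprop : ProperSpace E := FiniteDimensional.proper ℂ E
  have hcomp := (isCompactOperator_iff_isCompact_closure_image_closedBall
    (M : History E →ₗ[ℂ] History E) one_pos)
  refine hcomp.2 ?_
  set S := (M : History E →ₗ[ℂ] History E) '' Metric.closedBall 0 1 with hS
  set e := ContinuousMap.isometryEquivBoundedOfCompact (Icc (-1 : ℝ) 0) E with he
  have hAA : IsCompact (closure (e '' S)) := by
    refine BoundedContinuousFunction.arzela_ascoli (Metric.closedBall 0 K)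
      (isCompact_closedBall _ _) _ ?_ ?_
    · rintro _ θ ⟨_, ⟨ψ, hψ, rfl⟩, rfl⟩
      rw [mem_closedBall_zero_iff] at hψ ⊢
      exact (hbound ψ hψ).1 θ
    · refine Metric.equicontinuous_of_continuity_modulus (fun r => L * r) ?_ _ ?_
      · have : Tendsto (fun r => L * r) (𝓝 0) (𝓝 (L * 0)) := (continuous_const_mul L).tendsto 0
        rwa [mul_zero] at this
      · rintro θ θ' ⟨_, ⟨_, ⟨ψ, hψ, rfl⟩, rfl⟩⟩
        rw [mem_closedBall_zero_iff] at hψ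
        rw [dist_eq_norm]
        exact (hbound ψ hψ).2 θ θ'
  have h3 : closure (e '' S) = e '' closure S := (e.toHomeomorph.image_closure S).symm
  rw [h3] at hAA
  exact e.toHomeomorph.isCompact_image.1 hAA

/-- The range of a solution operator over more than one unit of time consists of differentiable
functions, so the operator is not invertible. -/
theorem zero_mem_spectrum_of_isSolutionOperator [Nontrivial E]
    {M : History E →L[ℂ] History E} (hM : IsSolutionOperator (delayRHS α k G) ω M)
    (hω : 1 < ω) : (0 : ℂ) ∈ spectrum ℂ M := by
  rw [spectrum.zero_mem_iff]
  intro hu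
  have hsurj := (ContinuousLinearMap.isUnit_iff_bijective.1 hu).2
  obtain ⟨e, he⟩ := exists_ne (0 : E)
  let φ : History E := ⟨fun θ => |(θ : ℝ) + 1 / 2| • e, by fun_prop⟩
  obtain ⟨ψ, hψ⟩ := hsurj φ
  obtain ⟨y, hy, h0, h1⟩ := hM ψ
  rw [hψ] at h1
  have hd := (hy.2 (ω - 1 / 2) (by linarith)).differentiableAt
  have heq : (fun t => y (t + (ω - 1 / 2))) =ᶠ[𝓝 0] fun t => |t| • e := by
    have hnhds : Icc (-(1 / 2) : ℝ) (1 / 2) ∈ 𝓝 (0 : ℝ) := Icc_mem_nhds (by norm_num) (by norm_num)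
    filter_upwards [hnhds] with t ht
    have h2 := h1 ⟨t - 1 / 2, by linarith [ht.1], by linarith [ht.2]⟩
    simp only [φ, ContinuousMap.coe_mk, sub_add_cancel] at h2
    rw [h2]; congr 1; ring
  have hd' : DifferentiableAt ℝ (fun t : ℝ => |t| • e) 0 := by
    refine DifferentiableAt.congr_of_eventuallyEq ?_ heq.symm
    have hd0 : DifferentiableAt ℝ y (0 + (ω - 1 / 2)) := by rwa [zero_add]
    exact hd0.comp (0 : ℝ) (differentiableAt_id.add_const _)
  -- composing with a functional that does not vanish at `e` gives a multiple of `|t|`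
  obtain ⟨g, -, hg⟩ := exists_dual_vector ℝ e (norm_ne_zero_iff.2 he)
  have h3 : DifferentiableAt ℝ (fun t : ℝ => g (|t| • e)) 0 :=
    g.differentiableAt.comp (0 : ℝ) hd'
  have hge : g e ≠ 0 := by rw [hg]; simpa using he
  have h4 : DifferentiableAt ℝ (fun t : ℝ => |t|) 0 := by
    have h5 : (fun t : ℝ => |t|) = fun t => g (|t| • e) * (g e)⁻¹ := by
      funext t
      rw [map_smul, smul_eq_mul, mul_assoc, mul_inv_cancel₀ hge, mul_one]
    rw [h5]
    exact h3.mul_const _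
  exact not_differentiableAt_abs_zero h4

/-- The nonzero spectrum of a solution operator consists of eigenvalues. -/
theorem IsSolutionOperator.mem_spectrum_iff [FiniteDimensional ℂ E]
    {M : History E →L[ℂ] History E} (hM : IsSolutionOperator (delayRHS α k G) ω M) (hα : 0 ≤ α)
    (hω : 1 < ω) (hk : ContinuousOn k (Ici 0)) {μ : ℂ} (hμ : μ ≠ 0) :
    μ ∈ spectrum ℂ M ↔ ∃ ψ, ψ ≠ 0 ∧ M ψ = μ • ψ := by
  rw [← (isCompactOperator_of_isSolutionOperator hM hα hω hk).hasEigenvalue_iff_mem_spectrum hμ]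
  constructor
  · intro h
    obtain ⟨ψ, hψ⟩ := h.exists_hasEigenvector
    exact ⟨ψ, hψ.2, hψ.apply_eq_smul⟩
  · rintro ⟨ψ, h0, h1⟩
    exact Module.End.hasEigenvalue_of_hasEigenvector
      (Module.End.hasEigenvector_iff.2 ⟨Module.End.mem_eigenspace_iff.2 h1, h0⟩)

end DelayOperator

/-! ### Linear algebra -/

section LinearAlgebra

open Polynomial

variable {V : Type*} [AddCommGroup V] [Module ℂ V]

theorem aeval_cons_apply (A : Module.End ℂ V) (a : ℂ) (s : Multiset ℂ) (ψ : V) :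
    aeval A ((a ::ₘ s).map fun r => X - C r).prod ψ =
      aeval A (s.map fun r => X - C r).prod (A ψ - a • ψ) := by
  rw [Multiset.map_cons, Multiset.prod_cons, mul_comm, map_mul, Module.End.mul_apply]
  simp [Module.algebraMap_end_apply]

/-- An invariant subspace that meets the kernel of a product of linear factors in `A` contains an
eigenvector of `A`. -/
theorem exists_eigenvector_of_prod (A : Module.End ℂ V) (W : Submodule ℂ V)
    (hW : ∀ w ∈ W, A w ∈ W) (s : Multiset ℂ) :
    ∀ ψ ∈ W, ψ ≠ 0 → aeval A (s.map fun r => X - C r).prod ψ = 0 →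
      ∃ lam : ℂ, ∃ φ ∈ W, φ ≠ 0 ∧ A φ = lam • φ := by
  induction s using Multiset.induction with
  | empty => intro ψ _ h0 h; simp at h; exact absurd h h0
  | cons a s ih =>
    intro ψ hψ h0 h
    rw [aeval_cons_apply] at h
    by_cases h1 : A ψ - a • ψ = 0
    · exact ⟨a, ψ, hψ, h0, sub_eq_zero.1 h1⟩
    · exact ih _ (W.sub_mem (hW ψ hψ) (W.smul_mem a hψ)) h1 h

/-- If `1` is the only possible eigenvalue of `A` on an invariant subspace, then only the factors
`A - 1` of a product of linear factors matter on it. -/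
theorem exists_pow_eq_zero_of_prod (A : Module.End ℂ V) (W : Submodule ℂ V)
    (hW : ∀ w ∈ W, A w ∈ W) (hA : ∀ lam : ℂ, lam ≠ 1 → ∀ ψ ∈ W, A ψ = lam • ψ → ψ = 0)
    (s : Multiset ℂ) :
    ∀ ψ ∈ W, aeval A (s.map fun r => X - C r).prod ψ = 0 →
      ∃ m : ℕ, ((A - (1 : ℂ) • (1 : Module.End ℂ V)) ^ m) ψ = 0 := by
  induction s using Multiset.induction with
  | empty => intro ψ _ h; exact ⟨0, by simpa using h⟩
  | cons a s ih =>
    intro ψ hψ h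
    rw [aeval_cons_apply] at h
    set B := A - (1 : ℂ) • (1 : Module.End ℂ V) with hB
    obtain ⟨m, hm⟩ := ih _ (W.sub_mem (hW ψ hψ) (W.smul_mem a hψ)) h
    by_cases ha : a = 1
    · refine ⟨m + 1, ?_⟩
      rw [ha] at hm
      rw [pow_succ, Module.End.mul_apply]
      exact hm
    · refine ⟨m, hA a ha _ ?_ ?_⟩
      · have hBW : ∀ w ∈ W, B w ∈ W := fun w hw => by
          simp only [hB, LinearMap.sub_apply, LinearMap.smul_apply, Module.End.one_apply]
          exact W.sub_mem (hW w hw) (W.smul_mem 1 hw)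
        clear hm h
        induction m with
        | zero => simpa using hψ
        | succ m ihm => rw [pow_succ', Module.End.mul_apply]; exact hBW _ ihm
      · have hc : Commute A (B ^ m) := by
          refine Commute.pow_right ?_ m
          rw [hB]
          exact (Commute.refl A).sub_right ((Commute.one_right A).smul_right 1)
        have h2 : A ((B ^ m) ψ) = (B ^ m) (A ψ) := by
          rw [← Module.End.mul_apply, hc.eq, Module.End.mul_apply]
        rw [map_sub, map_smul, ← h2] at hm
        exact sub_eq_zero.1 hm

theorem exists_prod_aeval_eq_zero [FiniteDimensional ℂ V] (A : Module.End ℂ V) :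
    ∃ s : Multiset ℂ, aeval A (s.map fun r => X - C r).prod = 0 := by
  refine ⟨A.charpoly.roots, ?_⟩
  rw [← (IsAlgClosed.splits A.charpoly).eq_prod_roots_of_monic A.charpoly_monic]
  exact A.aeval_self_charpoly

theorem isSimpleEigenvalue_of_span {A : Module.End ℂ V} {μ : ℂ} {q : V} (hq : q ≠ 0)
    (hAq : A q = μ • q) (h : ∀ ψ ∈ A.maxGenEigenspace μ, ∃ a : ℂ, ψ = a • q) :
    IsSimpleEigenvalue A μ := by
  have hmem : q ∈ A.maxGenEigenspace μ :=
    (Module.End.mem_maxGenEigenspace _ _ _).2 ⟨1, by simp [hAq]⟩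
  have hne : (⟨q, hmem⟩ : A.maxGenEigenspace μ) ≠ 0 := fun h0 => hq (congrArg Subtype.val h0)
  refine (finrank_eq_one_iff_of_nonzero' _ hne).2 fun w => ?_
  obtain ⟨a, ha⟩ := h w w.2
  exact ⟨a, Subtype.ext ha.symm⟩

theorem IsSimpleEigenvalue.exists_smul {A : Module.End ℂ V} {μ : ℂ} (h : IsSimpleEigenvalue A μ)
    {q : V} (hq : q ≠ 0) (hAq : A q = μ • q) {ψ : V} (hψ : ψ ∈ A.maxGenEigenspace μ) :
    ∃ a : ℂ, ψ = a • q := by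
  have hmem : q ∈ A.maxGenEigenspace μ :=
    (Module.End.mem_maxGenEigenspace _ _ _).2 ⟨1, by simp [hAq]⟩
  have hne : (⟨q, hmem⟩ : A.maxGenEigenspace μ) ≠ 0 := fun h0 => hq (congrArg Subtype.val h0)
  obtain ⟨a, ha⟩ := (finrank_eq_one_iff_of_nonzero' _ hne).1 h ⟨ψ, hψ⟩
  exact ⟨a, (congrArg Subtype.val ha).symm⟩

/-- If a linear map `M` with fixed vector `q` contracts a seminorm `‖L ·‖`, and vectors of seminorm
zero are eventually mapped to multiples of `q`, then the generalized eigenspace for `1` is spanned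
by `q` and all other eigenvalues lie in the open unit disc. -/
theorem eigen_of_contraction {W : Type*} [NormedAddCommGroup W] [NormedSpace ℂ W]
    {M : Module.End ℂ V} {L : V →ₗ[ℂ] W} {q : V} (hMq : M q = q)
    (hL : ∀ ψ, ‖L (M ψ)‖ ≤ 1 / 2 * ‖L ψ‖)
    (hker : ∀ ψ, L ψ = 0 → ∃ (m : ℕ) (a : ℂ), (M ^ m) ψ = a • q) :
    (∀ ψ ∈ M.maxGenEigenspace 1, ∃ a : ℂ, ψ = a • q) ∧
      ∀ (μ : ℂ) (ψ : V), ψ ≠ 0 → M ψ = μ • ψ → 1 ≤ ‖μ‖ → μ = 1 := by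
  constructor
  · intro ψ hψ
    obtain ⟨m, hm⟩ := (Module.End.mem_maxGenEigenspace _ _ _).1 hψ
    have hstep : ∀ (m : ℕ) (φ : V),
        (1 / 2) ^ m * ‖L φ‖ ≤ ‖L (((M - (1 : ℂ) • (1 : Module.End ℂ V)) ^ m) φ)‖ := by
      intro m
      induction m with
      | zero => intro φ; simp
      | succ m ih =>
        intro φ
        rw [pow_succ (M - _), Module.End.mul_apply]
        refine le_trans ?_ (ih _)
        rw [pow_succ, mul_assoc]
        refine mul_le_mul_of_nonneg_left ?_ (by positivity)
        simp only [LinearMap.sub_apply, one_smul, Module.End.one_apply, map_sub]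
        have h1 := norm_sub_norm_le (L φ) (L (M φ))
        rw [norm_sub_rev] at h1
        have h2 := hL φ
        linarith
    have h1 := hstep m ψ
    rw [hm, map_zero, norm_zero] at h1
    have h2 : L ψ = 0 := by
      have : (0 : ℝ) < (1 / 2) ^ m := by positivity
      have h3 : ‖L ψ‖ ≤ 0 := by
        by_contra! h4
        nlinarith [mul_pos this h4]
      exact norm_le_zero_iff.1 h3
    obtain ⟨j, a, hj⟩ := hker ψ h2
    have hpow : ∀ j : ℕ, (M ^ j) q = q := fun j => by
      induction j with
      | zero => simp
      | succ j ih => rw [pow_succ, Module.End.mul_apply, hMq, ih]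
    refine ⟨a, ?_⟩
    -- `ψ - a • q` lies in the generalized eigenspaces for both `0` and `1`
    have hq1 : q ∈ M.maxGenEigenspace 1 :=
      (Module.End.mem_maxGenEigenspace _ _ _).2 ⟨1, by simp [hMq]⟩
    have h4 : ψ - a • q ∈ M.maxGenEigenspace 1 :=
      Submodule.sub_mem _ hψ (Submodule.smul_mem _ a hq1)
    have h5 : ψ - a • q ∈ M.maxGenEigenspace 0 :=
      (Module.End.mem_maxGenEigenspace _ _ _).2 ⟨j, by simp [hj, hpow]⟩
    have hdis := M.disjoint_genEigenspace (zero_ne_one (α := ℂ)) ⊤ ⊤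
    exact sub_eq_zero.1 (Submodule.disjoint_def.1 hdis _ h5 h4)
  · intro μ ψ h0 hμ h1
    have h2 := hL ψ
    rw [hμ, map_smul, norm_smul] at h2
    have h3 : L ψ = 0 := by
      by_contra h4
      have := norm_pos_iff.2 h4
      nlinarith
    obtain ⟨m, a, hm⟩ := hker ψ h3
    have hpow : ∀ j : ℕ, (M ^ j) ψ = μ ^ j • ψ := fun j => by
      induction j with
      | zero => simp
      | succ j ih => rw [pow_succ, Module.End.mul_apply, hμ, map_smul, ih, smul_smul, pow_succ']
    rw [hpow] at hm
    have hμ0 : μ ≠ 0 := fun h => by rw [h, norm_zero] at h1; linarith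
    have h4 : M (μ ^ m • ψ) = μ ^ m • ψ := by rw [hm, map_smul, hMq]
    rw [map_smul, hμ] at h4
    have h5 : μ • ψ = ψ := smul_right_injective V (pow_ne_zero m hμ0) h4
    by_contra h6
    have h7 : (μ - 1) • ψ = 0 := by rw [sub_smul, one_smul, h5, sub_self]
    exact (smul_ne_zero (sub_ne_zero.2 h6) h0) h7

end LinearAlgebra

/-! ### The spectrum of the coupled system -/

section Coupled

open Polynomial

variable {E : Type*} [NormedAddCommGroup E] [NormedSpace ℂ E]

theorem aeval_historyMap (G : E →L[ℂ] E) (p : ℂ[X]) (ψ : History E) (θ : Icc (-1 : ℝ) 0) :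
    (aeval ((historyMap G).toLinearMap : Module.End ℂ (History E)) p ψ) θ =
      aeval (G.toLinearMap : Module.End ℂ E) p (ψ θ) := by
  induction p using Polynomial.induction_on' generalizing ψ with
  | add p q hp hq => simp [hp, hq]
  | monomial m a =>
    simp only [aeval_monomial, Module.End.mul_apply, Module.algebraMap_end_apply,
      ContinuousMap.smul_apply]
    congr 1
    induction m generalizing ψ with
    | zero => simp
    | succ m ih => rw [pow_succ, pow_succ, Module.End.mul_apply, Module.End.mul_apply, ih]; rfl

theorem exists_functional_ne_zero {ψ : History E} (hψ : ψ ≠ 0) :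
    ∃ θ, ψ θ ≠ 0 ∧ ∃ T : E →L[ℂ] ℂ, historyMap T ψ ≠ 0 := by
  obtain ⟨θ, hθ⟩ : ∃ θ, ψ θ ≠ 0 := by
    by_contra! h
    exact hψ (ContinuousMap.ext h)
  obtain ⟨T, -, hT⟩ := exists_dual_vector ℂ (ψ θ) (norm_ne_zero_iff.2 hθ)
  refine ⟨θ, hθ, T, fun h => ?_⟩
  have h1 : T (ψ θ) = 0 := by rw [← historyMap_apply, h]; rfl
  rw [hT] at h1
  exact hθ (by simpa using h1)

variable [NormedSpace ℝ E] [IsScalarTower ℝ ℂ E] [FiniteDimensional ℂ E]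
  {α ω : ℝ} {k : ℝ → ℝ} {G : E →L[ℂ] E} {M : History E →L[ℂ] History E}
  {M' : ℂ → History ℂ →L[ℂ] History ℂ}

/-- The spectrum of the solution operator of the coupled system is the union of the spectra of the
scalar ones over the eigenvalues of the coupling: the operator commutes with the coupling, so that
each of its eigenspaces contains an eigenvector of the coupling. -/
theorem spectrum_coupled [Nontrivial E] (hα : 0 ≤ α) (hω : 1 < ω) (hk : ContinuousOn k (Ici 0))
    (hM : IsSolutionOperator (delayRHS α k G) ω M)
    (hM' : ∀ lam : ℂ,
      IsSolutionOperator (delayRHS α k (lam • ContinuousLinearMap.id ℂ ℂ)) ω (M' lam)) :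
    spectrum ℂ M = ⋃ lam ∈ {lam | Module.End.HasEigenvalue (G.toLinearMap : Module.End ℂ E) lam},
      spectrum ℂ (M' lam) := by
  have hE : CompleteSpace E := FiniteDimensional.complete ℂ E
  have hω0 : 0 ≤ ω := by linarith
  ext μ
  simp only [mem_iUnion, mem_ofPred_eq, exists_prop]
  by_cases hμ : μ = 0
  · rw [hμ]
    obtain ⟨lam, hlam⟩ := Module.End.exists_eigenvalue (G.toLinearMap : Module.End ℂ E)
    exact ⟨fun _ => ⟨lam, hlam, zero_mem_spectrum_of_isSolutionOperator (hM' lam) hω⟩,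
      fun _ => zero_mem_spectrum_of_isSolutionOperator hM hω⟩
  rw [hM.mem_spectrum_iff hα hω hk hμ]
  constructor
  · rintro ⟨ψ, h0, hψ⟩
    obtain ⟨s, hs⟩ := exists_prod_aeval_eq_zero (G.toLinearMap : Module.End ℂ E)
    obtain ⟨lam, φ, hφ, hφ0, hGφ⟩ := exists_eigenvector_of_prod
      ((historyMap G).toLinearMap : Module.End ℂ (History E))
      (Module.End.eigenspace (M.toLinearMap : Module.End ℂ (History E)) μ)
      (fun w hw => by
        rw [Module.End.mem_eigenspace_iff] at hw ⊢
        have h1 := hM.map_of_commute hM hω0 G (fun _ => rfl) w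
        change M (historyMap G w) = μ • historyMap G w
        rw [h1, ← map_smul]
        exact congrArg _ hw) s ψ (Module.End.mem_eigenspace_iff.2 hψ) h0 (by
        ext θ
        rw [aeval_historyMap, hs]; rfl)
    obtain ⟨θ, hθ, T, hT⟩ := exists_functional_ne_zero hφ0
    have hG : ∀ θ, G (φ θ) = lam • φ θ := fun θ => congrArg (fun χ : History E => χ θ) hGφ
    refine ⟨lam, Module.End.hasEigenvalue_of_hasEigenvector
      (Module.End.hasEigenvector_iff.2 ⟨Module.End.mem_eigenspace_iff.2 (hG θ), hθ⟩), ?_⟩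
    rw [(hM' lam).mem_spectrum_iff hα hω hk hμ]
    refine ⟨historyMap T φ, hT, ?_⟩
    rw [hM.map_of_eigen (hM' lam) hω0 T hG, ← map_smul]
    exact congrArg _ (Module.End.mem_eigenspace_iff.1 hφ)
  · rintro ⟨lam, hlam, hμs⟩
    obtain ⟨v, hv⟩ := hlam.exists_hasEigenvector
    rw [(hM' lam).mem_spectrum_iff hα hω hk hμ] at hμs
    obtain ⟨φ, h0, hφ⟩ := hμs
    have hGv : G v = lam • v := hv.apply_eq_smul
    refine ⟨historyMap (ContinuousLinearMap.toSpanSingleton ℂ v) φ, fun h => h0 ?_, ?_⟩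
    · ext θ
      have h1 : φ θ • v = 0 := congrArg (fun χ : History E => χ θ) h
      exact (smul_eq_zero.1 h1).resolve_right hv.2
    · rw [(hM' lam).map_of_commute hM hω0 (ContinuousLinearMap.toSpanSingleton ℂ v) (fun z => by
        simp [hGv, smul_smul, mul_comm]) φ, hφ, map_smul]

/-- On histories with values in an eigenspace of the coupling, `M - 1` acts by components. -/
theorem pow_sub_one_historyMap (hω : 0 ≤ ω) (hM : IsSolutionOperator (delayRHS α k G) ω M)
    (hM' : ∀ lam : ℂ,
      IsSolutionOperator (delayRHS α k (lam • ContinuousLinearMap.id ℂ ℂ)) ω (M' lam))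
    (T : E →L[ℂ] ℂ) (lam : ℂ) (m : ℕ) :
    ∀ ψ : History E, (∀ θ, G (ψ θ) = lam • ψ θ) →
      (((M' lam).toLinearMap - (1 : ℂ) • (1 : Module.End ℂ (History ℂ))) ^ m) (historyMap T ψ) =
        historyMap T ((((M.toLinearMap - (1 : ℂ) • (1 : Module.End ℂ (History E))) ^ m)) ψ) := by
  have hE : CompleteSpace E := FiniteDimensional.complete ℂ E
  induction m with
  | zero => intro ψ _; rfl
  | succ m ih =>
    intro ψ hψ
    rw [pow_succ, pow_succ, Module.End.mul_apply, Module.End.mul_apply]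
    have h1 := hM.map_of_eigen (hM' lam) hω T hψ
    have h2 : ((M' lam).toLinearMap - (1 : ℂ) • (1 : Module.End ℂ (History ℂ))) (historyMap T ψ) =
        historyMap T ((M.toLinearMap - (1 : ℂ) • (1 : Module.End ℂ (History E))) ψ) := by
      simp only [LinearMap.sub_apply, one_smul, Module.End.one_apply, map_sub]
      exact congrArg (· - historyMap T ψ) h1
    rw [h2]
    refine ih _ fun θ => ?_
    have h3 := hM.map_of_commute hM hω G (fun _ => rfl) ψ
    have h4 : historyMap G ψ = lam • ψ := ContinuousMap.ext hψ
    rw [h4, map_smul] at h3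
    have h5 : G (M ψ θ) = lam • M ψ θ := (congrArg (fun χ : History E => χ θ) h3).symm
    simp only [LinearMap.sub_apply, one_smul, Module.End.one_apply, ContinuousMap.sub_apply,
      map_sub, smul_sub, hψ θ]
    exact congrArg (· - lam • ψ θ) h5

/-- Simplicity of the eigenvalue `1` for the coupled system. -/
theorem isSimpleEigenvalue_coupled (hω : 0 ≤ ω) (hM : IsSolutionOperator (delayRHS α k G) ω M)
    (hM' : ∀ lam : ℂ,
      IsSolutionOperator (delayRHS α k (lam • ContinuousLinearMap.id ℂ ℂ)) ω (M' lam))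
    (hG : IsSimpleEigenvalue (G.toLinearMap : Module.End ℂ E) 1) {v : E} (hv : v ≠ 0)
    (hGv : G v = v)
    (hne : ∀ lam : ℂ, lam ≠ 1 → Module.End.HasEigenvalue (G.toLinearMap : Module.End ℂ E) lam →
      ∀ φ, M' lam φ = φ → φ = 0)
    {q : History ℂ} (hq : q ≠ 0) (hMq : M' 1 q = q)
    (hspan : ∀ ψ ∈ Module.End.maxGenEigenspace (M' 1).toLinearMap 1,
      ∃ a : ℂ, ψ = a • q) :
    IsSimpleEigenvalue (M.toLinearMap : Module.End ℂ (History E)) 1 := by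
  have hE : CompleteSpace E := FiniteDimensional.complete ℂ E
  set S : ℂ →L[ℂ] E := ContinuousLinearMap.toSpanSingleton ℂ v with hS
  refine isSimpleEigenvalue_of_span (q := historyMap S q) (fun h => hq ?_) ?_ fun ψ hψ => ?_
  · ext θ
    have h1 : q θ • v = 0 := congrArg (fun χ : History E => χ θ) h
    exact (smul_eq_zero.1 h1).resolve_right hv
  · rw [one_smul]
    have := (hM' 1).map_of_commute hM hω S (fun z => by simp [hS, hGv]) q
    rw [hMq] at this
    exact this
  -- on the generalized eigenspace only the eigenvalue `1` of the coupling is possible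
  have hcomm : Commute (M.toLinearMap : Module.End ℂ (History E)) (historyMap G).toLinearMap :=
    LinearMap.ext fun w => hM.map_of_commute hM hω G (fun _ => rfl) w
  have hinv : ∀ w ∈ Module.End.maxGenEigenspace M.toLinearMap 1,
      (historyMap G).toLinearMap w ∈
        Module.End.maxGenEigenspace M.toLinearMap 1 :=
    fun w hw => Module.End.mapsTo_maxGenEigenspace_of_comm hcomm 1 hw
  have honly : ∀ lam : ℂ, lam ≠ 1 →
      ∀ w ∈ Module.End.maxGenEigenspace M.toLinearMap 1,
        (historyMap G).toLinearMap w = lam • w → w = 0 := by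
    intro lam hlam w hw hGw
    by_contra hw0
    obtain ⟨θ, hθ, T, hT⟩ := exists_functional_ne_zero hw0
    have hG' : ∀ θ, G (w θ) = lam • w θ := fun θ => congrArg (fun χ : History E => χ θ) hGw
    have heig : Module.End.HasEigenvalue (G.toLinearMap : Module.End ℂ E) lam :=
      Module.End.hasEigenvalue_of_hasEigenvector
        (Module.End.hasEigenvector_iff.2 ⟨Module.End.mem_eigenspace_iff.2 (hG' θ), hθ⟩)
    obtain ⟨m, hm⟩ := (Module.End.mem_maxGenEigenspace _ _ _).1 hw
    have h1 := pow_sub_one_historyMap hω hM hM' T lam m w hG'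
    rw [hm, map_zero] at h1
    have h2 : ∀ (j : ℕ) (φ : History ℂ),
        (((M' lam).toLinearMap - (1 : ℂ) • (1 : Module.End ℂ (History ℂ))) ^ j) φ = 0 →
          φ = 0 := by
      intro j
      induction j with
      | zero => intro φ h; exact h
      | succ j ih =>
        intro φ h
        rw [pow_succ, Module.End.mul_apply] at h
        have h3 := ih _ h
        simp only [LinearMap.sub_apply, one_smul, Module.End.one_apply] at h3
        exact hne lam hlam heig φ (sub_eq_zero.1 h3)
    exact hT (h2 m _ h1)
  obtain ⟨s, hs⟩ := exists_prod_aeval_eq_zero (G.toLinearMap : Module.End ℂ E)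
  obtain ⟨m, hm⟩ := exists_pow_eq_zero_of_prod _ _ hinv honly s ψ hψ (by
    ext θ
    rw [aeval_historyMap, hs]; rfl)
  have hpt : ∀ θ, ∃ a : ℂ, ψ θ = a • v := fun θ => by
    refine hG.exists_smul hv (by rw [one_smul]; exact hGv)
      ((Module.End.mem_maxGenEigenspace _ _ _).2 ⟨m, ?_⟩)
    have h1 := aeval_historyMap G ((X - C 1) ^ m) ψ θ
    simp only [map_pow, map_sub, aeval_X, aeval_C, Algebra.algebraMap_eq_smul_one] at h1
    rw [← h1, hm]; rfl
  obtain ⟨T, -, hT⟩ := exists_dual_vector ℂ v (norm_ne_zero_iff.2 hv)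
  have hTv : T v ≠ 0 := by rw [hT]; simpa using hv
  have hGψ : ∀ θ, G (ψ θ) = (1 : ℂ) • ψ θ := fun θ => by
    obtain ⟨a, ha⟩ := hpt θ
    rw [ha, map_smul, hGv, one_smul]
  obtain ⟨j, hj⟩ := (Module.End.mem_maxGenEigenspace _ _ _).1 hψ
  have h1 := pow_sub_one_historyMap hω hM hM' T 1 j ψ hGψ
  rw [hj, map_zero] at h1
  obtain ⟨a, ha⟩ := hspan _ ((Module.End.mem_maxGenEigenspace _ _ _).2 ⟨j, h1⟩)
  refine ⟨a * (T v)⁻¹, ContinuousMap.ext fun θ => ?_⟩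
  obtain ⟨b, hb⟩ := hpt θ
  have h2 : T (ψ θ) = a * q θ := congrArg (fun χ : History ℂ => χ θ) ha
  rw [hb, map_smul, smul_eq_mul] at h2
  have h3 : b = a * (T v)⁻¹ * q θ := by
    field_simp
    linear_combination h2
  rw [hb, h3]
  simp [historyMap_apply, hS, smul_smul]

end Coupled

/-! ### Floquet multipliers of the scalar equation -/

/-- Periodic extension to the whole line of a function that is periodic on `[-1, ∞)`. -/
theorem exists_periodic_extension {p : ℝ → ℝ} {ω : ℝ} (hω : 1 ≤ ω)
    (hp : ∀ t, -1 ≤ t → p (t + ω) = p t) :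
    ∃ P : ℝ → ℝ, Function.Periodic P ω ∧ ∀ t, -1 ≤ t → P t = p t := by
  have hnat : ∀ (n : ℕ) (t : ℝ), -1 ≤ t → p (t + n * ω) = p t := by
    intro n
    induction n with
    | zero => intro t _; simp
    | succ n ih =>
      intro t ht
      have h1 := hp (t + n * ω) (by have : 0 ≤ n * ω := by positivity
                                    linarith)
      rw [ih t ht] at h1
      rw [← h1]; congr 1; push_cast; ring
  have hle : ∀ (n m : ℕ) (t : ℝ), n ≤ m → -1 ≤ t + n * ω → p (t + m * ω) = p (t + n * ω) := by
    intro n m t hnm ht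
    obtain ⟨j, rfl⟩ := Nat.exists_eq_add_of_le hnm
    rw [← hnat j _ ht]; congr 1; push_cast; ring
  have heq : ∀ (n m : ℕ) (t : ℝ), -1 ≤ t + n * ω → -1 ≤ t + m * ω →
      p (t + m * ω) = p (t + n * ω) := fun n m t h1 h2 => by
    rcases le_total n m with h | h
    · exact hle n m t h h1
    · exact (hle m n t h h2).symm
  have hceil : ∀ t : ℝ, -1 ≤ t + (⌈|t|⌉₊ : ℝ) * ω := fun t => by
    have h1 := Nat.le_ceil |t|
    have h2 := neg_abs_le t
    nlinarith [abs_nonneg t]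
  refine ⟨fun t => p (t + (⌈|t|⌉₊ : ℝ) * ω), fun t => ?_, fun t ht => hnat _ t ht⟩
  have h1 := hceil (t + ω)
  have h2 := heq ⌈|t|⌉₊ (⌈|t + ω|⌉₊ + 1) t (hceil t) (by push_cast; linarith)
  simp only
  rw [← h2]; congr 1; push_cast; ring

/-- A slowly oscillating periodic solution, rescaled by `β` and extended to the whole line, is a
profile. -/
theorem IsSOPS.exists_profile {α β : ℝ} {f p : ℝ → ℝ} {ω : ℝ} (hβ : 0 < β)
    (h : IsSOPS α β f p ω) :
    ∃ (u : ℝ → ℝ) (z₀ z y : ℝ), -1 ≤ z₀ ∧ ω = z + y ∧ IsProfile α (fun v => f (β * v)) u z y ∧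
      ∀ t, -1 ≤ t → p t = β * u (t - z₀) := by
  obtain ⟨⟨-, hd⟩, z₀, z₁, z₂, h0, h1, h2, hpos, hneg, hω, hper⟩ := h
  obtain ⟨P, hP, hPp⟩ := exists_periodic_extension (by linarith) hper
  have hPd : ∀ t, HasDerivAt P (-α * P t + β * f (P (t - 1))) t := fun t => by
    obtain ⟨n, hn⟩ := exists_nat_gt |t|
    have hn0 : (0 : ℝ) ≤ n := Nat.cast_nonneg n
    have hn1 : 0 < t + n * ω := by nlinarith [neg_abs_le t]
    have hshift : ∀ s, P (s + n * ω) = P s := hP.nat_mul n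
    have h3 := (hd (t + n * ω) hn1).comp_add_const t (n * ω)
    have h4 : P =ᶠ[𝓝 t] fun s => p (s + n * ω) := by
      filter_upwards [Ioi_mem_nhds (show t - 1 < t by linarith)] with s hs
      have hs' : t - 1 < s := hs
      rw [← hPp _ (by linarith), hshift]
    refine (h3.congr_of_eventuallyEq h4).congr_deriv ?_
    rw [scalarRHS, ← hPp _ (by linarith), ← hPp _ (by linarith), hshift,
      show t + n * ω - 1 = t - 1 + n * ω by ring, hshift]
  refine ⟨fun t => P (t + z₀) / β, z₀, z₁ - z₀, z₂ - z₁, h0, by rw [hω]; ring, ?_, ?_⟩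
  · refine ⟨by linarith, by linarith, fun t => ?_, fun t h3 h4 => ?_, fun t h3 h4 => ?_,
      fun t => ?_⟩
    · refine (((hPd (t + z₀)).comp_add_const t z₀).div_const β).congr_deriv ?_
      rw [show t - 1 + z₀ = t + z₀ - 1 by ring, mul_div_cancel₀ _ hβ.ne']
      field_simp
    · rw [hPp _ (by linarith)]
      exact div_pos (hpos _ (by linarith) (by linarith)) hβ
    · rw [hPp _ (by linarith)]
      exact div_neg_of_neg_of_pos (hneg _ (by linarith) (by linarith)) hβ
    · rw [show t + (z₁ - z₀ + (z₂ - z₁)) + z₀ = t + z₀ + ω by rw [hω]; ring, hP]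
  · intro t ht
    simp only [sub_add_cancel]
    rw [hPp t ht, mul_div_cancel₀ _ hβ.ne']

/-- The coefficient `β f'(p(t-1))` of the linearized equations. -/
noncomputable def delayCoeff (β : ℝ) (f p : ℝ → ℝ) : ℝ → ℝ := fun t => β * deriv f (p (t - 1))

theorem continuousOn_delayCoeff {β : ℝ} {f p : ℝ → ℝ} (hf : ContDiff ℝ 1 f)
    (hp : ContinuousOn p (Ici (-1))) : ContinuousOn (delayCoeff β f p) (Ici 0) := by
  have h1 : ContinuousOn (fun t : ℝ => p (t - 1)) (Ici 0) :=
    hp.comp (by fun_prop) (fun t ht => by simp only [mem_Ici] at ht ⊢; linarith)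
  exact continuousOn_const.mul ((hf.continuous_deriv le_rfl).comp_continuousOn h1)

theorem isSolutionOperator_extendedMonodromy {α β : ℝ} (hα : 0 ≤ α) {f p : ℝ → ℝ}
    (hf : ContDiff ℝ 1 f) {ω : ℝ} (hω : 0 ≤ ω) (hp : ContinuousOn p (Ici (-1))) (lam : ℂ) :
    IsSolutionOperator (delayRHS α (delayCoeff β f p) (lam • ContinuousLinearMap.id ℂ ℂ)) ω
      (extendedMonodromy α β f p ω lam) := by
  refine (extendedMonodromy_spec hα hf hp hω lam).congr fun t _ u v => ?_
  simp only [extendedRHS, delayRHS, delayCoeff, smul_apply, ContinuousLinearMap.id_apply,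
    smul_eq_mul, Complex.real_smul]
  push_cast; ring

theorem IsSOPS.period_gt {α β : ℝ} {f p : ℝ → ℝ} {ω : ℝ} (h : IsSOPS α β f p ω) : 1 < ω := by
  obtain ⟨-, z₀, z₁, z₂, h0, h1, h2, -, -, hω, -⟩ := h
  linarith

/-- For large `β`, every slowly oscillating periodic solution of the scalar equation is linearly
stable: the multiplier `1` is simple and all others lie in the open unit disc. -/
theorem exists_scalar_stable {α : ℝ} (hα : 0 ≤ α) {f : ℝ → ℝ} (hf : BoundedNegativeFeedback f) :
    ∃ β₀ : ℝ, 0 < β₀ ∧ ∀ (β : ℝ) (p : ℝ → ℝ) (ω : ℝ), β₀ < β → IsSOPS α β f p ω →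
      ∃ q : History ℂ, q ≠ 0 ∧ extendedMonodromy α β f p ω 1 q = q ∧
        (∀ ψ ∈ Module.End.maxGenEigenspace (extendedMonodromy α β f p ω 1).toLinearMap 1,
          ∃ a : ℂ, ψ = a • q) ∧
        ∀ (μ : ℂ) (ψ : History ℂ), ψ ≠ 0 → extendedMonodromy α β f p ω 1 ψ = μ • ψ →
          1 ≤ ‖μ‖ → μ = 1 := by
  obtain ⟨β₀, τ, hβ₀, hτ, hτ4, hmain⟩ := exists_contraction hα hf
  refine ⟨β₀, hβ₀, fun β p ω hβ h => ?_⟩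
  have hω := h.period_gt
  have hω0 : 0 ≤ ω := by linarith
  have hp := h.1.1
  set M := extendedMonodromy α β f p ω 1 with hMdef
  set k := delayCoeff β f p with hk
  have hM := isSolutionOperator_extendedMonodromy (β := β) hα hf.contDiff hω0 hp 1
  rw [← hMdef, ← hk] at hM
  obtain ⟨u, z₀, z, y', hz₀, hωz, hu, hpu⟩ := h.exists_profile (hβ₀.trans hβ)
  obtain ⟨hqsol, hq0, hcontr⟩ := hmain β u z y' hβ hu
  rw [← hωz] at hcontr
  have huper : Function.Periodic u ω := fun t => by rw [hωz]; exact hu.periodic t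
  set F : ℝ → ℝ := fun v => f (β * v) with hF
  set q := IsProfile.velocity α F u with hq
  set K : ℝ → ℝ := fun s => β * deriv f (β * u s) with hK
  have hqper : Function.Periodic q ω := fun t => by
    simp only [hq, IsProfile.velocity]
    rw [huper, show t + ω - 1 = t - 1 + ω by ring, huper]
  have hqc : Continuous q := by
    have hFc : Continuous F := hf.contDiff.continuous.comp (continuous_const_mul β)
    exact Complex.continuous_ofReal.comp ((continuous_const.mul hu.continuous).add
      (hFc.comp (hu.continuous.comp (continuous_sub_right 1))))
  have hkK : ∀ t, 0 < t → k t = K (t - 1 - z₀) := fun t ht => by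
    simp only [hk, delayCoeff, hK]
    rw [hpu (t - 1) (by linarith)]
  have hKper : Function.Periodic K ω := fun t => by simp only [hK]; rw [huper]
  have hkper : ∀ t, 0 < t → k (t + ω) = k t := fun t ht => by
    rw [hkK t ht, hkK _ (by linarith), show t + ω - 1 - z₀ = t - 1 - z₀ + ω by ring, hKper]
  -- the derivative of the periodic solution, as a solution of the variational equation
  set w : ℝ → ℂ := fun t => q (t - z₀) with hw
  have hwsol : IsDDESolution (delayRHS α k ((1 : ℂ) • ContinuousLinearMap.id ℂ ℂ)) w := by
    obtain ⟨m, hm⟩ := exists_nat_ge z₀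
    have hmω : 0 ≤ m * ω - z₀ := by nlinarith [Nat.cast_nonneg (α := ℝ) m]
    have h1 := hqsol.shift_linear hmω
    have h2 : (fun t => q (t + (m * ω - z₀))) = w := by
      funext t
      rw [hw, show t + (m * ω - z₀) = t - z₀ + m * ω by ring]
      exact hqper.nat_mul m _
    rw [h2] at h1
    refine h1.congr fun t ht a b => ?_
    have h3 : K (t - 1 + (m * ω - z₀)) = k t := by
      rw [hkK t ht, show t - 1 + (m * ω - z₀) = t - 1 - z₀ + m * ω by ring]
      exact hKper.nat_mul m _
    simp only [linearRHS, delayRHS]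
    rw [h3]
    simp
  let q₀ : History ℂ := ⟨fun θ => w θ, hqc.comp (by fun_prop)⟩
  have hq₀ : HasHistory w 0 q₀ := fun θ => by rw [zero_add]; rfl
  have hMq : M q₀ = q₀ := by
    ext θ
    rw [hM.hasHistory hω0 hwsol hq₀ θ]
    change q (ω + θ - z₀) = q (θ - z₀)
    rw [show ω + θ - z₀ = θ - z₀ + ω by ring, hqper]
  have hq₀0 : q₀ ≠ 0 := fun h0 => by
    have h1 := delay_unique (x := w) (y := fun _ => 0) hwsol
      ⟨continuousOn_const, fun t _ => (hasDerivAt_const t (0 : ℂ)).congr_deriv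
        (by simp [delayRHS])⟩ (fun θ hθ => congrArg (fun χ : History ℂ => χ ⟨θ, hθ⟩) h0) z₀ hz₀
    rw [hw] at h1
    simp only [sub_self] at h1
    exact hq0 h1
  -- any solution of the variational equation, in the time of the profile
  set T := z₀ + ω with hT
  have hT0 : 0 ≤ T := by linarith
  have htrans : ∀ {x : ℝ → ℂ},
      IsDDESolution (delayRHS α k ((1 : ℂ) • ContinuousLinearMap.id ℂ ℂ)) x →
      IsDDESolution (linearRHS α K) fun t => x (t + T) := fun {x} hx => by
    refine ⟨hx.1.comp (by fun_prop) fun t ht => ?_, fun t ht => ?_⟩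
    · simp only [mem_Ici] at ht ⊢; linarith
    · refine ((hx.2 (t + T) (by linarith)).comp_add_const t T).congr_deriv ?_
      have h3 : k (t + T) = K (t - 1) := by
        rw [hkK _ (by linarith), show t + T - 1 - z₀ = t - 1 + ω by rw [hT]; ring, hKper]
      simp only [linearRHS, delayRHS]
      rw [h3, show t + T - 1 = t - 1 + T by ring]
      simp
  -- the transversal part of a history, after transport to the window `[-τ, 1 - τ]`
  have hkc := continuousOn_delayCoeff (β := β) hf.contDiff hp
  have hB : ContinuousOn (fun t => (k t : ℂ) • ((1 : ℂ) • ContinuousLinearMap.id ℂ ℂ)) (Ici 0) :=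
    (Complex.continuous_ofReal.comp_continuousOn hkc).smul continuousOn_const
  obtain ⟨S, hS, -⟩ := existsUnique_isSolutionOperator hα
    (delayRHS_eq α k ((1 : ℂ) • ContinuousLinearMap.id ℂ ℂ)) hB
    (show 0 ≤ T + (1 - τ) by linarith)
  let qW : History ℂ := ⟨fun θ => q (1 - τ + θ), hqc.comp (by fun_prop)⟩
  let θ₀ : Icc (-1 : ℝ) 0 := ⟨τ - 1, by linarith, by linarith⟩
  let L : History ℂ →ₗ[ℂ] History ℂ :=
    { toFun := fun ψ => S ψ - (S ψ θ₀ / q 0) • qW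
      map_add' := fun ψ φ => by ext θ; simp; ring
      map_smul' := fun a ψ => by ext θ; simp; ring }
  have hLapply : ∀ {x : ℝ → ℂ} {ψ : History ℂ},
      IsDDESolution (delayRHS α k ((1 : ℂ) • ContinuousLinearMap.id ℂ ℂ)) x → HasHistory x 0 ψ →
      ∀ θ : Icc (-1 : ℝ) 0, L ψ θ = x (1 - τ + θ + T) - x T / q 0 * q (1 - τ + θ) := by
    intro x ψ hx hx0 θ
    have h1 := hS.hasHistory (by linarith) hx hx0
    change S ψ θ - S ψ θ₀ / q 0 * q (1 - τ + θ) = _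
    rw [h1 θ, h1 θ₀, show T + (1 - τ) + (θ : ℝ) = 1 - τ + θ + T by ring,
      show T + (1 - τ) + (θ₀ : ℝ) = T by change T + (1 - τ) + (τ - 1) = T; ring]
  have hwindow : ∀ {x : ℝ → ℂ} {ψ : History ℂ},
      IsDDESolution (delayRHS α k ((1 : ℂ) • ContinuousLinearMap.id ℂ ℂ)) x → HasHistory x 0 ψ →
      ∀ t ∈ Icc (-τ) (1 - τ), ‖x (t + T) - x T / q 0 * q t‖ ≤ ‖L ψ‖ := by
    intro x ψ hx hx0 t ht
    have h1 := hLapply hx hx0 ⟨t - (1 - τ), by linarith [ht.1], by linarith [ht.2]⟩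
    rw [show 1 - τ + (t - (1 - τ)) = t by ring] at h1
    rw [← h1]
    exact ContinuousMap.norm_coe_le_norm _ _
  have hqω : q ω = q 0 := by rw [← hqper 0, zero_add]
  have hL : ∀ ψ, ‖L (M ψ)‖ ≤ 1 / 2 * ‖L ψ‖ := by
    intro ψ
    obtain ⟨x, hx, hx0, hx1⟩ := hM ψ
    refine (ContinuousMap.norm_le _ (by positivity)).2 fun θ => ?_
    have h1 := hLapply (hx.shift_period hω0 hkper) (ψ := M ψ)
      (fun θ => by rw [hx1 θ]; congr 1; ring) θ
    have h2 := hcontr _ ‖L ψ‖ ((htrans hx).sub_const_mul hqsol (x T / q 0)) (hwindow hx hx0)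
      (1 - τ + θ + ω) ⟨by linarith [θ.2.1], by linarith [θ.2.2]⟩
    refine le_trans (le_of_eq ?_) h2
    rw [h1, hqω, hqper, show 1 - τ + (θ : ℝ) + ω + T = 1 - τ + θ + T + ω by ring,
      show ω + T = T + ω by ring]
    congr 1
    field_simp
    ring
  have hker : ∀ ψ, L ψ = 0 → ∃ (m : ℕ) (a : ℂ), (M ^ m) ψ = a • q₀ := by
    intro ψ hψ
    obtain ⟨x, hx, hx0, hx1⟩ := hM ψ
    set a := x T / q 0 with ha
    have h1 := (((htrans hx).sub_const_mul hqsol a).shift_linear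
      (show 0 ≤ 1 - τ by linarith))
    have h2 : ∀ t, -1 ≤ t → x (t + (1 - τ) + T) - a * q (t + (1 - τ)) = 0 := by
      refine dde_unique (α := α) (R := linearRHS α fun s => K (s + (1 - τ)))
        (B := fun t => (K (t - 1 + (1 - τ)) : ℂ) • ContinuousLinearMap.id ℂ ℂ)
        (fun t u v => by simp [linearRHS]) h1 (y := fun _ => 0)
        ⟨continuousOn_const, fun t _ => (hasDerivAt_const t (0 : ℂ)).congr_deriv
          (by simp [linearRHS])⟩ fun θ hθ => ?_
      have h3 := hwindow hx hx0 (θ + (1 - τ)) ⟨by linarith [hθ.1], by linarith [hθ.2]⟩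
      rw [hψ, norm_zero] at h3
      exact norm_le_zero_iff.1 h3
    obtain ⟨m, hm⟩ := exists_nat_ge (T + 1)
    refine ⟨m, a, ?_⟩
    ext θ
    have hmω : (m : ℝ) ≤ m * ω := by nlinarith [Nat.cast_nonneg (α := ℝ) m]
    have h3 := h2 (m * ω + θ - T - (1 - τ)) (by linarith [θ.2.1])
    rw [show m * ω + (θ : ℝ) - T - (1 - τ) + (1 - τ) = m * ω + θ - T by ring,
      sub_add_cancel] at h3
    have h4 : q (m * ω + θ - T) = q (θ - z₀) := by
      rw [← hqper (m * ω + θ - T), show m * ω + (θ : ℝ) - T + ω = θ - z₀ + m * ω by rw [hT]; ring]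
      exact hqper.nat_mul m _
    rw [hM.pow_apply hω0 hkper hx hx0 m θ, sub_eq_zero.1 h3, h4]
    rfl
  have hker' : ∀ ψ, L ψ = 0 → ∃ (m : ℕ) (a : ℂ),
      ((M.toLinearMap : Module.End ℂ (History ℂ)) ^ m) ψ = a • q₀ := fun ψ hψ => by
    obtain ⟨m, a, hm⟩ := hker ψ hψ
    refine ⟨m, a, ?_⟩
    rw [← hm, ← ContinuousLinearMap.toLinearMap_pow]
    rfl
  obtain ⟨h1, h2⟩ := eigen_of_contraction (M := (M.toLinearMap : Module.End ℂ (History ℂ)))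
    (L := L) (q := q₀) hMq hL hker'
  exact ⟨q₀, hq₀0, hMq, h1, h2⟩

/-! ### The coupled system -/

/-- The complexified coupling matrix as an operator on `ℂⁿ`. -/
noncomputable def couplingOperator {n : ℕ} (G : Matrix (Fin n) (Fin n) ℝ) :
    EuclideanSpace ℂ (Fin n) →L[ℂ] EuclideanSpace ℂ (Fin n) :=
  LinearMap.toContinuousLinearMap (Matrix.toEuclideanLin (G.map (fun x : ℝ => (x : ℂ))))

section

variable {n : ℕ} {G : Matrix (Fin n) (Fin n) ℝ}

theorem couplingOperator_apply (v : EuclideanSpace ℂ (Fin n)) (j : Fin n) :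
    couplingOperator G v j = ∑ l, (G j l : ℂ) * v l := rfl

theorem mem_matrixSpectrum_iff {lam : ℂ} : lam ∈ matrixSpectrum G ↔
    Module.End.HasEigenvalue
      ((couplingOperator G).toLinearMap : Module.End ℂ (EuclideanSpace ℂ (Fin n))) lam := by
  rw [matrixSpectrum, ← Matrix.spectrum_toLpLin 2, Module.End.hasEigenvalue_iff_mem_spectrum]
  rfl

theorem isSimpleEigenvalue_couplingOperator {μ : ℂ} {v : EuclideanSpace ℂ (Fin n)} (hv : v ≠ 0)
    (hGv : couplingOperator G v = μ • v)
    (h : IsSimpleEigenvalue (Matrix.toLin' (G.map (fun x : ℝ => (x : ℂ)))) μ) :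
    IsSimpleEigenvalue
      ((couplingOperator G).toLinearMap : Module.End ℂ (EuclideanSpace ℂ (Fin n))) μ := by
  set A : Module.End ℂ (Fin n → ℂ) := Matrix.toLin' (G.map (fun x : ℝ => (x : ℂ))) with hA
  have hpow : ∀ (m : ℕ) (ψ : EuclideanSpace ℂ (Fin n)),
      ((A - μ • (1 : Module.End ℂ (Fin n → ℂ))) ^ m) (WithLp.ofLp ψ) =
        WithLp.ofLp ((((couplingOperator G).toLinearMap -
          μ • (1 : Module.End ℂ (EuclideanSpace ℂ (Fin n)))) ^ m) ψ) := by
    intro m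
    induction m with
    | zero => intro ψ; rfl
    | succ m ih =>
      intro ψ
      rw [pow_succ, pow_succ, Module.End.mul_apply, Module.End.mul_apply, ← ih]
      rfl
  refine isSimpleEigenvalue_of_span hv hGv fun ψ hψ => ?_
  obtain ⟨m, hm⟩ := (Module.End.mem_maxGenEigenspace _ _ _).1 hψ
  obtain ⟨a, ha⟩ := h.exists_smul (q := WithLp.ofLp v)
    (fun h0 => hv (WithLp.ofLp_injective 2 h0)) (congrArg WithLp.ofLp hGv)
    (ψ := WithLp.ofLp ψ) ((Module.End.mem_maxGenEigenspace _ _ _).2 ⟨m, by rw [hpow, hm]; rfl⟩)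
  exact ⟨a, WithLp.ofLp_injective 2 ha⟩

theorem exists_couplingOperator_fixed [NeZero n] (hG : ∀ j, ∑ k, G j k = 1) :
    ∃ v : EuclideanSpace ℂ (Fin n), v ≠ 0 ∧ couplingOperator G v = v := by
  refine ⟨WithLp.toLp 2 fun _ => 1, fun h => ?_, ?_⟩
  · simpa using congrArg (fun u : EuclideanSpace ℂ (Fin n) => u 0) h
  · ext j
    rw [couplingOperator_apply]
    simp only [mul_one]
    exact_mod_cast hG j

theorem isSolutionOperator_monodromy {α β : ℝ} (hα : 0 ≤ α) {f p : ℝ → ℝ}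
    (hf : ContDiff ℝ 1 f) {ω : ℝ} (hω : 0 ≤ ω) {P : ℝ → EuclideanSpace ℝ (Fin n)}
    (hP : ContinuousOn P (Ici (-1))) (hPp : ∀ t, -1 ≤ t → ∀ j, P t j = p t) :
    IsSolutionOperator (delayRHS α (delayCoeff β f p) (couplingOperator G)) ω
      (monodromy α β f G P ω) := by
  refine (monodromy_spec hα hf hP hω).congr fun t ht u v => ?_
  ext j
  simp only [variationalRHS, delayRHS, delayCoeff, PiLp.add_apply, PiLp.neg_apply,
    PiLp.smul_apply, couplingOperator_apply, Complex.real_smul, hPp (t - 1) (by linarith)]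
  simp only [Complex.ofReal_mul, neg_mul, Finset.mul_sum]
  congr 1
  refine Finset.sum_congr rfl fun l _ => ?_
  ring

end

theorem nnnorm_le_spectralRadius {A : Type*} [Ring A] [Algebra ℂ A] {a : A} {μ : ℂ}
    (h : μ ∈ spectrum ℂ a) : (‖μ‖₊ : ENNReal) ≤ spectralRadius ℂ a :=
  le_iSup₂ (f := fun (k : ℂ) (_ : k ∈ spectrum ℂ a) => (‖k‖₊ : ENNReal)) μ h

theorem theorem5 (α : ℝ) (hα : 0 ≤ α) (f : ℝ → ℝ) (hf : BoundedNegativeFeedback f) :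
    ∃ β₀ : ℝ, 0 < β₀ ∧ ∀ β : ℝ, β₀ < β → ∀ n : ℕ, 2 ≤ n →
      ∀ G : Matrix (Fin n) (Fin n) ℝ, (∀ j, ∑ k, G j k = 1) →
      ∀ (P : ℝ → EuclideanSpace ℝ (Fin n)) (p : ℝ → ℝ) (ω : ℝ),
        IsSynchronousSOPS α β f G P p ω →
        spectrum ℂ (monodromy α β f G P ω) =
            ⋃ lam ∈ matrixSpectrum G, spectrum ℂ (extendedMonodromy α β f p ω lam) ∧
        ((∀ lam ∈ matrixSpectrumMinusOne G,
            spectralRadius ℂ (extendedMonodromy α β f p ω lam) < 1) →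
          IsLinearlyStable α β f G P ω) ∧
        ((∃ lam ∈ matrixSpectrum G,
            1 < spectralRadius ℂ (extendedMonodromy α β f p ω lam)) →
          IsLinearlyUnstable α β f G P ω) := by
  obtain ⟨β₀, hβ₀, hscalar⟩ := exists_scalar_stable hα hf
  refine ⟨β₀, hβ₀, fun β hβ n hn G hG P p ω hP => ?_⟩
  obtain ⟨hPsol, hp, hPp⟩ := hP
  obtain ⟨q, hq0, hMq, hspan, hmult⟩ := hscalar β p ω hβ hp
  have hω := hp.period_gt
  have hω0 : 0 ≤ ω := by linarith
  have hk := continuousOn_delayCoeff (β := β) hf.contDiff hp.1.1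
  have hM := isSolutionOperator_monodromy (G := G) (β := β) hα hf.contDiff hω0 hPsol.1 hPp
  have hM' := isSolutionOperator_extendedMonodromy (β := β) hα hf.contDiff hω0 hp.1.1
  have : NeZero n := ⟨by omega⟩
  have : Nontrivial (EuclideanSpace ℂ (Fin n)) := inferInstance
  -- the synchronous direction
  obtain ⟨v, hv0, hGv⟩ := exists_couplingOperator_fixed hG
  have h1mem : (1 : ℂ) ∈ matrixSpectrum G :=
    mem_matrixSpectrum_iff.2 (Module.End.hasEigenvalue_of_hasEigenvector
      (Module.End.hasEigenvector_iff.2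
        ⟨Module.End.mem_eigenspace_iff.2 (by rw [one_smul]; exact hGv), hv0⟩))
  have hone : ∀ (lam : ℂ) (φ : History ℂ), φ ≠ 0 → extendedMonodromy α β f p ω lam φ = φ →
      ¬ spectralRadius ℂ (extendedMonodromy α β f p ω lam) < 1 := by
    intro lam φ h0 h1 h2
    have h3 : (1 : ℂ) ∈ spectrum ℂ (extendedMonodromy α β f p ω lam) := by
      rw [(hM' lam).mem_spectrum_iff hα hω hk one_ne_zero]
      exact ⟨φ, h0, by rw [h1, one_smul]⟩
    have h4 := (nnnorm_le_spectralRadius h3).trans_lt h2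
    simp only [nnnorm_one, ENNReal.coe_one, lt_irrefl] at h4
  have hspec : spectrum ℂ (monodromy α β f G P ω) =
      ⋃ lam ∈ matrixSpectrum G, spectrum ℂ (extendedMonodromy α β f p ω lam) := by
    rw [spectrum_coupled hα hω hk hM hM']
    ext μ
    simp only [mem_iUnion, mem_ofPred_eq, exists_prop, mem_matrixSpectrum_iff]
  refine ⟨hspec, fun hstab => ?_, ?_⟩
  · -- otherwise `1` belongs to `matrixSpectrumMinusOne G`, while `1` is an eigenvalue of `M₁`
    have hsimple : IsSimpleEigenvalue (Matrix.toLin' (G.map (fun x : ℝ => (x : ℂ)))) 1 := by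
      by_contra h
      exact hone 1 q hq0 hMq (hstab 1 ⟨h1mem, fun h' => absurd h' h⟩)
    refine ⟨?_, fun μ hμ hμ1 => ?_⟩
    · refine isSimpleEigenvalue_coupled hω0 hM hM'
        (isSimpleEigenvalue_couplingOperator hv0 (by rw [one_smul]; exact hGv) hsimple) hv0 hGv
        (fun lam hlam heig φ hφ => ?_) hq0 hMq hspan
      by_contra h0
      exact hone lam φ h0 hφ (hstab lam ⟨mem_matrixSpectrum_iff.2 heig, fun _ => hlam⟩)
    · obtain ⟨hμs, hμ0⟩ := hμ
      rw [hspec] at hμs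
      simp only [mem_iUnion, exists_prop] at hμs
      obtain ⟨lam, hlam, hμlam⟩ := hμs
      by_cases h1 : lam = 1
      · rw [h1, (hM' 1).mem_spectrum_iff hα hω hk hμ0] at hμlam
        obtain ⟨ψ, h0, hψ⟩ := hμlam
        by_contra! h2
        exact hμ1 (hmult μ ψ h0 hψ h2)
      · have h2 := (nnnorm_le_spectralRadius hμlam).trans_lt (hstab lam ⟨hlam, fun _ => h1⟩)
        exact_mod_cast h2
  · rintro ⟨lam, hlam, hρ⟩
    obtain ⟨μ, hμ⟩ := lt_iSup_iff.1 hρ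
    obtain ⟨hμs, hμ1⟩ := lt_iSup_iff.1 hμ
    have h1 : 1 < ‖μ‖ := by exact_mod_cast hμ1
    refine ⟨μ, ⟨?_, fun h0 => ?_⟩, h1⟩
    · rw [hspec]
      exact mem_biUnion hlam hμs
    · rw [h0, norm_zero] at h1
      linarith
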